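/- Let $(\bar M,\phi,\xi,\eta,g)$ be a nearly cosymplectic manifold, that is, a smooth Riemannian manifold with a smooth $(1,1)$-tensor field $\phi$, vector field $\xi$ and $1$-form $\eta$ such that $\phi^2=-I+\eta\otimes\xi$, $\phi\xi=0$, $\eta\circ\phi=0$, $\eta(\xi)=1$, $\eta(X)=g(X,\xi)$, $g(\phi X,\phi Y)=g(X,Y)-\eta(X)\eta(Y)$ and $(\bar\nabla_X\phi)Y+(\bar\nabla_Y\phi)X=0$ for all vector fields $X,Y$, where $\bar\nabla$ is the Riemannian connection of $g$. Let $(N_T,g_T)$ and $(N_\theta,g_\theta)$ be Riemannian manifolds, $f>0$ a smooth function on $N_T$, and let $M=N_T\times_f N_\theta$, i.e. $N_T\times N_\theta$ with the metric $g_T+f^2g_\theta$, be isometrically immersed in $\bar M$ as a warped product semi-slant submanifold with slant angle $\theta$: $\xi$ is tangent to the leaves $N_T\times\{b\}$; each leaf $N_T\times\{b\}$ is invariant ($\phi X$ is tangent to it for every tangent $X$); and each leaf $\{a\}\times N_\theta$ is proper slant with the same angle $\theta$ (for every tangent vector $X$ not proportional to $\xi$ the angle between $\phi X$ and the tangent space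 of the leaf is $\theta$, and the leaf is neither invariant nor anti-invariant, where anti-invariant means that $\phi X$ is normal to the leaf for every tangent $X$). Let $\dim N_\theta=2q$, let $h$ be the second fundamental form of $M$ in $\bar M$, $\|h\|^2=\sum_{i,j}g(h(e_i,e_j),h(e_i,e_j))$ for an orthonormal frame $(e_i)$ of $M$, and let $\nabla\ln f$ be the gradient of $\ln f$ on $M$. Then: (i) At every point of $M$, $$\|h\|^2\ \ge\ 4q\csc^2\theta\,\Bigl(1+\tfrac19\cos^2\theta\Bigr)\,\|\nabla\ln f\|^2 .$$ (ii) If equality holds in (i) at every point of $M$, then $N_T$ is totally geodesic in $\bar M$ (every leaf $N_T\times\{b\}$ has vanishing second fundamental form), $N_\theta$ is totally umbilical in $\bar M$ (the second fundamental form $h_a$ of every leaf $\{a\}\times N_\theta$ satisfies $h_a(Z,W)=g(Z,W)H_a$, with $H_a$ its mean curvature vector), and $M$ is minimal in $\bar M$ (its mean curvature vector vanishes). -/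

import Mathlib

open Bundle Manifold
open scoped ContDiff

noncomputable section

namespace WarpedSemiSlant

/-! ### The Riemannian connection

`M` is a smooth manifold without boundary, modelled on a finite-dimensional space `E`, with a smooth
Riemannian metric `inner ℝ` on its tangent spaces. The tangent space at `x` is identified with `E`
by the differential of the preferred chart `extChartAt 𝓘(ℝ, E) x`, so the coordinate formulas below,
evaluated at `x` in that chart, take values in the tangent space at `x`. -/

/-- The identification of the tangent space at `x` with the model space by the preferred chart
at `x` (in Mathlib, the identity map). -/
def tangentCoord {F : Type*} [NormedAddCommGroup F] [NormedSpace ℝ F]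
    {H : Type*} [TopologicalSpace H] (I : ModelWithCorners ℝ F H)
    {N : Type*} [TopologicalSpace N] [ChartedSpace H N] (x : N) : TangentSpace I x ≃L[ℝ] F :=
  ContinuousLinearEquiv.refl ℝ F

section Connection

variable {E : Type*} [NormedAddCommGroup E] [NormedSpace ℝ E]
  {M : Type*} [TopologicalSpace M] [ChartedSpace E M]

/-- The coordinate vector field `∑ wⁱ ∂ᵢ` of the preferred chart at `x`, at the point of coordinates
`y`. -/
def coordVec (x : M) (y : E) (w : E) :
    TangentSpace 𝓘(ℝ, E) ((extChartAt 𝓘(ℝ, E) x).symm y) :=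
  mfderiv 𝓘(ℝ, E) 𝓘(ℝ, E) (extChartAt 𝓘(ℝ, E) x).symm y
    ((tangentCoord 𝓘(ℝ, E) y).symm w)

/-- The coordinates, in the preferred chart at `x`, of a vector field `Y`, as a function of the
coordinates `y` of the point. -/
def coordRep (x : M) (Y : ∀ p : M, TangentSpace 𝓘(ℝ, E) p) (y : E) : E :=
  tangentCoord 𝓘(ℝ, E) _
    (mfderiv 𝓘(ℝ, E) 𝓘(ℝ, E) (extChartAt 𝓘(ℝ, E) x) ((extChartAt 𝓘(ℝ, E) x).symm y)
      (Y ((extChartAt 𝓘(ℝ, E) x).symm y)))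

variable [RiemannianBundle (fun p : M ↦ TangentSpace 𝓘(ℝ, E) p)]

/-- The metric coefficient `y ↦ g(∂_v, ∂_w)` in the preferred chart at `x`. -/
def metricCoeff (x : M) (v w : E) (y : E) : ℝ :=
  inner ℝ (coordVec x y v) (coordVec x y w)

/-- The derivative of the metric coefficient `g(∂_v, ∂_w)` in the direction `u`, at `x`. -/
def metricDeriv (x : M) (u v w : E) : ℝ :=
  fderiv ℝ (metricCoeff x v w) (extChartAt 𝓘(ℝ, E) x x) u

/-- The right-hand side of Koszul's formula for the coordinate fields `∂_v, ∂_w, ∂_z`, at `x`. -/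
def koszul (x : M) (v w z : E) : ℝ :=
  (metricDeriv x v w z + metricDeriv x w v z - metricDeriv x z v w) / 2

/-- The Christoffel symbols at `x` in the preferred chart at `x`: `christoffel x v w` is the vector
`∇_v ∂_w`, characterized by
`g(∇_v ∂_w, z) = 1/2 (v g(∂_w, ∂_z) + w g(∂_v, ∂_z) - z g(∂_v, ∂_w))`. -/
def christoffel (x : M) (v w : TangentSpace 𝓘(ℝ, E) x) : TangentSpace 𝓘(ℝ, E) x :=
  Classical.epsilon fun u : TangentSpace 𝓘(ℝ, E) x ↦ ∀ z : TangentSpace 𝓘(ℝ, E) x,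
    inner ℝ u z = koszul x (tangentCoord 𝓘(ℝ, E) x v) (tangentCoord 𝓘(ℝ, E) x w)
      (tangentCoord 𝓘(ℝ, E) x z)

/-- The covariant derivative `∇_v Y` of the Riemannian connection at `x`. -/
def covDeriv (Y : ∀ p : M, TangentSpace 𝓘(ℝ, E) p) (x : M) (v : TangentSpace 𝓘(ℝ, E) x) :
    TangentSpace 𝓘(ℝ, E) x :=
  (tangentCoord 𝓘(ℝ, E) x).symm
      (fderiv ℝ (coordRep x Y) (extChartAt 𝓘(ℝ, E) x x) (tangentCoord 𝓘(ℝ, E) x v)) +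
    christoffel x v (Y x)

end Connection

/-! ### Nearly cosymplectic structures -/

section Structures

variable (E : Type*) [NormedAddCommGroup E] [NormedSpace ℝ E]
  (M : Type*) [TopologicalSpace M] [ChartedSpace E M] [IsManifold 𝓘(ℝ, E) ∞ M]
  [RiemannianBundle (fun p : M ↦ TangentSpace 𝓘(ℝ, E) p)]

/-- An almost contact metric structure `(φ, ξ, η, g)`; `g` is the given Riemannian metric. -/
structure AlmostContactMetricStructure where
  φ : ∀ x : M, TangentSpace 𝓘(ℝ, E) x →L[ℝ] TangentSpace 𝓘(ℝ, E) x
  ξ : ∀ x : M, TangentSpace 𝓘(ℝ, E) x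
  η : ∀ x : M, TangentSpace 𝓘(ℝ, E) x →L[ℝ] ℝ
  smooth_φ : ContMDiff 𝓘(ℝ, E) (𝓘(ℝ, E).prod 𝓘(ℝ, E →L[ℝ] E)) ∞
    (fun x ↦ TotalSpace.mk' (E →L[ℝ] E)
      (E := fun x : M ↦ TangentSpace 𝓘(ℝ, E) x →L[ℝ] TangentSpace 𝓘(ℝ, E) x) x (φ x))
  smooth_ξ : ContMDiff 𝓘(ℝ, E) (𝓘(ℝ, E).prod 𝓘(ℝ, E)) ∞
    (fun x ↦ TotalSpace.mk' E (E := fun x : M ↦ TangentSpace 𝓘(ℝ, E) x) x (ξ x))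
  smooth_η : ContMDiff 𝓘(ℝ, E) (𝓘(ℝ, E).prod 𝓘(ℝ, E →L[ℝ] ℝ)) ∞
    (fun x ↦ TotalSpace.mk' (E →L[ℝ] ℝ)
      (E := fun x : M ↦ TangentSpace 𝓘(ℝ, E) x →L[ℝ] Bundle.Trivial M ℝ x) x (η x))
  φ_φ : ∀ x v, φ x (φ x v) = -v + η x v • ξ x
  φ_ξ : ∀ x, φ x (ξ x) = 0
  η_φ : ∀ x v, η x (φ x v) = 0
  η_ξ : ∀ x, η x (ξ x) = 1
  η_eq_inner : ∀ x v, η x v = inner ℝ v (ξ x)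
  inner_φ_φ : ∀ x v w, inner ℝ (φ x v) (φ x w) = inner ℝ v w - η x v * η x w

variable {E M}

/-- `(∇_X φ) Y = ∇_X (φ Y) - φ (∇_X Y)` at `x`. -/
def AlmostContactMetricStructure.covDerivPhi (S : AlmostContactMetricStructure E M)
    (X Y : ∀ p : M, TangentSpace 𝓘(ℝ, E) p) (x : M) : TangentSpace 𝓘(ℝ, E) x :=
  covDeriv (fun p ↦ S.φ p (Y p)) x (X x) - S.φ x (covDeriv Y x (X x))

/-- The structure is nearly cosymplectic: `(∇_X φ) Y + (∇_Y φ) X = 0` for all (locally defined)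
smooth vector fields `X`, `Y`. -/
def AlmostContactMetricStructure.IsNearlyCosymplectic (S : AlmostContactMetricStructure E M) :
    Prop :=
  ∀ (x : M) (X Y : ∀ p : M, TangentSpace 𝓘(ℝ, E) p),
    ContMDiffAt 𝓘(ℝ, E) (𝓘(ℝ, E).prod 𝓘(ℝ, E)) ∞
      (fun p ↦ TotalSpace.mk' E (E := fun p : M ↦ TangentSpace 𝓘(ℝ, E) p) p (X p)) x →
    ContMDiffAt 𝓘(ℝ, E) (𝓘(ℝ, E).prod 𝓘(ℝ, E)) ∞
      (fun p ↦ TotalSpace.mk' E (E := fun p : M ↦ TangentSpace 𝓘(ℝ, E) p) p (Y p)) x →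
    S.covDerivPhi X Y x + S.covDerivPhi Y X x = 0

end Structures

/-! ### Immersed submanifolds

`ι : N → M` is a smooth immersion; `N` has no boundary and carries the metric induced by `ι`. -/

section Submanifolds

variable (E : Type*) [NormedAddCommGroup E] [NormedSpace ℝ E]
  {M : Type*} [TopologicalSpace M] [ChartedSpace E M]
  [RiemannianBundle (fun p : M ↦ TangentSpace 𝓘(ℝ, E) p)]
  {F : Type*} [NormedAddCommGroup F] [NormedSpace ℝ F]
  {H : Type*} [TopologicalSpace H] (I : ModelWithCorners ℝ F H)
  {N : Type*} [TopologicalSpace N] [ChartedSpace H N]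

/-- The tangent space of the submanifold at `x`, as a subspace of the ambient tangent space. -/
def tangentImage (ι : N → M) (x : N) : Submodule ℝ (TangentSpace 𝓘(ℝ, E) (ι x)) :=
  LinearMap.range (mfderiv I 𝓘(ℝ, E) ι x).toLinearMap

/-- The induced metric. -/
def inducedInner (ι : N → M) (x : N) (v w : TangentSpace I x) : ℝ :=
  inner ℝ (mfderiv I 𝓘(ℝ, E) ι x v) (mfderiv I 𝓘(ℝ, E) ι x w)

/-- The gradient of `u : N → ℝ` for the induced metric: the vector with `g(∇u, v) = v u`. -/
def inducedGradient (ι : N → M) (u : N → ℝ) (x : N) : TangentSpace I x :=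
  Classical.epsilon fun w : TangentSpace I x ↦ ∀ v : TangentSpace I x,
    inducedInner E I ι x w v = tangentCoord 𝓘(ℝ, ℝ) (u x) (mfderiv I 𝓘(ℝ, ℝ) u x v)

/-- `‖∇u‖²` for the induced metric. -/
def gradNormSq (ι : N → M) (u : N → ℝ) (x : N) : ℝ :=
  inducedInner E I ι x (inducedGradient E I ι u x) (inducedGradient E I ι u x)

variable [FiniteDimensional ℝ E]

instance (p : M) : FiniteDimensional ℝ (TangentSpace 𝓘(ℝ, E) p) :=
  inferInstanceAs (FiniteDimensional ℝ E)

/-- The component of an ambient tangent vector tangent to the submanifold. -/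
def tangentPart (ι : N → M) (x : N) (v : TangentSpace 𝓘(ℝ, E) (ι x)) :
    TangentSpace 𝓘(ℝ, E) (ι x) :=
  (tangentImage E I ι x).starProjection v

/-- The component of an ambient tangent vector normal to the submanifold. -/
def normalPart (ι : N → M) (x : N) (v : TangentSpace 𝓘(ℝ, E) (ι x)) :
    TangentSpace 𝓘(ℝ, E) (ι x) :=
  v - tangentPart E I ι x v

/-- The ambient covariant derivative along `ι`, in the direction `v` at `x`, of the vector field
`dι(∂_w)`, where `∂_w` is the coordinate vector field of the preferred chart at `x` with value `w`:
in coordinates, with `ι` written as `u`, it is `∂_v ∂_w u + Γ(∂_v u, ∂_w u)`. -/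
def ambientDeriv (ι : N → M) (x : N) (v w : TangentSpace I x) : TangentSpace 𝓘(ℝ, E) (ι x) :=
  (tangentCoord 𝓘(ℝ, E) (ι x)).symm
      (fderiv ℝ (fderiv ℝ (writtenInExtChartAt I 𝓘(ℝ, E) x ι)) (extChartAt I x x)
        (tangentCoord I x v) (tangentCoord I x w)) +
    christoffel (ι x) (mfderiv I 𝓘(ℝ, E) ι x v) (mfderiv I 𝓘(ℝ, E) ι x w)

/-- The second fundamental form `h(v, w)`: the normal component of the ambient covariant derivative
(Gauss formula). -/
def secondFundamentalForm (ι : N → M) (x : N) (v w : TangentSpace I x) :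
    TangentSpace 𝓘(ℝ, E) (ι x) :=
  normalPart E I ι x (ambientDeriv E I ι x v w)

/-- An orthonormal frame of the tangent space of `N` at `x` for the induced metric: vectors whose
images under `dι` form an orthonormal basis of the tangent space of the submanifold. -/
def orthonormalFrame (ι : N → M) (x : N) (i : Fin (Module.finrank ℝ (tangentImage E I ι x))) :
    TangentSpace I x :=
  Classical.choose (stdOrthonormalBasis ℝ (tangentImage E I ι x) i).2

/-- `‖h‖² = ∑ᵢⱼ g(h(eᵢ, eⱼ), h(eᵢ, eⱼ))`. -/
def secondFundamentalFormNormSq (ι : N → M) (x : N) : ℝ :=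
  ∑ i, ∑ j, inner ℝ
    (secondFundamentalForm E I ι x (orthonormalFrame E I ι x i) (orthonormalFrame E I ι x j))
    (secondFundamentalForm E I ι x (orthonormalFrame E I ι x i) (orthonormalFrame E I ι x j))

/-- The mean curvature vector `H = (1/m) ∑ᵢ h(eᵢ, eᵢ)`. -/
def meanCurvature (ι : N → M) (x : N) : TangentSpace 𝓘(ℝ, E) (ι x) :=
  (1 / (Module.finrank ℝ (tangentImage E I ι x) : ℝ)) •
    ∑ i, secondFundamentalForm E I ι x (orthonormalFrame E I ι x i) (orthonormalFrame E I ι x i)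

def IsTotallyGeodesic (ι : N → M) : Prop :=
  ∀ x v w, secondFundamentalForm E I ι x v w = 0

def IsTotallyUmbilical (ι : N → M) : Prop :=
  ∀ x v w, secondFundamentalForm E I ι x v w = inducedInner E I ι x v w • meanCurvature E I ι x

def IsMinimal (ι : N → M) : Prop :=
  ∀ x, meanCurvature E I ι x = 0

variable [IsManifold 𝓘(ℝ, E) ∞ M]

/-- `φ X` is tangent to the submanifold for every tangent `X`. -/
def IsInvariant (S : AlmostContactMetricStructure E M) (ι : N → M) : Prop :=
  ∀ x, ∀ X ∈ tangentImage E I ι x, normalPart E I ι x (S.φ (ι x) X) = 0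

/-- `φ X` is normal to the submanifold for every tangent `X`. -/
def IsAntiInvariant (S : AlmostContactMetricStructure E M) (ι : N → M) : Prop :=
  ∀ x, ∀ X ∈ tangentImage E I ι x, tangentPart E I ι x (S.φ (ι x) X) = 0

/-- The submanifold is slant with slant angle `θ`: for every tangent vector `X` that is nonzero and
not proportional to `ξ`, the angle between `φ X` and the tangent space (that is, between `φ X` and
its tangential component) is `θ`. -/
def IsSlant (S : AlmostContactMetricStructure E M) (ι : N → M) (θ : ℝ) : Prop :=
  ∀ x, ∀ X ∈ tangentImage E I ι x, X ∉ Submodule.span ℝ {S.ξ (ι x)} →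
    InnerProductGeometry.angle (S.φ (ι x) X) (tangentPart E I ι x (S.φ (ι x) X)) = θ

/-- Slant, and neither invariant nor anti-invariant. -/
def IsProperSlant (S : AlmostContactMetricStructure E M) (ι : N → M) (θ : ℝ) : Prop :=
  IsSlant E I S ι θ ∧ ¬ IsInvariant E I S ι ∧ ¬ IsAntiInvariant E I S ι

end Submanifolds

/-! ### Warped product semi-slant submanifolds -/

section Warped

variable (E : Type*) [NormedAddCommGroup E] [NormedSpace ℝ E] [FiniteDimensional ℝ E]
  {M : Type*} [TopologicalSpace M] [ChartedSpace E M] [IsManifold 𝓘(ℝ, E) ∞ M]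
  [RiemannianBundle (fun p : M ↦ TangentSpace 𝓘(ℝ, E) p)]
  (E₁ : Type*) [NormedAddCommGroup E₁] [NormedSpace ℝ E₁]
  {N₁ : Type*} [TopologicalSpace N₁] [ChartedSpace E₁ N₁]
  [RiemannianBundle (fun p : N₁ ↦ TangentSpace 𝓘(ℝ, E₁) p)]
  (E₂ : Type*) [NormedAddCommGroup E₂] [NormedSpace ℝ E₂]
  {N₂ : Type*} [TopologicalSpace N₂] [ChartedSpace E₂ N₂]
  [RiemannianBundle (fun p : N₂ ↦ TangentSpace 𝓘(ℝ, E₂) p)]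

/-- `ι` is an isometric immersion of the warped product `N₁ ×_f N₂`, whose metric is
`g₁ + f² g₂` with `f > 0` a smooth function on `N₁`. -/
structure IsWarpedProductImmersion (f : N₁ → ℝ) (ι : N₁ × N₂ → M) : Prop where
  smooth_f : ContMDiff 𝓘(ℝ, E₁) 𝓘(ℝ, ℝ) ∞ f
  f_pos : ∀ a, 0 < f a
  smooth_ι : ContMDiff (𝓘(ℝ, E₁).prod 𝓘(ℝ, E₂)) 𝓘(ℝ, E) ∞ ι
  isometric : ∀ (a : N₁) (b : N₂) (v₁ w₁ : TangentSpace 𝓘(ℝ, E₁) a)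
    (v₂ w₂ : TangentSpace 𝓘(ℝ, E₂) b),
    inducedInner E (𝓘(ℝ, E₁).prod 𝓘(ℝ, E₂)) ι (a, b)
        ((tangentCoord (𝓘(ℝ, E₁).prod 𝓘(ℝ, E₂)) (a, b)).symm
          (tangentCoord 𝓘(ℝ, E₁) a v₁, tangentCoord 𝓘(ℝ, E₂) b v₂))
        ((tangentCoord (𝓘(ℝ, E₁).prod 𝓘(ℝ, E₂)) (a, b)).symm
          (tangentCoord 𝓘(ℝ, E₁) a w₁, tangentCoord 𝓘(ℝ, E₂) b w₂)) =
      inner ℝ v₁ w₁ + f a ^ 2 * inner ℝ v₂ w₂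

/-- `ι` presents `N₁ ×_f N₂` as a warped product semi-slant submanifold with slant angle `θ`: the
leaves `N₁ × {b}` are invariant and tangent to `ξ`, the leaves `{a} × N₂` are proper slant. -/
structure IsWarpedProductSemiSlant (S : AlmostContactMetricStructure E M) (f : N₁ → ℝ)
    (ι : N₁ × N₂ → M) (θ : ℝ) : Prop extends
    IsWarpedProductImmersion E E₁ E₂ f ι where
  ξ_tangent : ∀ a b, S.ξ (ι (a, b)) ∈ tangentImage E 𝓘(ℝ, E₁) (fun a' ↦ ι (a', b)) a
  invariant : ∀ b, IsInvariant E 𝓘(ℝ, E₁) S (fun a ↦ ι (a, b))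
  properSlant : ∀ a, IsProperSlant E 𝓘(ℝ, E₂) S (fun b ↦ ι (a, b)) θ

end Warped

end WarpedSemiSlant

end

/-! At one point of `M`, write `D` for the differential of the immersion, `B` for the ambient
covariant derivative of coordinate fields, `lam` for the differential of ln f, and `Ω(z, w) = g(φ z,
w)` on vertical vectors (tangent to the slant factor). Let `x` be horizontal (tangent to the
invariant factor), with `φ x = y`. The estimate uses only the mixed part of h and only its
components along `φ w`, `w` vertical.

Differentiating `g(φ x, w) = 0` along `z`, and `Ω(z, w)` along `x`, expresses `ψ(z, x, w) = g((∇_z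
φ) x, w)` and the derivative `dΩ` through the numbers `g(B(x, z), φ w)`. The form `ψ` is totally
skew: in the first two slots by the nearly cosymplectic condition, in the last two because `φ` is
skew. Eliminating `ψ` gives `dΩ = -3 ψ(z, x, w)`, so that `g(h(x, z), φ w) = -lam(y) g(z, w) +
(lam(x) Ω - dΩ/3)(z, w)`.

The first term is diagonal in an orthonormal frame and the bracket vanishes on the diagonal, so
their squares add without a cross term. By the slant condition the sum of the squares of the entries
of `Ω` in a fixed vertical frame scales as the fourth power of f along the invariant factor; hence
`⟨Ω, dΩ⟩ = 2 lam(x) ‖Ω‖²`. The part of `dΩ` proportional to `Ω` is therefore `2 lam(x) Ω`, the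
bracket has component `lam(x) Ω / 3` along `Ω`, and its squared norm is at least `lam(x)² cos²θ / 9`
times the dimension of the slant factor (`le_sum_sq_component`).

The normal parts of `φ e_k` are orthogonal of length |sin θ|, so Bessel's inequality contributes
csc²θ (`le_sum_norm_sq_mixed`). Summing over a horizontal frame produces `‖∇ ln f‖²` from `lam(x)²`,
and again from `lam(φ x)²`, since `∇ ln f` is orthogonal to `ξ` (`lam_reeb`, resting on
`reeb_killing`). Mixed terms occur twice in `‖h‖²`, which gives the constant 4q.

Equality forces h to vanish on pairs of horizontal and on pairs of vertical vectors. Then h has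
trace zero, and the leaf statements follow from the warped product formulas
`inner_horizontal_vertical` and `inner_vertical_horizontal`. The remaining work reads the manifold
data in charts and differentiates the defining identities there (`nearlyCosymplecticChart`,
`warpedChart`, `semiSlantPoint_of_chart`). -/

noncomputable section

namespace WarpedSemiSlant

/-! ### Orthonormal frames pulled back along a linear map, and traces over them. -/

section Frames

variable {V : Type*} [NormedAddCommGroup V] [InnerProductSpace ℝ V]
  {F : Type*} [AddCommGroup F] [Module ℝ F]

/-- The finite family `e` is orthonormal and spanning for the inner product induced by the linear
map `D`. -/
structure IsFrame {κ : Type*} [Fintype κ] (D : F →ₗ[ℝ] V) (e : κ → F) : Prop where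
  orthonormal : Orthonormal ℝ (fun i ↦ D (e i))
  expand : ∀ z, ∑ j, inner ℝ (D (e j)) (D z) • e j = z

variable {κ κ' : Type*} [Fintype κ] [Fintype κ'] {D : F →ₗ[ℝ] V} {e : κ → F} {e' : κ' → F}

theorem IsFrame.sum_inner_mul_inner (he : IsFrame D e) (z w : F) :
    ∑ j, inner ℝ (D (e j)) (D z) * inner ℝ (D (e j)) (D w) = inner ℝ (D z) (D w) := by
  conv_rhs => rw [← he.expand z]
  simp [sum_inner, inner_smul_left]

theorem IsFrame.sum_sq (he : IsFrame D e) (z : F) :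
    ∑ j, inner ℝ (D (e j)) (D z) ^ 2 = ‖D z‖ ^ 2 := by
  rw [← real_inner_self_eq_norm_sq, ← he.sum_inner_mul_inner]
  simp [sq]

/-- The trace does not depend on the frame: expanding one frame in the other leaves the Gram matrix
of the second, which is the identity. The index types may differ, which allows the frame chosen in
the definition of `‖h‖²` to be replaced by one adapted to the product. -/
theorem IsFrame.sum_bilin_eq {W : Type*} [AddCommGroup W] [Module ℝ W]
    (he : IsFrame D e) (he' : IsFrame D e') (β : F →ₗ[ℝ] F →ₗ[ℝ] W) :
    ∑ i, β (e i) (e i) = ∑ j, β (e' j) (e' j) := by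
  classical
  have key : ∀ i, β (e i) (e i) = ∑ j, ∑ k,
      (inner ℝ (D (e i)) (D (e' j)) * inner ℝ (D (e i)) (D (e' k))) • β (e' j) (e' k) := by
    intro i
    conv_lhs => rw [← he'.expand (e i)]
    simp only [map_sum, map_smul, LinearMap.sum_apply, LinearMap.smul_apply, Finset.smul_sum,
      smul_smul]
    rw [Finset.sum_comm]
    simp only [real_inner_comm]
    refine Finset.sum_congr rfl fun j _ ↦ Finset.sum_congr rfl fun k _ ↦ ?_
    rw [mul_comm]
  simp_rw [key]
  rw [Finset.sum_comm]
  refine Finset.sum_congr rfl fun j _ ↦ ?_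
  rw [Finset.sum_comm]
  simp_rw [← Finset.sum_smul, he.sum_inner_mul_inner, orthonormal_iff_ite.mp he'.orthonormal]
  simp

/-- Invariance of the trace, applied to the form `⟨A ·, A ·⟩` in one slot at a time. -/
theorem IsFrame.sum_sum_norm_sq_eq {W : Type*} [NormedAddCommGroup W] [InnerProductSpace ℝ W]
    (he : IsFrame D e) (he' : IsFrame D e') (h : F →ₗ[ℝ] F →ₗ[ℝ] W) :
    ∑ i, ∑ j, ‖h (e i) (e j)‖ ^ 2 = ∑ i, ∑ j, ‖h (e' i) (e' j)‖ ^ 2 := by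
  have h1 : ∀ A : F →ₗ[ℝ] W, ∑ j, ‖A (e j)‖ ^ 2 = ∑ j, ‖A (e' j)‖ ^ 2 := by
    intro A
    simpa using he.sum_bilin_eq he' ((innerₗ W).compl₁₂ A A)
  rw [Finset.sum_congr rfl fun i _ ↦ h1 (h (e i)), Finset.sum_comm]
  refine (Finset.sum_congr rfl fun j _ ↦ ?_).trans Finset.sum_comm
  simpa using h1 (h.flip (e' j))

theorem IsFrame.eq_zero_of_sum_norm_sq {W : Type*} [NormedAddCommGroup W] [NormedSpace ℝ W]
    (he : IsFrame D e) (h : F →ₗ[ℝ] F →ₗ[ℝ] W) (h0 : ∑ i, ∑ j, ‖h (e i) (e j)‖ ^ 2 = 0) (x y : F) :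
    h x y = 0 := by
  have h' : ∀ i j, h (e i) (e j) = 0 := by
    intro i j
    have h1 := (Finset.sum_eq_zero_iff_of_nonneg fun _ _ ↦
      Finset.sum_nonneg fun _ _ ↦ sq_nonneg _).mp h0 i (Finset.mem_univ _)
    have h2 := (Finset.sum_eq_zero_iff_of_nonneg fun _ _ ↦ sq_nonneg _).mp h1 j
      (Finset.mem_univ _)
    simpa using h2
  rw [← he.expand x, ← he.expand y]
  simp [h']

theorem IsFrame.of_orthonormalBasis (hD : Function.Injective D)
    (b : OrthonormalBasis κ ℝ (LinearMap.range D)) (hb : ∀ i, D (e i) = b i) : IsFrame D e where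
  orthonormal := by
    have := b.orthonormal.comp_linearIsometry (LinearMap.range D).subtypeₗᵢ
    convert this using 1
    ext i
    simp [hb]
  expand z := by
    apply hD
    have := congrArg Subtype.val (b.sum_repr' ⟨D z, LinearMap.mem_range_self D z⟩)
    simpa [hb] using this

theorem exists_isFrame [FiniteDimensional ℝ F] (hD : Function.Injective D) :
    ∃ e : Fin (Module.finrank ℝ F) → F, IsFrame D e := by
  have h : Module.finrank ℝ (LinearMap.range D) = Module.finrank ℝ F :=
    LinearMap.finrank_range_of_inj hD
  let b := (stdOrthonormalBasis ℝ (LinearMap.range D)).reindex (finCongr h)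
  choose e he using fun i ↦ (b i).2
  exact ⟨e, .of_orthonormalBasis hD b he⟩

theorem IsFrame.prod {E₁ E₂ : Type*} [AddCommGroup E₁] [Module ℝ E₁] [AddCommGroup E₂] [Module ℝ E₂]
    {D : E₁ × E₂ →ₗ[ℝ] V} (hD : ∀ x z, inner ℝ (D (x, 0)) (D (0, z)) = 0)
    {e₁ : κ → E₁} {e₂ : κ' → E₂} (h₁ : IsFrame (D ∘ₗ LinearMap.inl ℝ E₁ E₂) e₁)
    (h₂ : IsFrame (D ∘ₗ LinearMap.inr ℝ E₁ E₂) e₂) :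
    IsFrame D (Sum.elim (fun i ↦ (e₁ i, 0)) (fun j ↦ (0, e₂ j))) where
  orthonormal := by
    classical
    have h1 := orthonormal_iff_ite.mp h₁.orthonormal
    have h2 := orthonormal_iff_ite.mp h₂.orthonormal
    rw [orthonormal_iff_ite]
    rintro (i | i) (j | j)
    · simpa using h1 i j
    · simpa using hD _ _
    · simpa [real_inner_comm] using hD (e₁ j) (e₂ i)
    · simpa using h2 i j
  expand := by
    rintro ⟨x, z⟩
    have hx := h₁.expand x
    have hz := h₂.expand z
    have hs : D (x, z) = D (x, 0) + D (0, z) := by rw [← map_add]; simp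
    have hD' : ∀ x z, inner ℝ (D (0, z)) (D (x, 0)) = 0 := fun x z ↦ by
      rw [real_inner_comm]; exact hD x z
    simp only [LinearMap.comp_apply, LinearMap.inl_apply, LinearMap.inr_apply] at hx hz
    simp only [Fintype.sum_sum_type, Sum.elim_inl, Sum.elim_inr, hs, inner_add_right, hD, hD',
      add_zero, zero_add]
    ext
    · simp [Prod.fst_sum, hx]
    · simp [Prod.snd_sum, hz]

end Frames

/-! ### Linear algebra at one point: the estimate and its equality case. -/

section Pointwise

variable {V : Type*} [NormedAddCommGroup V] [InnerProductSpace ℝ V]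
  {E₁ : Type*} [AddCommGroup E₁] [Module ℝ E₁] {E₂ : Type*} [AddCommGroup E₂] [Module ℝ E₂]

/-- The relations that hold at one point of a warped product semi-slant submanifold of a nearly
cosymplectic manifold: `D` is the differential of the immersion, `B` the ambient covariant
derivative of the coordinate fields, `lam` the differential of the logarithm of the warping
function, `ψ x y z = g((∇_x φ) y, z)`, and `dΩ x z w` the derivative of
`g(φ z, w)` in the direction `x`. -/
structure SemiSlantPoint (D : E₁ × E₂ →ₗ[ℝ] V) (B : E₁ × E₂ →ₗ[ℝ] E₁ × E₂ →ₗ[ℝ] V)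
    (φ : V →ₗ[ℝ] V) (ξ : V) (lam : E₁ →ₗ[ℝ] ℝ) (θ : ℝ) (ψ : V → V → V → ℝ)
    (dΩ : E₁ → E₂ → E₂ → ℝ) : Prop where
  injective : Function.Injective D
  orthogonal : ∀ x z, inner ℝ (D (x, 0)) (D (0, z)) = 0
  symm : ∀ v w, B v w = B w v
  vertical_deriv : ∀ x z w, 2 * lam x * inner ℝ (D (0, z)) (D (0, w)) =
    inner ℝ (B (x, 0) (0, z)) (D (0, w)) + inner ℝ (D (0, z)) (B (x, 0) (0, w))
  mixed_deriv : ∀ s x z,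
    inner ℝ (B s (x, 0)) (D (0, z)) + inner ℝ (D (x, 0)) (B s (0, z)) = 0
  horizontal_deriv : ∀ z x y,
    inner ℝ (B (0, z) (x, 0)) (D (y, 0)) + inner ℝ (D (x, 0)) (B (0, z) (y, 0)) = 0
  skew : ∀ v w, inner ℝ (φ v) w = -inner ℝ v (φ w)
  inner_map : ∀ v w, inner ℝ (φ v) (φ w) = inner ℝ v w - inner ℝ v ξ * inner ℝ w ξ
  invariant : ∀ x, ∃ y, φ (D (x, 0)) = D (y, 0)
  reeb : ∃ x, ξ = D (x, 0)
  killing : ∀ z, inner ℝ (B (0, z) (0, z)) ξ = 0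
  slant : ∀ z, ∃ y, (∀ w, inner ℝ (φ (D (0, z)) - D (0, y)) (D (0, w)) = 0) ∧
    ‖D (0, y)‖ ^ 2 = Real.cos θ ^ 2 * ‖D (0, z)‖ ^ 2
  sin_ne_zero : Real.sin θ ≠ 0
  swap₁₂ : ∀ u v w, ψ u v w = -ψ v u w
  swap₂₃ : ∀ u v w, ψ u v w = -ψ u w v
  mixed_form : ∀ z x w, ψ (D (0, z)) (D (x, 0)) (D (0, w)) =
    inner ℝ (B (0, z) (x, 0)) (φ (D (0, w))) - inner ℝ (B (0, z) (0, w)) (φ (D (x, 0)))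
  vertical_form : ∀ x z w, dΩ x z w = ψ (D (x, 0)) (D (0, z)) (D (0, w)) -
    inner ℝ (B (x, 0) (0, z)) (φ (D (0, w))) + inner ℝ (B (x, 0) (0, w)) (φ (D (0, z)))
  trace_form : ∀ (κ : Type) [Fintype κ] (e : κ → E₂),
    IsFrame (D ∘ₗ LinearMap.inr ℝ E₁ E₂) e → ∀ x,
    ∑ j, ∑ k, inner ℝ (φ (D (0, e j))) (D (0, e k)) * dΩ x (e j) (e k) =
      2 * lam x * ∑ j, ∑ k, inner ℝ (φ (D (0, e j))) (D (0, e k)) ^ 2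

namespace SemiSlantPoint

variable {D : E₁ × E₂ →ₗ[ℝ] V} {B : E₁ × E₂ →ₗ[ℝ] E₁ × E₂ →ₗ[ℝ] V}
    {φ : V →ₗ[ℝ] V} {ξ : V} {lam : E₁ →ₗ[ℝ] ℝ} {θ : ℝ} {ψ : V → V → V → ℝ}
    {dΩ : E₁ → E₂ → E₂ → ℝ}

/-- The horizontal part of `∇_z w` is `-g(z, w) ∇ ln f`. As in Koszul's formula, the derivative of
`g(z, w)` along `x` is combined with the two derivatives of the orthogonality relation between the
factors. -/
theorem inner_vertical_horizontal (H : SemiSlantPoint D B φ ξ lam θ ψ dΩ) (x z w) :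
    inner ℝ (B (0, z) (0, w)) (D (x, 0)) = -(lam x * inner ℝ (D (0, z)) (D (0, w))) := by
  have h1 := H.vertical_deriv x z w
  have h2 := H.mixed_deriv (0, z) x w
  have h3 := H.mixed_deriv (0, w) x z
  rw [H.symm (0, w) (0, z), H.symm (0, w)] at h3
  rw [H.symm (0, z) (x, 0)] at h2
  rw [real_inner_comm (D (0, z))] at h3
  rw [real_inner_comm] at h2 h3 ⊢
  linarith [real_inner_comm (B (x, 0) (0, z)) (D (0, w)),
    real_inner_comm (B (x, 0) (0, w)) (D (0, z))]

theorem inner_mixed_vertical (H : SemiSlantPoint D B φ ξ lam θ ψ dΩ) (x z w) :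
    inner ℝ (B (x, 0) (0, z)) (D (0, w)) = lam x * inner ℝ (D (0, z)) (D (0, w)) := by
  have h1 := H.inner_vertical_horizontal x z w
  have h2 := H.mixed_deriv (0, z) x w
  rw [H.symm (0, z) (x, 0), real_inner_comm (B (0, z) (0, w))] at h2
  linarith

/-- The horizontal metric is constant along the slant factor, and `B` is symmetric; the two
orthogonality relations then add up to twice the left side. This makes the horizontal leaves totally
geodesic in the warped product. -/
theorem inner_horizontal_vertical (H : SemiSlantPoint D B φ ξ lam θ ψ dΩ) (x y z) :
    inner ℝ (B (x, 0) (y, 0)) (D (0, z)) = 0 := by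
  have h1 := H.horizontal_deriv z x y
  have h2 := H.mixed_deriv (x, 0) y z
  have h3 := H.mixed_deriv (y, 0) x z
  rw [H.symm (0, z), H.symm (0, z)] at h1
  rw [H.symm (y, 0)] at h3
  linarith [real_inner_comm (B (x, 0) (0, z)) (D (y, 0))]

theorem inner_map_self (H : SemiSlantPoint D B φ ξ lam θ ψ dΩ) (v : V) : inner ℝ (φ v) v = 0 := by
  have := H.skew v v
  linarith [real_inner_comm v (φ v)]

theorem inner_map_vertical_horizontal (H : SemiSlantPoint D B φ ξ lam θ ψ dΩ)
    (x z) : inner ℝ (φ (D (0, z))) (D (x, 0)) = 0 := by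
  obtain ⟨y, hy⟩ := H.invariant x
  rw [H.skew, hy, real_inner_comm, H.orthogonal, neg_zero]

theorem inner_vertical_reeb (H : SemiSlantPoint D B φ ξ lam θ ψ dΩ)
    (z) : inner ℝ (D (0, z)) ξ = 0 := by
  obtain ⟨x, rfl⟩ := H.reeb
  rw [real_inner_comm, H.orthogonal]

theorem map_eq_add (x z) : D (x, z) = D (x, 0) + D (0, z) := by
  rw [← map_add]; simp

/-- The part of `φ z` normal to the submanifold, for `z` tangent to the slant factor. -/
theorem exists_normal (H : SemiSlantPoint D B φ ξ lam θ ψ dΩ)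
    (z) : ∃ (y : E₂) (n : V), φ (D (0, z)) = D (0, y) + n ∧
    (∀ v, inner ℝ n (D v) = 0) ∧ ‖n‖ ^ 2 = Real.sin θ ^ 2 * ‖D (0, z)‖ ^ 2 := by
  obtain ⟨y, hy, hn⟩ := H.slant z
  have horth : ∀ v, inner ℝ (φ (D (0, z)) - D (0, y)) (D v) = 0 := by
    rintro ⟨x, w⟩
    rw [map_eq_add x, inner_add_right, hy, add_zero, inner_sub_left,
      H.inner_map_vertical_horizontal, real_inner_comm, H.orthogonal, sub_zero]
  refine ⟨y, φ (D (0, z)) - D (0, y), by abel, horth, ?_⟩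
  have h1 : ‖φ (D (0, z))‖ ^ 2 = ‖D (0, z)‖ ^ 2 := by
    rw [← real_inner_self_eq_norm_sq, H.inner_map, H.inner_vertical_reeb,
      real_inner_self_eq_norm_sq]
    ring
  have h2 : φ (D (0, z)) = (φ (D (0, z)) - D (0, y)) + D (0, y) := by abel
  have h3 := norm_add_sq_real (φ (D (0, z)) - D (0, y)) (D (0, y))
  rw [← h2, h1, horth, hn] at h3
  rw [Real.sin_sq]
  linarith

/-- A scalar matrix and one with zero diagonal are orthogonal for the entrywise inner product;
skewness itself is not needed. -/
theorem sum_sq_delta_add_skew {κ : Type*} [Fintype κ] [DecidableEq κ] (c : ℝ) (s : κ → κ → ℝ)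
    (hs : ∀ j, s j j = 0) :
    ∑ j, ∑ k, ((if j = k then c else 0) + s j k) ^ 2 =
      Fintype.card κ * c ^ 2 + ∑ j, ∑ k, s j k ^ 2 := by
  have : ∀ j k, ((if j = k then c else 0) + s j k) ^ 2 =
      (if j = k then c ^ 2 else 0) + s j k ^ 2 := by
    intro j k
    split_ifs with h
    · subst h; rw [hs]; ring
    · ring
  simp [this, Finset.sum_add_distrib]

variable {κ : Type} [Fintype κ] {e : κ → E₂}

/-- Each row of `Ω` lists the coordinates of the tangential part of `φ e_j`, whose length is |cos θ|
by the slant condition. -/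
theorem sum_form_sq (H : SemiSlantPoint D B φ ξ lam θ ψ dΩ)
    (he : IsFrame (D ∘ₗ LinearMap.inr ℝ E₁ E₂) e) :
    ∑ j, ∑ k, inner ℝ (φ (D (0, e j))) (D (0, e k)) ^ 2 =
      Fintype.card κ * Real.cos θ ^ 2 := by
  have : ∀ j, ∑ k, inner ℝ (φ (D (0, e j))) (D (0, e k)) ^ 2 = Real.cos θ ^ 2 := by
    intro j
    obtain ⟨y, hy, hn⟩ := H.slant (e j)
    have h1 : ∀ k, inner ℝ (φ (D (0, e j))) (D (0, e k)) = inner ℝ (D (0, e k)) (D (0, y)) := by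
      intro k
      have := hy (e k)
      rw [inner_sub_left] at this
      rw [real_inner_comm (D (0, y))]
      linarith
    have h2 := he.sum_sq y
    have h3 : ‖D (0, e j)‖ = 1 := he.orthonormal.1 j
    simp only [LinearMap.comp_apply, LinearMap.inr_apply] at h2
    simp_rw [h1, h2, hn, h3]
    ring
  simp [this]

/-- The sum over the slant directions of the squared components of `h(x, ·)`. -/
theorem le_sum_sq_component (H : SemiSlantPoint D B φ ξ lam θ ψ dΩ)
    (he : IsFrame (D ∘ₗ LinearMap.inr ℝ E₁ E₂) e) {x y : E₁}
    (hxy : φ (D (x, 0)) = D (y, 0)) :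
    Fintype.card κ * (lam y ^ 2 + 1 / 9 * Real.cos θ ^ 2 * lam x ^ 2) ≤
      ∑ j, ∑ k, (inner ℝ (B (x, 0) (0, e j)) (φ (D (0, e k))) +
        lam x * inner ℝ (φ (D (0, e j))) (D (0, e k))) ^ 2 := by
  classical
  set Ω : E₂ → E₂ → ℝ := fun z w ↦ inner ℝ (φ (D (0, z))) (D (0, w)) with hΩ
  have hmix : ∀ z w, ψ (D (0, z)) (D (x, 0)) (D (0, w)) =
      inner ℝ (B (x, 0) (0, z)) (φ (D (0, w))) +
        lam y * inner ℝ (D (0, z)) (D (0, w)) := by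
    intro z w
    rw [H.mixed_form, hxy, H.inner_vertical_horizontal, H.symm (0, z)]
    ring
  -- Total skewness turns `h1`, `h2`, `h3` into a linear system whose solution is `dΩ = -3 ψ(z, x,
  -- w)`. This is the origin of the third here and of the ninth in the theorem.
  have key : ∀ z w, inner ℝ (B (x, 0) (0, z)) (φ (D (0, w))) + lam x * Ω z w =
      -(lam y * inner ℝ (D (0, z)) (D (0, w))) + (lam x * Ω z w - dΩ x z w / 3) := by
    intro z w
    have h1 := hmix z w
    have h2 := hmix w z
    have h3 := H.vertical_form x z w
    have h4 := H.swap₁₂ (D (x, 0)) (D (0, z)) (D (0, w))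
    have h5 : ψ (D (0, w)) (D (x, 0)) (D (0, z)) = -ψ (D (0, z)) (D (x, 0)) (D (0, w)) := by
      rw [H.swap₂₃, H.swap₁₂, H.swap₂₃, neg_neg]
    rw [real_inner_comm (D (0, z)) (D (0, w))] at h2
    linarith
  have hdΩ : ∀ z, dΩ x z z = 0 := by
    intro z
    have h5 := H.swap₂₃ (D (x, 0)) (D (0, z)) (D (0, z))
    have := H.vertical_form x z z
    linarith
  have hon := orthonormal_iff_ite.mp he.orthonormal
  simp only [LinearMap.comp_apply, LinearMap.inr_apply] at hon
  have hsum : ∑ j, ∑ k, (inner ℝ (B (x, 0) (0, e j)) (φ (D (0, e k))) + lam x * Ω (e j) (e k)) ^ 2 =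
      Fintype.card κ * (-lam y) ^ 2 +
        ∑ j, ∑ k, (lam x * Ω (e j) (e k) - dΩ x (e j) (e k) / 3) ^ 2 := by
    rw [← sum_sq_delta_add_skew]
    · refine Finset.sum_congr rfl fun j _ ↦ Finset.sum_congr rfl fun k _ ↦ ?_
      rw [key, hon]
      split_ifs <;> ring
    · intro j
      rw [hdΩ]
      simp [hΩ, H.inner_map_self]
  have hS := H.sum_form_sq he
  have hT := H.trace_form κ e he x
  change ∑ j, ∑ k, Ω (e j) (e k) ^ 2 = _ at hS
  change ∑ j, ∑ k, Ω (e j) (e k) * dΩ x (e j) (e k) =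
    2 * lam x * ∑ j, ∑ k, Ω (e j) (e k) ^ 2 at hT
  -- The split is `dΩ = 2 lam(x) Ω + R`. The last bracket is the inner product of `Ω` with `R`,
  -- which `hT` makes zero; the nonnegative `‖R‖² / 9` is then dropped.
  have hexp : ∑ j, ∑ k, (lam x * Ω (e j) (e k) - dΩ x (e j) (e k) / 3) ^ 2 =
      lam x ^ 2 / 9 * ∑ j, ∑ k, Ω (e j) (e k) ^ 2 +
      1 / 9 * ∑ j, ∑ k, (dΩ x (e j) (e k) - 2 * lam x * Ω (e j) (e k)) ^ 2 -
      2 / 9 * lam x * (∑ j, ∑ k, Ω (e j) (e k) * dΩ x (e j) (e k) -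
        2 * lam x * ∑ j, ∑ k, Ω (e j) (e k) ^ 2) := by
    simp only [Finset.mul_sum, ← Finset.sum_add_distrib, ← Finset.sum_sub_distrib]
    refine Finset.sum_congr rfl fun j _ ↦ Finset.sum_congr rfl fun k _ ↦ ?_
    ring
  have hnn : 0 ≤ ∑ j, ∑ k, (dΩ x (e j) (e k) - 2 * lam x * Ω (e j) (e k)) ^ 2 :=
    Finset.sum_nonneg fun j _ ↦ Finset.sum_nonneg fun k _ ↦ sq_nonneg _
  rw [hsum, hexp, hT, hS]
  nlinarith

variable {N : V →ₗ[ℝ] V}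

/-- Only the normal part of `φ w` pairs with the normal projection. Removing its tangential part
costs `lam(x) g(z, φ w)`, and skewness of `φ` gives the sign of the correction. -/
theorem inner_normal_mixed (H : SemiSlantPoint D B φ ξ lam θ ψ dΩ)
    (hN : ∀ v w, inner ℝ (N v) (D w) = 0) (hN' : ∀ v, ∃ w, v - N v = D w)
    (x z w) : inner ℝ (N (B (x, 0) (0, z))) (φ (D (0, w))) =
      inner ℝ (B (x, 0) (0, z)) (φ (D (0, w))) + lam x * inner ℝ (φ (D (0, z))) (D (0, w)) := by
  obtain ⟨y, n, hy, hn, -⟩ := H.exists_normal w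
  obtain ⟨t, ht⟩ := hN' (B (x, 0) (0, z))
  have h1 : inner ℝ (B (x, 0) (0, z) - N (B (x, 0) (0, z))) n = 0 := by
    rw [ht, real_inner_comm, hn]
  have h2 := H.inner_mixed_vertical x z y
  rw [inner_sub_left] at h1
  rw [H.skew, hy, inner_add_right, inner_add_right, inner_add_right, hN, h2,
    real_inner_comm n (D (0, z)), hn]
  linarith

theorem norm_normal_sq (H : SemiSlantPoint D B φ ξ lam θ ψ dΩ)
    (hN : ∀ v w, inner ℝ (N v) (D w) = 0) (hN' : ∀ v, ∃ w, v - N v = D w)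
    (w) : ‖N (φ (D (0, w)))‖ ^ 2 = Real.sin θ ^ 2 * ‖D (0, w)‖ ^ 2 := by
  obtain ⟨y, n, hy, hn, hnorm⟩ := H.exists_normal w
  obtain ⟨t, ht⟩ := hN' (φ (D (0, w)))
  have h1 : n - N (φ (D (0, w))) = D (t - (0, y)) := by
    rw [map_sub, ← ht, hy]; abel
  have h2 : inner ℝ (n - N (φ (D (0, w)))) (n - N (φ (D (0, w)))) = 0 := by
    nth_rewrite 2 [h1]
    rw [inner_sub_left, hn, hN, sub_zero]
  rw [← hnorm, ← sub_eq_zero.mp (inner_self_eq_zero.mp h2)]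

/-- Polarization of `norm_normal_sq`: the normal part of `φ` is sin θ times an isometry, up to sign,
on vertical vectors. -/
theorem orthonormal_normal (H : SemiSlantPoint D B φ ξ lam θ ψ dΩ)
    (hN : ∀ v w, inner ℝ (N v) (D w) = 0) (hN' : ∀ v, ∃ w, v - N v = D w)
    (he : IsFrame (D ∘ₗ LinearMap.inr ℝ E₁ E₂) e) :
    Orthonormal ℝ (fun k ↦ (Real.sin θ)⁻¹ • N (φ (D (0, e k)))) := by
  classical
  have hpol : ∀ z w, inner ℝ (N (φ (D (0, z)))) (N (φ (D (0, w)))) =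
      Real.sin θ ^ 2 * inner ℝ (D (0, z)) (D (0, w)) := by
    intro z w
    have h1 := H.norm_normal_sq hN hN' (z + w)
    have h2 := H.norm_normal_sq hN hN' z
    have h3 := H.norm_normal_sq hN hN' w
    have h4 : D (0, z + w) = D (0, z) + D (0, w) := by rw [← map_add]; simp
    rw [h4, map_add, map_add, norm_add_sq_real, norm_add_sq_real] at h1
    linarith
  have hon := orthonormal_iff_ite.mp he.orthonormal
  simp only [LinearMap.comp_apply, LinearMap.inr_apply] at hon
  rw [orthonormal_iff_ite]
  intro j k
  rw [real_inner_smul_left, real_inner_smul_right, hpol, hon]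
  have := H.sin_ne_zero
  split_ifs
  · field_simp
  · simp

theorem le_sum_norm_sq_mixed (H : SemiSlantPoint D B φ ξ lam θ ψ dΩ)
    (hN : ∀ v w, inner ℝ (N v) (D w) = 0)
    (hN' : ∀ v, ∃ w, v - N v = D w)
    (he : IsFrame (D ∘ₗ LinearMap.inr ℝ E₁ E₂) e) {x y : E₁} (hxy : φ (D (x, 0)) = D (y, 0)) :
    Fintype.card κ * (1 / Real.sin θ) ^ 2 * (lam y ^ 2 + 1 / 9 * Real.cos θ ^ 2 * lam x ^ 2) ≤
      ∑ j, ‖N (B (x, 0) (0, e j))‖ ^ 2 := by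
  have hs := H.sin_ne_zero
  have hon := H.orthonormal_normal hN hN' he
  have h1 : ∀ j, (1 / Real.sin θ) ^ 2 * ∑ k, (inner ℝ (B (x, 0) (0, e j)) (φ (D (0, e k))) +
        lam x * inner ℝ (φ (D (0, e j))) (D (0, e k))) ^ 2 ≤ ‖N (B (x, 0) (0, e j))‖ ^ 2 := by
    intro j
    -- Bessel's inequality discards the normal directions outside the span of the normal parts of
    -- the `φ e_k`.
    have hb := hon.sum_inner_products_le (N (B (x, 0) (0, e j))) (s := Finset.univ)
    refine le_trans (le_of_eq ?_) hb
    rw [Finset.mul_sum]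
    refine Finset.sum_congr rfl fun k _ ↦ ?_
    have h2 : inner ℝ (N (φ (D (0, e k)))) (N (B (x, 0) (0, e j))) =
        inner ℝ (N (B (x, 0) (0, e j))) (φ (D (0, e k))) := by
      obtain ⟨t, ht⟩ := hN' (φ (D (0, e k)))
      have := hN (B (x, 0) (0, e j)) t
      rw [← ht, inner_sub_right] at this
      rw [real_inner_comm]
      linarith
    rw [← H.inner_normal_mixed hN hN', real_inner_smul_left, h2, Real.norm_eq_abs, sq_abs]
    ring
  have h2 := H.le_sum_sq_component he hxy
  calc _ = (1 / Real.sin θ) ^ 2 *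
        (Fintype.card κ * (lam y ^ 2 + 1 / 9 * Real.cos θ ^ 2 * lam x ^ 2)) := by ring
    _ ≤ _ := mul_le_mul_of_nonneg_left h2 (sq_nonneg _)
    _ ≤ _ := by
      rw [Finset.mul_sum]
      exact Finset.sum_le_sum fun j _ ↦ h1 j

/-- The warping function is constant along the Reeb field. -/
theorem lam_reeb (H : SemiSlantPoint D B φ ξ lam θ ψ dΩ)
    {r : E₁} {z : E₂} (hr : ξ = D (r, 0)) (hz : z ≠ 0) : lam r = 0 := by
  have h1 := H.killing z
  rw [hr, H.inner_vertical_horizontal, neg_eq_zero, mul_eq_zero] at h1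
  refine h1.resolve_right fun h ↦ hz ?_
  have := H.injective ((inner_self_eq_zero.mp h).trans (map_zero D).symm)
  simpa using this

variable {κ₁ : Type} [Fintype κ₁] {e₁ : κ₁ → E₁}

theorem sum_lam_sq (he₁ : IsFrame (D ∘ₗ LinearMap.inl ℝ E₁ E₂) e₁) {g : E₁}
    (hg : ∀ x, lam x = inner ℝ (D (g, 0)) (D (x, 0))) :
    ∑ i, lam (e₁ i) ^ 2 = ‖D (g, 0)‖ ^ 2 := by
  refine Eq.trans ?_ (he₁.sum_sq g)
  refine Finset.sum_congr rfl fun i _ ↦ ?_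
  rw [hg, real_inner_comm]
  rfl

/-- Up to sign, `lam(φ e_i)` is the coordinate of `φ ∇ ln f` along `e_i`, and `φ` preserves the
length of `∇ ln f` because `lam` vanishes on `ξ`. -/
theorem sum_lam_map_sq (H : SemiSlantPoint D B φ ξ lam θ ψ dΩ)
    (he₁ : IsFrame (D ∘ₗ LinearMap.inl ℝ E₁ E₂) e₁) {g : E₁}
    (hg : ∀ x, lam x = inner ℝ (D (g, 0)) (D (x, 0))) {z : E₂} (hz : z ≠ 0) {J : κ₁ → E₁}
    (hJ : ∀ i, φ (D (e₁ i, 0)) = D (J i, 0)) :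
    ∑ i, lam (J i) ^ 2 = ‖D (g, 0)‖ ^ 2 := by
  obtain ⟨y, hy⟩ := H.invariant g
  obtain ⟨r, hr⟩ := H.reeb
  have h1 : ‖D (g, 0)‖ ^ 2 = ‖D (y, 0)‖ ^ 2 := by
    rw [← hy, ← real_inner_self_eq_norm_sq (φ _), H.inner_map, hr, ← hg r, H.lam_reeb hr hz,
      real_inner_self_eq_norm_sq]
    ring
  rw [h1]
  refine Eq.trans ?_ (he₁.sum_sq y)
  refine Finset.sum_congr rfl fun i _ ↦ ?_
  rw [hg, ← hJ, real_inner_comm, H.skew, hy]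
  simp

theorem le_sum_sum_norm_sq_mixed (H : SemiSlantPoint D B φ ξ lam θ ψ dΩ)
    (hN : ∀ v w, inner ℝ (N v) (D w) = 0)
    (hN' : ∀ v, ∃ w, v - N v = D w) (he₁ : IsFrame (D ∘ₗ LinearMap.inl ℝ E₁ E₂) e₁)
    (he : IsFrame (D ∘ₗ LinearMap.inr ℝ E₁ E₂) e) {g : E₁}
    (hg : ∀ x, lam x = inner ℝ (D (g, 0)) (D (x, 0))) :
    Fintype.card κ * (1 / Real.sin θ) ^ 2 * (1 + 1 / 9 * Real.cos θ ^ 2) * ‖D (g, 0)‖ ^ 2 ≤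
      ∑ i, ∑ j, ‖N (B (e₁ i, 0) (0, e j))‖ ^ 2 := by
  -- A nonzero vertical vector is needed for `lam` to vanish on `ξ`. Without one the left side is
  -- zero.
  rcases isEmpty_or_nonempty κ with hκ | ⟨⟨k⟩⟩
  · simp
  have hz : e k ≠ 0 := fun h ↦ he.orthonormal.ne_zero k (by rw [h, map_zero])
  choose J hJ using fun i ↦ H.invariant (e₁ i)
  refine le_trans (le_of_eq ?_)
    (Finset.sum_le_sum fun i _ ↦ H.le_sum_norm_sq_mixed hN hN' he (hJ i))
  rw [← Finset.mul_sum, Finset.sum_add_distrib, ← Finset.mul_sum, sum_lam_sq he₁ hg,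
    H.sum_lam_map_sq he₁ hg hz hJ]
  ring

theorem sum_sum_elim {κ κ₁ : Type*} [Fintype κ] [Fintype κ₁] {e₁ : κ₁ → E₁} {e : κ → E₂}
    (hs : ∀ v w, B v w = B w v) :
    ∑ i, ∑ j, ‖N (B (Sum.elim (fun i ↦ (e₁ i, 0)) (fun j ↦ (0, e j)) i)
        (Sum.elim (fun i ↦ (e₁ i, 0)) (fun j ↦ (0, e j)) j))‖ ^ 2 =
      ∑ i, ∑ j, ‖N (B (e₁ i, 0) (e₁ j, 0))‖ ^ 2 + 2 * ∑ i, ∑ j, ‖N (B (e₁ i, 0) (0, e j))‖ ^ 2 +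
        ∑ i, ∑ j, ‖N (B (0, e i) (0, e j))‖ ^ 2 := by
  simp only [Fintype.sum_sum_type, Sum.elim_inl, Sum.elim_inr, Finset.sum_add_distrib]
  have : ∑ i, ∑ j, ‖N (B (0, e i) (e₁ j, 0))‖ ^ 2 = ∑ i, ∑ j, ‖N (B (e₁ i, 0) (0, e j))‖ ^ 2 := by
    rw [Finset.sum_comm]
    simp only [hs (0, e _)]
  rw [this]
  ring

variable {κ₀ : Type*} [Fintype κ₀] {e₀ : κ₀ → E₁ × E₂} [FiniteDimensional ℝ E₁]
  [FiniteDimensional ℝ E₂]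

/-- The lower bound for the norm of the second fundamental form, and the equality case. -/
theorem sum_norm_sq_ge (H : SemiSlantPoint D B φ ξ lam θ ψ dΩ) (hN : ∀ v w, inner ℝ (N v) (D w) = 0)
    (hN' : ∀ v, ∃ w, v - N v = D w) (he₀ : IsFrame D e₀) {g : E₁}
    (hg : ∀ x, lam x = inner ℝ (D (g, 0)) (D (x, 0))) :
    (2 * Module.finrank ℝ E₂ * (1 / Real.sin θ) ^ 2 * (1 + 1 / 9 * Real.cos θ ^ 2) *
      ‖D (g, 0)‖ ^ 2 ≤ ∑ i, ∑ j, ‖N (B (e₀ i) (e₀ j))‖ ^ 2) ∧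
    (∑ i, ∑ j, ‖N (B (e₀ i) (e₀ j))‖ ^ 2 = 2 * Module.finrank ℝ E₂ * (1 / Real.sin θ) ^ 2 *
      (1 + 1 / 9 * Real.cos θ ^ 2) * ‖D (g, 0)‖ ^ 2 →
      (∀ x y, N (B (x, 0) (y, 0)) = 0) ∧ (∀ z w, N (B (0, z) (0, w)) = 0)) := by
  have hi₁ : Function.Injective (D ∘ₗ LinearMap.inl ℝ E₁ E₂) :=
    H.injective.comp LinearMap.inl_injective
  have hi₂ : Function.Injective (D ∘ₗ LinearMap.inr ℝ E₁ E₂) :=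
    H.injective.comp LinearMap.inr_injective
  obtain ⟨e₁, he₁⟩ := exists_isFrame hi₁
  obtain ⟨e, he⟩ := exists_isFrame hi₂
  have h1 := he₀.sum_sum_norm_sq_eq (he₁.prod H.orthogonal he) (B.compr₂ N)
  simp only [LinearMap.compr₂_apply] at h1
  -- In the adapted frame `‖h‖²` splits into horizontal, twice mixed, and vertical sums. The bound
  -- concerns the mixed sum alone, so equality kills the other two.
  rw [sum_sum_elim H.symm] at h1
  have h2 := H.le_sum_sum_norm_sq_mixed hN hN' he₁ he hg
  rw [Fintype.card_fin] at h2
  have h3 : 0 ≤ ∑ i, ∑ j, ‖N (B (e₁ i, 0) (e₁ j, 0))‖ ^ 2 :=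
    Finset.sum_nonneg fun _ _ ↦ Finset.sum_nonneg fun _ _ ↦ sq_nonneg _
  have h4 : 0 ≤ ∑ i, ∑ j, ‖N (B (0, e i) (0, e j))‖ ^ 2 :=
    Finset.sum_nonneg fun _ _ ↦ Finset.sum_nonneg fun _ _ ↦ sq_nonneg _
  refine ⟨by linarith, fun heq ↦ ?_⟩
  have h5 : ∑ i, ∑ j, ‖N (B (e₁ i, 0) (e₁ j, 0))‖ ^ 2 = 0 := by linarith
  have h6 : ∑ i, ∑ j, ‖N (B (0, e i) (0, e j))‖ ^ 2 = 0 := by linarith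
  exact ⟨he₁.eq_zero_of_sum_norm_sq
      ((B.compr₂ N).compl₁₂ (LinearMap.inl ℝ E₁ E₂) (LinearMap.inl ℝ E₁ E₂)) h5,
    he.eq_zero_of_sum_norm_sq
      ((B.compr₂ N).compl₁₂ (LinearMap.inr ℝ E₁ E₂) (LinearMap.inr ℝ E₁ E₂)) h6⟩

theorem sum_normal_diag_eq_zero (H : SemiSlantPoint D B φ ξ lam θ ψ dΩ) (he₀ : IsFrame D e₀)
    (h₁ : ∀ x y, N (B (x, 0) (y, 0)) = 0) (h₂ : ∀ z w, N (B (0, z) (0, w)) = 0) :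
    ∑ i, N (B (e₀ i) (e₀ i)) = 0 := by
  have hi₁ : Function.Injective (D ∘ₗ LinearMap.inl ℝ E₁ E₂) :=
    H.injective.comp LinearMap.inl_injective
  have hi₂ : Function.Injective (D ∘ₗ LinearMap.inr ℝ E₁ E₂) :=
    H.injective.comp LinearMap.inr_injective
  obtain ⟨e₁, he₁⟩ := exists_isFrame hi₁
  obtain ⟨e, he⟩ := exists_isFrame hi₂
  have h1 := he₀.sum_bilin_eq (he₁.prod H.orthogonal he) (B.compr₂ N)
  simpa [Fintype.sum_sum_type, h₁, h₂] using h1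

end SemiSlantPoint
end Pointwise

/-! ### The nearly cosymplectic structure in a chart. -/

section Calculus

open Filter Topology

variable {E : Type*} [NormedAddCommGroup E] [NormedSpace ℝ E]

/-- A shortcut instance. -/
instance bilinNormedAddCommGroup : NormedAddCommGroup (E →L[ℝ] E →L[ℝ] ℝ) :=
  ContinuousLinearMap.toNormedAddCommGroup

/-- A shortcut instance. -/
instance bilinNormedSpace : NormedSpace ℝ (E →L[ℝ] E →L[ℝ] ℝ) :=
  ContinuousLinearMap.toNormedSpace

/-- `(∇_v Φ) w` in coordinates, at a point where the Christoffel symbols are `Γ`. -/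
def covDerivEnd (y₀ : E) (Φ : E → E →L[ℝ] E) (Γ : E → E → E) (v w : E) : E :=
  fderiv ℝ Φ y₀ v w + Γ v (Φ y₀ w) - Φ y₀ (Γ v w)

/-- A nearly cosymplectic structure read in a chart around the point of coordinates `y₀`, where
the Christoffel symbols are `Γ`. -/
structure NearlyCosymplecticChart (y₀ : E) (G : E → E →L[ℝ] E →L[ℝ] ℝ) (Φ : E → E →L[ℝ] E)
    (Ξ : E → E) (Γ : E → E → E) : Prop where
  differentiableAt_metric : DifferentiableAt ℝ G y₀
  differentiableAt_map : DifferentiableAt ℝ Φ y₀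
  differentiableAt_reeb : DifferentiableAt ℝ Ξ y₀
  symm : ∀ᶠ y in 𝓝 y₀, ∀ v w, G y v w = G y w v
  nondegenerate : ∀ v, (∀ w, G y₀ v w = 0) → v = 0
  skew : ∀ᶠ y in 𝓝 y₀, ∀ v w, G y (Φ y v) w = -G y v (Φ y w)
  metric_map : ∀ᶠ y in 𝓝 y₀, ∀ v w,
    G y (Φ y v) (Φ y w) = G y v w - G y v (Ξ y) * G y w (Ξ y)
  map_reeb : ∀ᶠ y in 𝓝 y₀, Φ y (Ξ y) = 0
  koszul : ∀ v w z, G y₀ (Γ v w) z =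
    (fderiv ℝ G y₀ v w z + fderiv ℝ G y₀ w v z - fderiv ℝ G y₀ z v w) / 2
  nearly : ∀ v w, covDerivEnd y₀ Φ Γ v w + covDerivEnd y₀ Φ Γ w v = 0

namespace NearlyCosymplecticChart

variable {y₀ : E} {G : E → E →L[ℝ] E →L[ℝ] ℝ} {Φ : E → E →L[ℝ] E}
    {Ξ : E → E} {Γ : E → E → E}

theorem symm_at (C : NearlyCosymplecticChart y₀ G Φ Ξ Γ)
    (v w : E) : G y₀ v w = G y₀ w v := C.symm.self_of_nhds v w

theorem skew_at (C : NearlyCosymplecticChart y₀ G Φ Ξ Γ)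
    (v w : E) : G y₀ (Φ y₀ v) w = -G y₀ v (Φ y₀ w) := C.skew.self_of_nhds v w

theorem fderiv_metric_symm (C : NearlyCosymplecticChart y₀ G Φ Ξ Γ)
    (s v w : E) : fderiv ℝ G y₀ s v w = fderiv ℝ G y₀ s w v := by
  have h : ∀ v w, HasFDerivAt (fun y ↦ G y v w)
      (((ContinuousLinearMap.apply ℝ ℝ w).comp
        (ContinuousLinearMap.apply ℝ (E →L[ℝ] ℝ) v)).comp (fderiv ℝ G y₀)) y₀ := fun v w ↦
    (((ContinuousLinearMap.apply ℝ ℝ w).comp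
      (ContinuousLinearMap.apply ℝ (E →L[ℝ] ℝ) v)).hasFDerivAt).comp y₀
      C.differentiableAt_metric.hasFDerivAt
  have h1 := (h w v).congr_of_eventuallyEq (C.symm.mono fun y hy ↦ hy v w)
  exact DFunLike.congr_fun ((h v w).unique h1) s

theorem metric_ext (C : NearlyCosymplecticChart y₀ G Φ Ξ Γ)
    {v w : E} (h : ∀ z, G y₀ v z = G y₀ w z) : v = w :=
  sub_eq_zero.mp (C.nondegenerate _ fun z ↦ by simp [h])

theorem fderiv_metric (C : NearlyCosymplecticChart y₀ G Φ Ξ Γ) (s v w : E) :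
    fderiv ℝ G y₀ s v w = G y₀ (Γ s v) w + G y₀ v (Γ s w) := by
  rw [C.symm_at v, C.koszul, C.koszul, C.fderiv_metric_symm s w v, C.fderiv_metric_symm v s w,
    C.fderiv_metric_symm w s v]
  ring

theorem christoffel_symm (C : NearlyCosymplecticChart y₀ G Φ Ξ Γ) (v w : E) : Γ v w = Γ w v :=
  C.metric_ext fun z ↦ by
    rw [C.koszul, C.koszul, C.fderiv_metric_symm z v w]; ring

theorem christoffel_add (C : NearlyCosymplecticChart y₀ G Φ Ξ Γ)
    (v w w' : E) : Γ v (w + w') = Γ v w + Γ v w' :=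
  C.metric_ext fun z ↦ by simp only [C.koszul, map_add, add_apply]; ring

theorem christoffel_smul (C : NearlyCosymplecticChart y₀ G Φ Ξ Γ)
    (v w : E) (c : ℝ) : Γ v (c • w) = c • Γ v w :=
  C.metric_ext fun z ↦ by
    simp only [C.koszul, map_smul, smul_apply, smul_eq_mul]
    ring

/-- The Riemannian connection is compatible with the metric, along a map `u`. -/
theorem hasFDerivAt_metric_along (C : NearlyCosymplecticChart y₀ G Φ Ξ Γ)
    {F : Type*} [NormedAddCommGroup F] [NormedSpace ℝ F]
    {u W₁ W₂ : F → E} {u' W₁' W₂' : F →L[ℝ] E} {x₀ : F} (hy : u x₀ = y₀) (hu : HasFDerivAt u u' x₀)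
    (h₁ : HasFDerivAt W₁ W₁' x₀) (h₂ : HasFDerivAt W₂ W₂' x₀) {m : F → ℝ} {m' : F →L[ℝ] ℝ}
    (hm : HasFDerivAt m m' x₀) (heq : ∀ᶠ x in 𝓝 x₀, G (u x) (W₁ x) (W₂ x) = m x) (s : F) :
    m' s = G y₀ (W₁' s + Γ (u' s) (W₁ x₀)) (W₂ x₀) + G y₀ (W₁ x₀) (W₂' s + Γ (u' s) (W₂ x₀)) := by
  subst hy
  have hG := (C.differentiableAt_metric.hasFDerivAt.comp x₀ hu)
  have h := ((hG.clm_apply h₁).clm_apply h₂).unique (hm.congr_of_eventuallyEq heq)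
  rw [← h]
  simp only [Function.comp_apply, add_apply, ContinuousLinearMap.comp_apply,
    ContinuousLinearMap.flip_apply, C.fderiv_metric, map_add]
  ring

theorem hasFDerivAt_map_along {F : Type*} [NormedAddCommGroup F] [NormedSpace ℝ F]
    (hΦ : DifferentiableAt ℝ Φ y₀)
    {u W : F → E} {u' W' : F →L[ℝ] E} {x₀ : F} (hy : u x₀ = y₀) (hu : HasFDerivAt u u' x₀)
    (hW : HasFDerivAt W W' x₀) :
    HasFDerivAt (fun x ↦ Φ (u x) (W x))
      ((Φ y₀).comp W' + ((fderiv ℝ Φ y₀).comp u').flip (W x₀)) x₀ := by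
  subst hy
  exact (hΦ.hasFDerivAt.comp x₀ hu).clm_apply hW

/-- Differentiate `g(φ v, w) = -g(v, φ w)` for fields with constant coordinates; the Christoffel
terms cancel by skewness at the point. -/
theorem covDerivEnd_skew (C : NearlyCosymplecticChart y₀ G Φ Ξ Γ) (s v w : E) :
    G y₀ (covDerivEnd y₀ Φ Γ s v) w = -G y₀ (covDerivEnd y₀ Φ Γ s w) v := by
  have hid := hasFDerivAt_id (𝕜 := ℝ) y₀
  have hc := fun v : E ↦ hasFDerivAt_const (𝕜 := ℝ) v y₀
  have hΦ := fun v ↦ hasFDerivAt_map_along C.differentiableAt_map rfl hid (hc v)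
  have hm : HasFDerivAt (fun y ↦ G y v (Φ y w)) _ y₀ :=
    ((C.differentiableAt_metric.hasFDerivAt).clm_apply (hc v)).clm_apply (hΦ w)
  have h1 := C.hasFDerivAt_metric_along rfl hid (hc v) (hΦ w) hm
    (Eventually.of_forall fun _ ↦ rfl) s
  have h2 := C.hasFDerivAt_metric_along rfl hid (hΦ v) (hc w) hm.neg
    (C.skew.mono fun y hy ↦ hy v w) s
  rw [neg_apply, h1] at h2
  simp only [ContinuousLinearMap.comp_zero, zero_add, ContinuousLinearMap.comp_id,
    ContinuousLinearMap.flip_apply, zero_apply, ContinuousLinearMap.id_apply,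
    id] at h2
  have h3 := C.skew_at (Γ s v) w
  have h4 := C.skew_at v (Γ s w)
  rw [C.symm_at _ v]
  simp only [covDerivEnd, map_add, map_sub, add_apply, sub_apply] at h2 ⊢
  linarith

/-- The covariant derivative of the Reeb field is skew on its orthogonal complement. -/
theorem reeb_killing (C : NearlyCosymplecticChart y₀ G Φ Ξ Γ) {x : E} (hx : G y₀ x (Ξ y₀) = 0) :
    G y₀ (fderiv ℝ Ξ y₀ x + Γ x (Ξ y₀)) x = 0 := by
  have hid := hasFDerivAt_id (𝕜 := ℝ) y₀
  have hc := fun v : E ↦ hasFDerivAt_const (𝕜 := ℝ) v y₀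
  have hΦ := fun v ↦ hasFDerivAt_map_along C.differentiableAt_map rfl hid (hc v)
  have hΞ := C.differentiableAt_reeb.hasFDerivAt
  have hG := C.differentiableAt_metric.hasFDerivAt
  have hm₁ : HasFDerivAt (fun y ↦ G y x x) _ y₀ := (hG.clm_apply (hc x)).clm_apply (hc x)
  have hm₂ : HasFDerivAt (fun y ↦ G y x (Ξ y)) _ y₀ := (hG.clm_apply (hc x)).clm_apply hΞ
  have h1 := C.hasFDerivAt_metric_along rfl hid (hc x) (hc x) hm₁
    (Eventually.of_forall fun _ ↦ rfl) (Ξ y₀)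
  -- Differentiating `g(φ x, φ x) = g(x, x) - η(x)²` along `ξ` gives `g((∇_ξ φ) x, φ x) = 0`, since
  -- `η(x) = 0` at the point.
  have h2 := C.hasFDerivAt_metric_along rfl hid (hΦ x) (hΦ x) (hm₁.sub (hm₂.mul hm₂))
    (C.metric_map.mono fun y hy ↦ hy x x) (Ξ y₀)
  rw [sub_apply, h1] at h2
  have h0 := hasFDerivAt_const (𝕜 := ℝ) (0 : E) y₀
  have hΦΞ := hasFDerivAt_map_along C.differentiableAt_map rfl hid hΞ
  have h3 := DFunLike.congr_fun (hΦΞ.unique (h0.congr_of_eventuallyEq C.map_reeb)) x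
  -- From `φ ξ = 0`. The nearly cosymplectic condition then gives `(∇_ξ φ) x = φ ∇_x ξ`, so the
  -- quantity wanted equals `g((∇_ξ φ) x, φ x)`.
  have hQ : covDerivEnd y₀ Φ Γ x (Ξ y₀) = -Φ y₀ (fderiv ℝ Ξ y₀ x + Γ x (Ξ y₀)) := by
    have hz : Γ x (Φ y₀ (Ξ y₀)) = 0 := by
      rw [C.map_reeb.self_of_nhds]
      simpa using C.christoffel_smul x 0 0
    simp only [add_apply, ContinuousLinearMap.comp_apply, ContinuousLinearMap.flip_apply,
      zero_apply, ContinuousLinearMap.id_apply] at h3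
    rw [covDerivEnd, hz, map_add, eq_neg_of_add_eq_zero_right h3]
    abel
  have h4 := C.nearly x (Ξ y₀)
  have h5 := C.metric_map.self_of_nhds (fderiv ℝ Ξ y₀ x + Γ x (Ξ y₀)) x
  have h6 := C.metric_map.self_of_nhds (Γ (Ξ y₀) x) x
  rw [hx, mul_zero, sub_zero] at h5 h6
  rw [hQ] at h4
  have h7 : Φ y₀ (fderiv ℝ Ξ y₀ x + Γ x (Ξ y₀)) = covDerivEnd y₀ Φ Γ (Ξ y₀) x := by
    rw [neg_add_eq_zero] at h4; exact h4
  rw [← h5, h7]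
  simp only [ContinuousLinearMap.comp_zero, zero_add, ContinuousLinearMap.comp_id,
    ContinuousLinearMap.flip_apply, zero_apply, ContinuousLinearMap.id_apply,
    id, hx, zero_smul, sub_zero, add_zero] at h2
  rw [C.symm_at x, C.symm_at (Φ y₀ x)] at h2
  simp only [covDerivEnd, map_add, map_sub, add_apply, sub_apply] at h2 ⊢
  linarith

end NearlyCosymplecticChart
end Calculus

/-! ### Differentiating the semi-slant identities along the immersion, in charts. -/

section Calculus

open Filter Topology

variable {E : Type*} [NormedAddCommGroup E] [NormedSpace ℝ E]
  {F : Type*} [NormedAddCommGroup F] [NormedSpace ℝ F]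
  {F₀ : Type*} [NormedAddCommGroup F₀] [NormedSpace ℝ F₀]

/-- The covariant derivative `∇_v ∂_w` along `u`, where the Christoffel symbols are `Γ`. -/
def alongDeriv (u : F → E) (Γ : E → E → E) (x₀ v w : F) : E :=
  fderiv ℝ (fderiv ℝ u) x₀ v w + Γ (fderiv ℝ u x₀ v) (fderiv ℝ u x₀ w)

namespace NearlyCosymplecticChart

variable {y₀ : E} {G : E → E →L[ℝ] E →L[ℝ] ℝ} {Φ : E → E →L[ℝ] E}
    {Ξ : E → E} {Γ : E → E → E}
    {u : F → E} {x₀ : F} {j : F₀ → F} {j' : F₀ →L[ℝ] F} {a : F₀} {m : F₀ → ℝ} {m' : F₀ →L[ℝ] ℝ}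

theorem alongDeriv_symm (C : NearlyCosymplecticChart y₀ G Φ Ξ Γ)
    (hu : ContDiffAt ℝ 2 u x₀) (v w : F) :
    alongDeriv u Γ x₀ v w = alongDeriv u Γ x₀ w v := by
  have h := hu.isSymmSndFDerivAt (by simp) v w
  rw [alongDeriv, alongDeriv, h, C.christoffel_symm]

theorem alongDeriv_add (C : NearlyCosymplecticChart y₀ G Φ Ξ Γ) (v w w' : F) :
    alongDeriv u Γ x₀ v (w + w') = alongDeriv u Γ x₀ v w + alongDeriv u Γ x₀ v w' := by
  simp only [alongDeriv, map_add, C.christoffel_add]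
  abel

theorem alongDeriv_smul (C : NearlyCosymplecticChart y₀ G Φ Ξ Γ) (v w : F) (c : ℝ) :
    alongDeriv u Γ x₀ v (c • w) = c • alongDeriv u Γ x₀ v w := by
  simp only [alongDeriv, map_smul, C.christoffel_smul, smul_add]

theorem hasFDerivAt_fderiv_slice (hu : ContDiffAt ℝ 2 u x₀) (hj : HasFDerivAt j j' a)
    (hja : j a = x₀) (v : F) : HasFDerivAt (fun t ↦ fderiv ℝ u (j t) v)
      (((fderiv ℝ (fderiv ℝ u) x₀).comp j').flip v) a := by
  subst hja
  have h1 : DifferentiableAt ℝ (fderiv ℝ u) (j a) :=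
    (hu.fderiv_right (m := 1) (by norm_num)).differentiableAt one_ne_zero
  have h2 := (h1.hasFDerivAt.comp a hj).clm_apply (hasFDerivAt_const v a)
  simpa using h2

theorem hasFDerivAt_slice (hu : ContDiffAt ℝ 2 u x₀) (hj : HasFDerivAt j j' a)
    (hja : j a = x₀) : HasFDerivAt (fun t ↦ u (j t)) ((fderiv ℝ u x₀).comp j') a := by
  subst hja
  exact (hu.differentiableAt two_ne_zero).hasFDerivAt.comp a hj

/-- The map `j` is the identity or the inclusion of one factor. Slices are needed because the
induced metric on each factor is recorded only along the leaf of the other factor through the point.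
-/
theorem deriv_metric_slice (C : NearlyCosymplecticChart y₀ G Φ Ξ Γ)
    (hu : ContDiffAt ℝ 2 u x₀) (hy : u x₀ = y₀) (hj : HasFDerivAt j j' a)
    (hja : j a = x₀) (hm : HasFDerivAt m m' a) {v w : F}
    (heq : ∀ᶠ t in 𝓝 a, G (u (j t)) (fderiv ℝ u (j t) v) (fderiv ℝ u (j t) w) = m t) (s : F₀) :
    m' s = G y₀ (alongDeriv u Γ x₀ (j' s) v) (fderiv ℝ u x₀ w) +
      G y₀ (fderiv ℝ u x₀ v) (alongDeriv u Γ x₀ (j' s) w) := by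
  have h := C.hasFDerivAt_metric_along (by rw [hja, hy]) (hasFDerivAt_slice hu hj hja)
    (hasFDerivAt_fderiv_slice hu hj hja v) (hasFDerivAt_fderiv_slice hu hj hja w) hm heq s
  rw [h]
  simp [alongDeriv, hja]

/-- The product rule for `g(φ ∂_v u, ∂_w u)`, with skewness moving `φ` off the derivative of the
first field. Both relations between `ψ` and `B` are instances. -/
theorem deriv_form_slice (C : NearlyCosymplecticChart y₀ G Φ Ξ Γ)
    (hu : ContDiffAt ℝ 2 u x₀) (hy : u x₀ = y₀) (hj : HasFDerivAt j j' a)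
    (hja : j a = x₀) (hm : HasFDerivAt m m' a) {v w : F}
    (heq : ∀ᶠ t in 𝓝 a,
      G (u (j t)) (Φ (u (j t)) (fderiv ℝ u (j t) v)) (fderiv ℝ u (j t) w) = m t) (s : F₀) :
    m' s = G y₀ (covDerivEnd y₀ Φ Γ (fderiv ℝ u x₀ (j' s)) (fderiv ℝ u x₀ v)) (fderiv ℝ u x₀ w) -
      G y₀ (alongDeriv u Γ x₀ (j' s) v) (Φ y₀ (fderiv ℝ u x₀ w)) +
      G y₀ (alongDeriv u Γ x₀ (j' s) w) (Φ y₀ (fderiv ℝ u x₀ v)) := by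
  have hs := hasFDerivAt_slice hu hj hja
  have hv := hasFDerivAt_fderiv_slice hu hj hja v
  have hs0 : u (j a) = y₀ := by rw [hja, hy]
  have h := C.hasFDerivAt_metric_along (u := fun t ↦ u (j t)) hs0 hs
    (hasFDerivAt_map_along (u := fun t ↦ u (j t)) C.differentiableAt_map hs0 hs hv)
    (hasFDerivAt_fderiv_slice hu hj hja w) hm heq s
  rw [h, hs0, hja, C.symm_at _ (Φ y₀ (fderiv ℝ u x₀ v))]
  rw [← neg_eq_iff_eq_neg.mpr (C.skew_at (alongDeriv u Γ x₀ (j' s) v) (fderiv ℝ u x₀ w))]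
  simp [alongDeriv, covDerivEnd]
  ring

theorem deriv_reeb_slice (C : NearlyCosymplecticChart y₀ G Φ Ξ Γ)
    (hu : ContDiffAt ℝ 2 u x₀) (hy : u x₀ = y₀) (hj : HasFDerivAt j j' a)
    (hja : j a = x₀) (hm : HasFDerivAt m m' a) {w : F}
    (heq : ∀ᶠ t in 𝓝 a, G (u (j t)) (Ξ (u (j t))) (fderiv ℝ u (j t) w) = m t) (s : F₀) :
    m' s = G y₀ (fderiv ℝ Ξ y₀ (fderiv ℝ u x₀ (j' s)) + Γ (fderiv ℝ u x₀ (j' s)) (Ξ y₀))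
        (fderiv ℝ u x₀ w) +
      G y₀ (Ξ y₀) (alongDeriv u Γ x₀ (j' s) w) := by
  have hs := hasFDerivAt_slice hu hj hja
  have hs0 : u (j a) = y₀ := by rw [hja, hy]
  have hΞ := C.differentiableAt_reeb
  rw [← hs0] at hΞ
  have h := C.hasFDerivAt_metric_along (u := fun t ↦ u (j t)) (W₁ := fun t ↦ Ξ (u (j t))) hs0 hs
    (hΞ.hasFDerivAt.comp a hs)
    (hasFDerivAt_fderiv_slice hu hj hja w) hm heq s
  rw [h, hs0, hja]
  simp [alongDeriv]

end NearlyCosymplecticChart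

variable {E₁ : Type*} [NormedAddCommGroup E₁] [NormedSpace ℝ E₁]
  {E₂ : Type*} [NormedAddCommGroup E₂] [NormedSpace ℝ E₂]

/-- The immersion of a warped product semi-slant submanifold read in charts around the point of
coordinates `(x₁, x₂)`; `ρ` is the warping function, divided by its value at that point. -/
structure WarpedChart (G : E → E →L[ℝ] E →L[ℝ] ℝ) (Φ : E → E →L[ℝ] E) (Ξ : E → E)
    (u : E₁ × E₂ → E) (x₁ : E₁) (x₂ : E₂) (ρ : E₁ → ℝ) (θ : ℝ) : Prop where
  contDiffAt : ContDiffAt ℝ 2 u (x₁, x₂)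
  differentiableAt : DifferentiableAt ℝ ρ x₁
  normalized : ρ x₁ = 1
  mixed : ∀ᶠ y in 𝓝 (x₁, x₂), ∀ x z, G (u y) (fderiv ℝ u y (x, 0)) (fderiv ℝ u y (0, z)) = 0
  horizontal : ∀ᶠ t in 𝓝 x₂, ∀ x y, G (u (x₁, t)) (fderiv ℝ u (x₁, t) (x, 0))
    (fderiv ℝ u (x₁, t) (y, 0)) =
      G (u (x₁, x₂)) (fderiv ℝ u (x₁, x₂) (x, 0)) (fderiv ℝ u (x₁, x₂) (y, 0))
  vertical : ∀ᶠ s in 𝓝 x₁, ∀ z w, G (u (s, x₂)) (fderiv ℝ u (s, x₂) (0, z))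
    (fderiv ℝ u (s, x₂) (0, w)) = ρ s ^ 2 *
      G (u (x₁, x₂)) (fderiv ℝ u (x₁, x₂) (0, z)) (fderiv ℝ u (x₁, x₂) (0, w))
  invariant : ∀ᶠ y in 𝓝 (x₁, x₂), ∀ x z,
    G (u y) (Φ (u y) (fderiv ℝ u y (x, 0))) (fderiv ℝ u y (0, z)) = 0
  reeb : ∀ᶠ y in 𝓝 (x₁, x₂), ∀ z, G (u y) (Ξ (u y)) (fderiv ℝ u y (0, z)) = 0
  slant : ∀ᶠ y in 𝓝 (x₁, x₂), ∀ z, ∃ t,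
    (∀ w, G (u y) (Φ (u y) (fderiv ℝ u y (0, z))) (fderiv ℝ u y (0, w)) =
      G (u y) (fderiv ℝ u y (0, t)) (fderiv ℝ u y (0, w))) ∧
    G (u y) (fderiv ℝ u y (0, t)) (fderiv ℝ u y (0, t)) =
      Real.cos θ ^ 2 * G (u y) (fderiv ℝ u y (0, z)) (fderiv ℝ u y (0, z))

section Main

variable {y₀ : E} {G : E → E →L[ℝ] E →L[ℝ] ℝ} {Φ : E → E →L[ℝ] E}
    {Ξ : E → E} {Γ : E → E → E} {u : E₁ × E₂ → E} {x₁ : E₁} {x₂ : E₂} {ρ : E₁ → ℝ}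
    {V : Type*} [NormedAddCommGroup V] [InnerProductSpace ℝ V]
    {D : E₁ × E₂ →ₗ[ℝ] V} {B : E₁ × E₂ →ₗ[ℝ] E₁ × E₂ →ₗ[ℝ] V}
    {φ : V →ₗ[ℝ] V} {ξ : V} {θ : ℝ}

/-- The fundamental form `g(φ z, w)` on the slant factor, along `N₁ × {x₂}`. -/
def slantForm (G : E → E →L[ℝ] E →L[ℝ] ℝ) (Φ : E → E →L[ℝ] E) (u : E₁ × E₂ → E) (x₂ : E₂)
    (z w : E₂) (s : E₁) : ℝ :=
  G (u (s, x₂)) (Φ (u (s, x₂)) (fderiv ℝ u (s, x₂) (0, z))) (fderiv ℝ u (s, x₂) (0, w))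

/-- The frame is orthonormal at the base point and is kept constant in coordinates. At `s` its
vectors have length `|ρ s|`, while the tangential part of `φ e_j` keeps base length |cos θ|; pairing
with the metric at `s` gives `ρ s ^ 2` in each entry, hence `ρ s ^ 4`. -/
theorem WarpedChart.sum_slantForm_sq (U : WarpedChart G Φ Ξ u x₁ x₂ ρ θ)
    (hG : ∀ v w, G (u (x₁, x₂)) (fderiv ℝ u (x₁, x₂) v) (fderiv ℝ u (x₁, x₂) w) =
      inner ℝ (D v) (D w)) {κ : Type*} [Fintype κ] {e : κ → E₂}
    (he : IsFrame (D ∘ₗ LinearMap.inr ℝ E₁ E₂) e) :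
    ∀ᶠ s in 𝓝 x₁, ∑ j, ∑ k, slantForm G Φ u x₂ (e j) (e k) s ^ 2 =
      ρ s ^ 4 * (Fintype.card κ * Real.cos θ ^ 2) := by
  have ht : Tendsto (fun s : E₁ ↦ (s, x₂)) (𝓝 x₁) (𝓝 (x₁, x₂)) :=
    (Continuous.prodMk_left x₂).tendsto x₁
  have hρ : ∀ᶠ s in 𝓝 x₁, ρ s ≠ 0 := by
    refine U.differentiableAt.continuousAt.eventually_ne ?_
    simp [U.normalized]
  filter_upwards [ht.eventually U.slant, U.vertical, hρ] with s hs hv hρs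
  have : ∀ j, ∑ k, slantForm G Φ u x₂ (e j) (e k) s ^ 2 = ρ s ^ 4 * Real.cos θ ^ 2 := by
    intro j
    obtain ⟨t, h1, h2⟩ := hs (e j)
    have h3 := he.sum_sq t
    have h4 : ‖D (0, e j)‖ = 1 := he.orthonormal.1 j
    simp only [LinearMap.comp_apply, LinearMap.inr_apply] at h3
    rw [hv, hv, hG, hG, real_inner_self_eq_norm_sq, real_inner_self_eq_norm_sq, h4] at h2
    have h5 : ‖D (0, t)‖ ^ 2 = Real.cos θ ^ 2 := by
      have : ρ s ^ 2 ≠ 0 := pow_ne_zero _ hρs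
      apply mul_left_cancel₀ this
      rw [h2]; ring
    simp_rw [real_inner_comm (D (0, t))] at h3
    simp_rw [slantForm, h1, hv, hG, mul_pow]
    rw [← Finset.mul_sum, h3, h5]
    ring
  simp only [this, Finset.sum_const, Finset.card_univ, nsmul_eq_mul]
  ring

/-- Along an affine slice there is no second-order term from `j`, so the ambient derivative of a
leaf is the restriction of that of the whole immersion. -/
theorem fderiv_fderiv_comp {F₀ : Type*} [NormedAddCommGroup F₀] [NormedSpace ℝ F₀]
    {F : Type*} [NormedAddCommGroup F] [NormedSpace ℝ F]
    {u : F → E} {j : F₀ → F} {L : F₀ →L[ℝ] F} {a : F₀} (hu : ContDiffAt ℝ 2 u (j a))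
    (hj : ∀ t, HasFDerivAt j L t) (v w : F₀) :
    fderiv ℝ (fun t ↦ u (j t)) a w = fderiv ℝ u (j a) (L w) ∧
    fderiv ℝ (fderiv ℝ (fun t ↦ u (j t))) a v w = fderiv ℝ (fderiv ℝ u) (j a) (L v) (L w) := by
  have h1 : ∀ᶠ y in 𝓝 (j a), DifferentiableAt ℝ u y :=
    (hu.eventually (by simp)).mono fun y hy ↦ hy.differentiableAt two_ne_zero
  have h2 : fderiv ℝ (fun t ↦ u (j t)) =ᶠ[𝓝 a] fun t ↦ (fderiv ℝ u (j t)).comp L := by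
    filter_upwards [(hj a).continuousAt.eventually h1] with t ht
    exact (ht.hasFDerivAt.comp t (hj t)).fderiv
  have h3 : DifferentiableAt ℝ (fderiv ℝ u) (j a) :=
    (hu.fderiv_right (m := 1) (by norm_num)).differentiableAt one_ne_zero
  refine ⟨by rw [h2.self_of_nhds]; rfl, ?_⟩
  have h4 : HasFDerivAt (fun t ↦ (fderiv ℝ u (j t)).comp L) _ a :=
    (h3.hasFDerivAt.comp a (hj a)).clm_comp (hasFDerivAt_const L a)
  rw [h2.fderiv_eq, h4.fderiv]
  simp

/-- Each differential relation at the point is the derivative of an identity valid near it or along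
a slice. The map `c` carries coordinates to the tangent space, and since `ρ` is 1 at the point, its
derivative there is that of ln f. -/
theorem semiSlantPoint_of_chart (C : NearlyCosymplecticChart y₀ G Φ Ξ Γ)
    (U : WarpedChart G Φ Ξ u x₁ x₂ ρ θ) (hy : u (x₁, x₂) = y₀)
    (c : E ≃ₗ[ℝ] V) (hc : ∀ v w, G y₀ v w = inner ℝ (c v) (c w))
    (hD : ∀ v, D v = c (fderiv ℝ u (x₁, x₂) v))
    (hB : ∀ v w, B v w = c (alongDeriv u Γ (x₁, x₂) v w))
    (hφ : ∀ v, φ (c v) = c (Φ y₀ v)) (hξ : ξ = c (Ξ y₀))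
    (injective : Function.Injective D) (hinv : ∀ x, ∃ y, φ (D (x, 0)) = D (y, 0))
    (hreeb : ∃ x, ξ = D (x, 0))
    (sin_ne_zero : Real.sin θ ≠ 0) :
    SemiSlantPoint D B φ ξ (fderiv ℝ ρ x₁ : E₁ →ₗ[ℝ] ℝ) θ
      (fun v w z ↦ inner ℝ (c (covDerivEnd y₀ Φ Γ (c.symm v) (c.symm w))) z)
      (fun x z w ↦ fderiv ℝ (slantForm G Φ u x₂ z w) x₁ x) := by
  have hu := U.contDiffAt
  have hl : HasFDerivAt (fun s : E₁ ↦ (s, x₂)) (ContinuousLinearMap.inl ℝ E₁ E₂) x₁ :=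
    hasFDerivAt_prodMk_left x₁ x₂
  have hr : HasFDerivAt (fun t : E₂ ↦ (x₁, t)) (ContinuousLinearMap.inr ℝ E₁ E₂) x₂ :=
    hasFDerivAt_prodMk_right x₁ x₂
  have hid := hasFDerivAt_id (𝕜 := ℝ) (x₁, x₂)
  have h0 := hasFDerivAt_const (𝕜 := ℝ) (0 : ℝ) (x₁, x₂)
  have hΩ : ∀ z w, HasFDerivAt (slantForm G Φ u x₂ z w)
      (fderiv ℝ (slantForm G Φ u x₂ z w) x₁) x₁ := by
    intro z w
    refine DifferentiableAt.hasFDerivAt ?_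
    have hs := NearlyCosymplecticChart.hasFDerivAt_slice hu hl rfl
    have hG := C.differentiableAt_metric
    rw [← hy] at hG
    exact ((hG.hasFDerivAt.comp x₁ hs).clm_apply
      (NearlyCosymplecticChart.hasFDerivAt_map_along (u := fun s ↦ u (s, x₂))
        C.differentiableAt_map hy hs
        (NearlyCosymplecticChart.hasFDerivAt_fderiv_slice hu hl rfl (0, z)))).clm_apply
      (NearlyCosymplecticChart.hasFDerivAt_fderiv_slice hu hl rfl (0, w)) |>.differentiableAt
  refine
    { injective := injective
      orthogonal := fun x z ↦ by
        have := U.mixed.self_of_nhds x z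
        rwa [hy, hc, ← hD, ← hD] at this
      symm := fun v w ↦ by rw [hB, hB, C.alongDeriv_symm hu]
      vertical_deriv := fun x z w ↦ ?_
      mixed_deriv := fun s x z ↦ ?_
      horizontal_deriv := fun z x y ↦ ?_
      skew := fun v w ↦ ?_
      inner_map := fun v w ↦ ?_
      invariant := hinv
      reeb := hreeb
      killing := fun z ↦ ?_
      slant := fun z ↦ ?_
      sin_ne_zero := sin_ne_zero
      swap₁₂ := fun v w z ↦ ?_
      swap₂₃ := fun v w z ↦ ?_
      mixed_form := fun z x w ↦ ?_
      vertical_form := fun x z w ↦ ?_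
      trace_form := fun κ _ e he x ↦ ?_ }
  · have hρ : HasFDerivAt (fun s ↦ ρ s ^ 2 * G (u (x₁, x₂)) (fderiv ℝ u (x₁, x₂) (0, z))
        (fderiv ℝ u (x₁, x₂) (0, w))) _ x₁ :=
      ((U.differentiableAt.hasFDerivAt.pow 2).mul_const _)
    have h := C.deriv_metric_slice hu hy hl rfl hρ (U.vertical.mono fun s hs ↦ hs z w) x
    simp only [hc, hy, ← hD, ContinuousLinearMap.inl_apply, ← hB] at h
    rw [← h]
    simp [U.normalized]
    ring
  · have h := C.deriv_metric_slice hu hy hid rfl h0 (U.mixed.mono fun y hy ↦ hy x z) s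
    simp only [hc, ← hD, ContinuousLinearMap.id_apply, ← hB] at h
    exact h.symm
  · have hc0 := hasFDerivAt_const (𝕜 := ℝ) (G (u (x₁, x₂)) (fderiv ℝ u (x₁, x₂) (x, 0))
      (fderiv ℝ u (x₁, x₂) (y, 0))) x₂
    have h := C.deriv_metric_slice hu hy hr rfl hc0 (U.horizontal.mono fun t ht ↦ ht x y) z
    simp only [hc, ← hD, ContinuousLinearMap.inr_apply, ← hB] at h
    exact h.symm
  · obtain ⟨v, rfl⟩ := c.surjective v
    obtain ⟨w, rfl⟩ := c.surjective w
    simpa only [hφ, ← hc] using C.skew_at v w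
  · obtain ⟨v, rfl⟩ := c.surjective v
    obtain ⟨w, rfl⟩ := c.surjective w
    simpa only [hφ, ← hc, hξ] using C.metric_map.self_of_nhds v w
  · have h := C.deriv_reeb_slice hu hy hid rfl h0 (U.reeb.mono fun y hy ↦ hy (0 + z)) (0, z)
    simp only [zero_add, ContinuousLinearMap.id_apply] at h
    rw [C.reeb_killing, zero_add, C.symm_at, hc, ← hB, ← hξ] at h
    · exact h.symm
    · have := U.reeb.self_of_nhds z
      rw [hy] at this
      rw [C.symm_at, this]
  · obtain ⟨t, h1, h2⟩ := U.slant.self_of_nhds z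
    refine ⟨t, fun w ↦ ?_, ?_⟩
    · have := h1 w
      rw [hy, hc, hc, ← hφ, ← hD, ← hD, ← hD] at this
      rw [inner_sub_left, this, sub_self]
    · rw [hy, hc, hc, ← hD, ← hD] at h2
      simpa only [real_inner_self_eq_norm_sq] using h2
  · have := C.nearly (c.symm v) (c.symm w)
    rw [eq_neg_of_add_eq_zero_left this, map_neg, inner_neg_left]
  · have := C.covDerivEnd_skew (c.symm v) (c.symm w) (c.symm z)
    rw [hc, hc] at this
    simpa using this
  · have h := C.deriv_form_slice hu hy hid rfl h0 (U.invariant.mono fun y hy ↦ hy x w) (0, z)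
    simp only [ContinuousLinearMap.id_apply, zero_apply, hc, ← hB, ← hD, ← hφ] at h
    simp only [hD, LinearEquiv.symm_apply_apply] at h ⊢
    linarith
  · have h := C.deriv_form_slice hu hy hl rfl (hΩ z w) (Eventually.of_forall fun _ ↦ rfl) x
    simp only [ContinuousLinearMap.inl_apply, hc, ← hB, ← hD, ← hφ] at h
    simp only [hD, LinearEquiv.symm_apply_apply] at h ⊢
    exact h
  · have hval : ∀ j k, slantForm G Φ u x₂ (e j) (e k) x₁ =
        inner ℝ (φ (D (0, e j))) (D (0, e k)) := by
      intro j k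
      rw [slantForm, hy, hc, ← hφ, hD, hD]
    have h1 : HasFDerivAt (fun s ↦ ∑ j, ∑ k, slantForm G Φ u x₂ (e j) (e k) s ^ 2) _ x₁ :=
      HasFDerivAt.fun_sum fun j _ ↦ HasFDerivAt.fun_sum fun k _ ↦ (hΩ (e j) (e k)).pow 2
    have h2 : HasFDerivAt (fun s ↦ ρ s ^ 4 *
        (Fintype.card κ * Real.cos θ ^ 2)) _ x₁ :=
      (U.differentiableAt.hasFDerivAt.pow 4).mul_const _
    have htr := U.sum_slantForm_sq (fun v w ↦ by rw [hD, hD, hy, hc]) he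
    -- Differentiating `Σ Ω² = ρ⁴ n cos²θ`, with `n` the size of the frame, gives `2 Σ Ω dΩ = 4
    -- lam(x) Σ Ω²`; only this trace of `dΩ` is ever needed.
    have h3 := DFunLike.congr_fun (h1.unique (h2.congr_of_eventuallyEq htr)) x
    have h6 := htr.self_of_nhds
    simp only [U.normalized, hval, one_pow, one_mul] at h6
    simp [U.normalized] at h3
    simp only [hval, mul_assoc, ← Finset.mul_sum] at h3
    have h4 : (2 : ℝ) * ∑ j, ∑ k, inner ℝ (φ (D (0, e j))) (D (0, e k)) *
        fderiv ℝ (slantForm G Φ u x₂ (e j) (e k)) x₁ x = 4 * fderiv ℝ ρ x₁ x *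
        ∑ j, ∑ k, inner ℝ (φ (D (0, e j))) (D (0, e k)) ^ 2 := by
      rw [h3, h6]; ring
    have h5 : ((fderiv ℝ ρ x₁ : E₁ →ₗ[ℝ] ℝ) x) = fderiv ℝ ρ x₁ x := rfl
    rw [h5]
    linarith

end Main
end Calculus

/-! ### Coordinate fields, the metric and the Christoffel symbols in the preferred chart. -/

section ChartFields

open Filter Topology Set

variable {E : Type*} [NormedAddCommGroup E] [NormedSpace ℝ E]
  {M : Type*} [TopologicalSpace M] [ChartedSpace E M]

theorem chart_symm_mem_source {p : M} {y : E} (hy : y ∈ (extChartAt 𝓘(ℝ, E) p).target) :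
    (extChartAt 𝓘(ℝ, E) p).symm y ∈ (chartAt E p).source := by
  have := (extChartAt 𝓘(ℝ, E) p).map_target hy
  rwa [extChartAt_source] at this

theorem coordVec_add (p : M) (y v w : E) : coordVec p y (v + w) =
    coordVec p y v + coordVec p y w := by
  simp only [coordVec, map_add]

theorem coordVec_smul (p : M) (y : E) (c : ℝ) (v : E) :
    coordVec p y (c • v) = c • coordVec p y v := by
  simp only [coordVec, map_smul]

variable [IsManifold 𝓘(ℝ, E) ∞ M]

/-- The vector field with constant coordinates `w` in the preferred chart at `p`. -/
def constField (p : M) (w : E) (q : M) : TangentSpace 𝓘(ℝ, E) q :=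
  (trivializationAt E (TangentSpace 𝓘(ℝ, E)) p).symmL ℝ q w

theorem contMDiffAt_constField {p q : M} (hq : q ∈ (chartAt E p).source) (w : E) :
    ContMDiffAt 𝓘(ℝ, E) (𝓘(ℝ, E).prod 𝓘(ℝ, E)) ∞
      (fun q ↦ TotalSpace.mk' E (E := fun q : M ↦ TangentSpace 𝓘(ℝ, E) q) q
        (constField p w q)) q := by
  have hq' : q ∈ (trivializationAt E (TangentSpace 𝓘(ℝ, E)) p).baseSet := by simpa using hq
  rw [(trivializationAt E (TangentSpace 𝓘(ℝ, E)) p).contMDiffAt_section_iff hq']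
  refine (contMDiffAt_const (c := w)).congr_of_eventuallyEq ?_
  filter_upwards [(trivializationAt E (TangentSpace 𝓘(ℝ, E)) p).open_baseSet.mem_nhds hq'] with r hr
  rw [constField, Trivialization.symmL_apply _ hr, Trivialization.mk_symm _ hr]
  exact congrArg Prod.snd ((trivializationAt E (TangentSpace 𝓘(ℝ, E)) p).apply_symm_apply
    ((Trivialization.mem_target _).mpr hr))

/-- The differential of the inverse chart, between model spaces. -/
def chartSymmDeriv (p : M) (y : E) : E →L[ℝ] E :=
  mfderivWithin 𝓘(ℝ, E) 𝓘(ℝ, E) (extChartAt 𝓘(ℝ, E) p).symm (range 𝓘(ℝ, E)) y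

/-- Both are the derivative of the inverse chart. The trivialization form carries the smoothness of
the tangent bundle, and the `mfderiv` form is the one in the definition of the connection. -/
theorem coordVec_eq_constField {p : M} {y : E} (hy : y ∈ (extChartAt 𝓘(ℝ, E) p).target) (w : E) :
    coordVec p y w = constField p w ((extChartAt 𝓘(ℝ, E) p).symm y) := by
  have h1 := TangentBundle.symmL_trivializationAt (I := 𝓘(ℝ, E)) (𝕜 := ℝ) (chart_symm_mem_source hy)
  have h2 : (chartSymmDeriv p (extChartAt 𝓘(ℝ, E) p ((extChartAt 𝓘(ℝ, E) p).symm y))) w =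
      chartSymmDeriv p y w := by rw [(extChartAt 𝓘(ℝ, E) p).right_inv hy]
  have h3 : coordVec p y w = chartSymmDeriv p y w := by
    simp only [coordVec, chartSymmDeriv, modelWithCornersSelf_coe, range_id, mfderivWithin_univ]
    rfl
  rw [h3]
  refine h2.symm.trans ?_
  exact (DFunLike.congr_fun h1 w).symm

theorem coordRep_eq_trivializationAt {p : M} {y : E} (hy : y ∈ (extChartAt 𝓘(ℝ, E) p).target)
    (Y : ∀ p : M, TangentSpace 𝓘(ℝ, E) p) :
    coordRep p Y y = (trivializationAt E (TangentSpace 𝓘(ℝ, E)) p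
      ⟨(extChartAt 𝓘(ℝ, E) p).symm y, Y ((extChartAt 𝓘(ℝ, E) p).symm y)⟩).2 := by
  have h1 := TangentBundle.continuousLinearMapAt_trivializationAt (I := 𝓘(ℝ, E)) (𝕜 := ℝ)
    (chart_symm_mem_source hy)
  have h2 := DFunLike.congr_fun h1 (Y ((extChartAt 𝓘(ℝ, E) p).symm y))
  refine Eq.trans h2.symm ?_
  have hb : (extChartAt 𝓘(ℝ, E) p).symm y ∈
      (trivializationAt E (TangentSpace 𝓘(ℝ, E)) p).baseSet := by
    simpa using chart_symm_mem_source hy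
  rw [Trivialization.continuousLinearMapAt_apply, Trivialization.coe_linearMapAt_of_mem _ hb]

theorem coordRep_constField {p : M} {y : E} (hy : y ∈ (extChartAt 𝓘(ℝ, E) p).target) (w : E) :
    coordRep p (constField p w) y = w := by
  have hb : (extChartAt 𝓘(ℝ, E) p).symm y ∈
      (trivializationAt E (TangentSpace 𝓘(ℝ, E)) p).baseSet := by
    simpa using chart_symm_mem_source hy
  rw [coordRep_eq_trivializationAt hy, constField, Trivialization.symmL_apply _ hb,
    Trivialization.mk_symm _ hb]
  exact congrArg Prod.snd ((trivializationAt E (TangentSpace 𝓘(ℝ, E)) p).apply_symm_apply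
    ((Trivialization.mem_target _).mpr hb))

theorem coordVec_coordRep {p : M} {y : E} (hy : y ∈ (extChartAt 𝓘(ℝ, E) p).target)
    (Y : ∀ p : M, TangentSpace 𝓘(ℝ, E) p) :
    coordVec p y (coordRep p Y y) = Y ((extChartAt 𝓘(ℝ, E) p).symm y) := by
  have h := mfderivWithin_extChartAt_symm_comp_mfderiv_extChartAt (I := 𝓘(ℝ, E)) hy
  simp only [modelWithCornersSelf_coe, range_id, mfderivWithin_univ] at h
  exact DFunLike.congr_fun h (Y ((extChartAt 𝓘(ℝ, E) p).symm y))

theorem contDiffOn_coordRep {p : M} {Y : ∀ p : M, TangentSpace 𝓘(ℝ, E) p}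
    (hY : ∀ q ∈ (chartAt E p).source, ContMDiffAt 𝓘(ℝ, E) (𝓘(ℝ, E).prod 𝓘(ℝ, E)) ∞
      (fun q ↦ TotalSpace.mk' E (E := fun q : M ↦ TangentSpace 𝓘(ℝ, E) q) q (Y q)) q) :
    ContDiffOn ℝ ∞ (coordRep p Y) (extChartAt 𝓘(ℝ, E) p).target := by
  have h1 : ContMDiffOn 𝓘(ℝ, E) 𝓘(ℝ, E) ∞
      (fun y ↦ (trivializationAt E (TangentSpace 𝓘(ℝ, E)) p
      ⟨(extChartAt 𝓘(ℝ, E) p).symm y, Y ((extChartAt 𝓘(ℝ, E) p).symm y)⟩).2)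
      (extChartAt 𝓘(ℝ, E) p).target := by
    intro y hy
    have hq := chart_symm_mem_source hy
    have hq' : (extChartAt 𝓘(ℝ, E) p).symm y ∈
      (trivializationAt E (TangentSpace 𝓘(ℝ, E)) p).baseSet := by simpa using hq
    have h2 := ((trivializationAt E (TangentSpace 𝓘(ℝ, E)) p).contMDiffAt_section_iff hq').mp
      (hY _ hq)
    exact h2.comp_contMDiffWithinAt y (contMDiffOn_extChartAt_symm p y hy)
  exact (contMDiffOn_iff_contDiffOn.mp h1).congr fun y hy ↦ coordRep_eq_trivializationAt hy Y

theorem coordVec_symm {p : M} {y : E} (hy : y ∈ (extChartAt 𝓘(ℝ, E) p).target)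
    (X : TangentSpace 𝓘(ℝ, E) ((extChartAt 𝓘(ℝ, E) p).symm y)) :
    coordVec p y (tangentCoord 𝓘(ℝ, E) _ (mfderiv 𝓘(ℝ, E) 𝓘(ℝ, E) (extChartAt 𝓘(ℝ, E) p)
      ((extChartAt 𝓘(ℝ, E) p).symm y) X)) = X := by
  have h := mfderivWithin_extChartAt_symm_comp_mfderiv_extChartAt (I := 𝓘(ℝ, E)) hy
  simp only [modelWithCornersSelf_coe, range_id, mfderivWithin_univ] at h
  exact DFunLike.congr_fun h X

theorem constField_self (p : M) (w : E) :
    constField p w p = (tangentCoord 𝓘(ℝ, E) p).symm w := by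
  have h1 := TangentBundle.symmL_trivializationAt (I := 𝓘(ℝ, E)) (𝕜 := ℝ) (mem_chart_source E p)
  have h2 := mfderivWithin_range_extChartAt_symm (I := 𝓘(ℝ, E)) (x := p)
  exact (DFunLike.congr_fun h1 w).trans (DFunLike.congr_fun h2 w)

theorem coordRep_self (p : M) (Y : ∀ p : M, TangentSpace 𝓘(ℝ, E) p) :
    coordRep p Y (extChartAt 𝓘(ℝ, E) p p) = tangentCoord 𝓘(ℝ, E) p (Y p) := by
  -- As an `E`-valued function of the base point, `k` allows the point to be replaced by an equal
  -- one without transport between tangent spaces.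
  let k : M → E := fun q ↦ tangentCoord 𝓘(ℝ, E) _
    (mfderiv 𝓘(ℝ, E) 𝓘(ℝ, E) (extChartAt 𝓘(ℝ, E) p) q (Y q))
  have h1 : coordRep p Y (extChartAt 𝓘(ℝ, E) p p) = k p :=
    congrArg k (extChartAt_to_inv p)
  have h2 := DFunLike.congr_fun (mfderiv_extChartAt_self (I := 𝓘(ℝ, E)) (x := p)) (Y p)
  rw [h1]
  exact h2

variable [RiemannianBundle (fun p : M ↦ TangentSpace 𝓘(ℝ, E) p)]

theorem contDiffOn_metricCoeff
    [IsContMDiffRiemannianBundle 𝓘(ℝ, E) ∞ E (fun p : M ↦ TangentSpace 𝓘(ℝ, E) p)]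
    (p : M) (v w : E) :
    ContDiffOn ℝ ∞ (metricCoeff p v w) (extChartAt 𝓘(ℝ, E) p).target := by
  have h1 : ContMDiffOn 𝓘(ℝ, E) 𝓘(ℝ, ℝ) ∞
      (fun y ↦ inner ℝ (constField p v ((extChartAt 𝓘(ℝ, E) p).symm y))
        (constField p w ((extChartAt 𝓘(ℝ, E) p).symm y)))
      (extChartAt 𝓘(ℝ, E) p).target := by
    intro y hy
    have hq := chart_symm_mem_source hy
    have h2 := ContMDiffAt.inner_bundle (E := fun p : M ↦ TangentSpace 𝓘(ℝ, E) p)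
      (contMDiffAt_constField hq v) (contMDiffAt_constField hq w)
    exact h2.comp_contMDiffWithinAt y (contMDiffOn_extChartAt_symm p y hy)
  exact (contMDiffOn_iff_contDiffOn.mp h1).congr fun y hy ↦ by
    rw [metricCoeff, coordVec_eq_constField hy, coordVec_eq_constField hy]

variable [FiniteDimensional ℝ E]

/-- The metric in the preferred chart at `p`. -/
def chartMetric (p : M) (y : E) : E →L[ℝ] E →L[ℝ] ℝ :=
  LinearMap.toContinuousLinearMap
    (LinearMap.toContinuousLinearMap.toLinearMap ∘ₗ LinearMap.mk₂ ℝ (fun v w ↦ metricCoeff p v w y)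
      (fun _ _ _ ↦ by simp only [metricCoeff, coordVec_add, inner_add_left])
      (fun _ _ _ ↦ by simp only [metricCoeff, coordVec_smul, real_inner_smul_left, smul_eq_mul])
      (fun _ _ _ ↦ by simp only [metricCoeff, coordVec_add, inner_add_right])
      (fun _ _ _ ↦ by simp only [metricCoeff, coordVec_smul, real_inner_smul_right, smul_eq_mul]))

theorem chartMetric_apply (p : M) (y v w : E) :
    chartMetric p y v w = inner ℝ (coordVec p y v) (coordVec p y w) := rfl

theorem contDiffOn_chartMetric
    [IsContMDiffRiemannianBundle 𝓘(ℝ, E) ∞ E (fun p : M ↦ TangentSpace 𝓘(ℝ, E) p)] (p : M) :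
    ContDiffOn ℝ ∞ (chartMetric p) (extChartAt 𝓘(ℝ, E) p).target :=
  contDiffOn_clm_apply.mpr fun v ↦ contDiffOn_clm_apply.mpr fun w ↦ contDiffOn_metricCoeff p v w

theorem chartMetric_self (p : M) (v w : E) :
    chartMetric p (extChartAt 𝓘(ℝ, E) p p) v w =
      inner ℝ ((tangentCoord 𝓘(ℝ, E) p).symm v) ((tangentCoord 𝓘(ℝ, E) p).symm w) := by
  rw [chartMetric_apply, coordVec_eq_constField (mem_extChartAt_target p),
    coordVec_eq_constField (mem_extChartAt_target p), ← constField_self, ← constField_self]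
  exact congrArg (fun q ↦ inner ℝ (constField p v q) (constField p w q)) (extChartAt_to_inv p)

theorem metricDeriv_eq
    [IsContMDiffRiemannianBundle 𝓘(ℝ, E) ∞ E (fun p : M ↦ TangentSpace 𝓘(ℝ, E) p)]
    (p : M) (s v w : E) :
    metricDeriv p s v w = fderiv ℝ (chartMetric p) (extChartAt 𝓘(ℝ, E) p p) s v w := by
  have hd : DifferentiableAt ℝ (chartMetric p) (extChartAt 𝓘(ℝ, E) p p) :=
    ((contDiffOn_chartMetric p).contDiffAt (extChartAt_target_mem_nhds p)).differentiableAt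
      (by simp)
  have h := ((hd.hasFDerivAt.clm_apply (hasFDerivAt_const v _)).clm_apply
    (hasFDerivAt_const w _)).fderiv
  rw [metricDeriv]
  refine (DFunLike.congr_fun h s).trans ?_
  simp

/-- Koszul's expression is linear in the last vector, so the Riesz theorem supplies the vector that
the choice operator in `christoffel` asks for. -/
theorem inner_christoffel
    [IsContMDiffRiemannianBundle 𝓘(ℝ, E) ∞ E (fun p : M ↦ TangentSpace 𝓘(ℝ, E) p)]
    (p : M) (v w z : TangentSpace 𝓘(ℝ, E) p) :
    inner ℝ (christoffel p v w) z = koszul p (tangentCoord 𝓘(ℝ, E) p v) (tangentCoord 𝓘(ℝ, E) p w)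
      (tangentCoord 𝓘(ℝ, E) p z) := by
  have hex : ∃ u : TangentSpace 𝓘(ℝ, E) p, ∀ z : TangentSpace 𝓘(ℝ, E) p,
      inner ℝ u z = koszul p (tangentCoord 𝓘(ℝ, E) p v) (tangentCoord 𝓘(ℝ, E) p w)
        (tangentCoord 𝓘(ℝ, E) p z) := by
    let L : TangentSpace 𝓘(ℝ, E) p →ₗ[ℝ] ℝ :=
      { toFun := fun z ↦ koszul p (tangentCoord 𝓘(ℝ, E) p v) (tangentCoord 𝓘(ℝ, E) p w)
          (tangentCoord 𝓘(ℝ, E) p z)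
        map_add' := fun z z' ↦ by
          simp only [koszul, metricDeriv_eq, map_add, add_apply]; ring
        map_smul' := fun c z ↦ by
          simp only [koszul, metricDeriv_eq, map_smul, smul_apply, smul_eq_mul,
            RingHom.id_apply]
          ring }
    have : CompleteSpace (TangentSpace 𝓘(ℝ, E) p) := FiniteDimensional.complete ℝ _
    refine ⟨(InnerProductSpace.toDual ℝ _).symm (LinearMap.toContinuousLinearMap L), fun z ↦ ?_⟩
    rw [InnerProductSpace.toDual_symm_apply]
    rfl
  exact Classical.epsilon_spec hex z

end ChartFields

/-! ### The almost contact structure in the preferred chart. -/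

section NearlyCosymplectic

open Filter Topology Set

variable {E : Type*} [NormedAddCommGroup E] [NormedSpace ℝ E]
  {M : Type*} [TopologicalSpace M] [ChartedSpace E M] [IsManifold 𝓘(ℝ, E) ∞ M]
  [RiemannianBundle (fun p : M ↦ TangentSpace 𝓘(ℝ, E) p)]
  (S : AlmostContactMetricStructure E M)

theorem AlmostContactMetricStructure.skew (q : M)
    (v w : TangentSpace 𝓘(ℝ, E) q) : inner ℝ (S.φ q v) w = -inner ℝ v (S.φ q w) := by
  have h1 := S.inner_φ_φ q v (S.φ q w)
  rw [S.η_φ, S.φ_φ, inner_add_right, inner_neg_right, real_inner_smul_right,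
    ← S.η_eq_inner, S.η_φ] at h1
  linarith

theorem contMDiffAt_map_constField {p q : M} (hq : q ∈ (chartAt E p).source) (w : E) :
    ContMDiffAt 𝓘(ℝ, E) (𝓘(ℝ, E).prod 𝓘(ℝ, E)) ∞
      (fun q ↦ TotalSpace.mk' E (E := fun q : M ↦ TangentSpace 𝓘(ℝ, E) q) q
        (S.φ q (constField p w q))) q :=
  ContMDiffAt.clm_bundle_apply (b := fun q : M ↦ q) (S.smooth_φ q) (contMDiffAt_constField hq w)

variable [FiniteDimensional ℝ E]

/-- The tensor `φ` in the preferred chart at `p`. -/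
def chartMap (p : M) (y : E) : E →L[ℝ] E :=
  LinearMap.toContinuousLinearMap
    { toFun := fun w ↦ tangentCoord 𝓘(ℝ, E) _ (mfderiv 𝓘(ℝ, E) 𝓘(ℝ, E) (extChartAt 𝓘(ℝ, E) p)
        ((extChartAt 𝓘(ℝ, E) p).symm y) (S.φ _ (coordVec p y w)))
      map_add' := fun v w ↦ by simp only [coordVec_add, map_add]
      map_smul' := fun c v ↦ by simp only [coordVec_smul, map_smul, RingHom.id_apply] }

theorem coordVec_chartMap {p : M} {y : E} (hy : y ∈ (extChartAt 𝓘(ℝ, E) p).target) (w : E) :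
    coordVec p y (chartMap S p y w) = S.φ _ (coordVec p y w) :=
  coordVec_symm hy _

theorem chartMap_eq_coordRep {p : M} {y : E} (hy : y ∈ (extChartAt 𝓘(ℝ, E) p).target) (w : E) :
    chartMap S p y w = coordRep p (fun q ↦ S.φ q (constField p w q)) y := by
  have : coordRep p (fun q ↦ S.φ q (constField p w q)) y =
      tangentCoord 𝓘(ℝ, E) _ (mfderiv 𝓘(ℝ, E) 𝓘(ℝ, E) (extChartAt 𝓘(ℝ, E) p)
        ((extChartAt 𝓘(ℝ, E) p).symm y)
        (S.φ _ (constField p w ((extChartAt 𝓘(ℝ, E) p).symm y)))) := rfl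
  rw [this, ← coordVec_eq_constField hy]
  rfl

theorem contDiffOn_chartMap (p : M) :
    ContDiffOn ℝ ∞ (chartMap S p) (extChartAt 𝓘(ℝ, E) p).target :=
  contDiffOn_clm_apply.mpr fun w ↦
    (contDiffOn_coordRep fun _ hq ↦ contMDiffAt_map_constField S hq w).congr
      fun _ hy ↦ chartMap_eq_coordRep S hy w

theorem chartMap_self (p : M) (w : E) :
    chartMap S p (extChartAt 𝓘(ℝ, E) p p) w =
      tangentCoord 𝓘(ℝ, E) p (S.φ p ((tangentCoord 𝓘(ℝ, E) p).symm w)) := by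
  rw [chartMap_eq_coordRep S (mem_extChartAt_target p), coordRep_self, constField_self]

/-- The Christoffel symbols at `p`, on the model space. -/
def chartChristoffel (p : M) (v w : E) : E :=
  tangentCoord 𝓘(ℝ, E) p (christoffel p ((tangentCoord 𝓘(ℝ, E) p).symm v)
    ((tangentCoord 𝓘(ℝ, E) p).symm w))

/-- Fields with constant coordinates have no derivative term of their own, so `∇φ` becomes a
derivative of `chartMap` plus Christoffel terms. Testing the nearly cosymplectic condition on such
fields is enough. -/
theorem covDerivPhi_constField (p : M) (v w : E) :
    S.covDerivPhi (constField p v) (constField p w) p = (tangentCoord 𝓘(ℝ, E) p).symm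
      (covDerivEnd (extChartAt 𝓘(ℝ, E) p p) (chartMap S p) (chartChristoffel p) v w) := by
  have hmem := extChartAt_target_mem_nhds (I := 𝓘(ℝ, E)) p
  have hd : DifferentiableAt ℝ (chartMap S p) (extChartAt 𝓘(ℝ, E) p p) :=
    ((contDiffOn_chartMap S p).contDiffAt hmem).differentiableAt (by simp)
  have h1 : fderiv ℝ (coordRep p (constField p w)) (extChartAt 𝓘(ℝ, E) p p) = 0 := by
    have : coordRep p (constField p w) =ᶠ[𝓝 (extChartAt 𝓘(ℝ, E) p p)] fun _ ↦ w := by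
      filter_upwards [hmem] with y hy using coordRep_constField hy w
    rw [this.fderiv_eq]
    simp
  have h2 : fderiv ℝ (coordRep p (fun q ↦ S.φ q (constField p w q))) (extChartAt 𝓘(ℝ, E) p p) v =
      fderiv ℝ (chartMap S p) (extChartAt 𝓘(ℝ, E) p p) v w := by
    have : coordRep p (fun q ↦ S.φ q (constField p w q)) =ᶠ[𝓝 (extChartAt 𝓘(ℝ, E) p p)]
        fun y ↦ chartMap S p y w := by
      filter_upwards [hmem] with y hy using (chartMap_eq_coordRep S hy w).symm
    rw [this.fderiv_eq, (hd.hasFDerivAt.clm_apply (hasFDerivAt_const w _)).fderiv]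
    simp
  simp only [AlmostContactMetricStructure.covDerivPhi, covDeriv, h1, h2, constField_self,
    covDerivEnd, chartChristoffel, chartMap_self, map_add, map_sub,
    ContinuousLinearEquiv.symm_apply_apply, ContinuousLinearEquiv.apply_symm_apply, zero_apply,
    map_zero, zero_add]

theorem nearlyCosymplecticChart
    [IsContMDiffRiemannianBundle 𝓘(ℝ, E) ∞ E (fun p : M ↦ TangentSpace 𝓘(ℝ, E) p)]
    (hS : S.IsNearlyCosymplectic) (p : M) :
    NearlyCosymplecticChart (extChartAt 𝓘(ℝ, E) p p) (chartMetric p) (chartMap S p)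
      (coordRep p S.ξ) (chartChristoffel p) := by
  have hmem := extChartAt_target_mem_nhds (I := 𝓘(ℝ, E)) p
  refine
    { differentiableAt_metric :=
        ((contDiffOn_chartMetric p).contDiffAt hmem).differentiableAt (by simp)
      differentiableAt_map := ((contDiffOn_chartMap S p).contDiffAt hmem).differentiableAt (by simp)
      differentiableAt_reeb := ((contDiffOn_coordRep fun q _ ↦ S.smooth_ξ q).contDiffAt
        hmem).differentiableAt (by simp)
      symm := Eventually.of_forall fun y v w ↦ by
        rw [chartMetric_apply, chartMetric_apply, real_inner_comm]
      nondegenerate := fun v hv ↦ ?_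
      skew := ?_
      metric_map := ?_
      map_reeb := ?_
      koszul := fun v w z ↦ ?_
      nearly := fun v w ↦ ?_ }
  · have := hv v
    rw [chartMetric_self, inner_self_eq_zero] at this
    simpa using this
  · filter_upwards [hmem] with y hy v w
    rw [chartMetric_apply, chartMetric_apply, coordVec_chartMap S hy, coordVec_chartMap S hy,
      S.skew]
  · filter_upwards [hmem] with y hy v w
    rw [chartMetric_apply, chartMetric_apply, chartMetric_apply, chartMetric_apply,
      coordVec_chartMap S hy, coordVec_chartMap S hy, coordVec_coordRep hy, S.inner_φ_φ,
      S.η_eq_inner, S.η_eq_inner]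
  · filter_upwards [hmem] with y hy
    have : coordVec p y (coordRep p S.ξ y) = S.ξ _ := coordVec_coordRep hy _
    change tangentCoord 𝓘(ℝ, E) _ (mfderiv 𝓘(ℝ, E) 𝓘(ℝ, E) (extChartAt 𝓘(ℝ, E) p)
        ((extChartAt 𝓘(ℝ, E) p).symm y) (S.φ _ (coordVec p y (coordRep p S.ξ y)))) = 0
    rw [this, S.φ_ξ, map_zero, map_zero]
  · rw [chartMetric_self, chartChristoffel, ContinuousLinearEquiv.symm_apply_apply,
      inner_christoffel, koszul]
    simp only [ContinuousLinearEquiv.apply_symm_apply, metricDeriv_eq]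
  · have h := hS p (constField p v) (constField p w)
      (contMDiffAt_constField (mem_chart_source E p) v)
      (contMDiffAt_constField (mem_chart_source E p) w)
    rw [covDerivPhi_constField, covDerivPhi_constField, ← map_add] at h
    exact (ContinuousLinearEquiv.map_eq_zero_iff _).mp h

end NearlyCosymplectic

/-! ### Passing between coordinate vectors and tangent vectors at nearby points. -/

section Transfer

open Filter Topology Set

variable {E : Type*} [NormedAddCommGroup E] [NormedSpace ℝ E]
  {M : Type*} [TopologicalSpace M] [ChartedSpace E M] [IsManifold 𝓘(ℝ, E) ∞ M]

theorem constField_mfderiv {p q : M} (hq : q ∈ (extChartAt 𝓘(ℝ, E) p).source)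
    (X : TangentSpace 𝓘(ℝ, E) q) :
    constField p (tangentCoord 𝓘(ℝ, E) _
      (mfderiv 𝓘(ℝ, E) 𝓘(ℝ, E) (extChartAt 𝓘(ℝ, E) p) q X)) q = X := by
  have hq' : q ∈ (chartAt E p).source := by rwa [extChartAt_source] at hq
  have h1 := TangentBundle.symmL_trivializationAt (I := 𝓘(ℝ, E)) (𝕜 := ℝ) hq'
  have h2 := mfderivWithin_extChartAt_symm_comp_mfderiv_extChartAt' (I := 𝓘(ℝ, E)) hq
  exact (DFunLike.congr_fun h1 _).trans (DFunLike.congr_fun h2 X)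

theorem constField_coordRep {p q : M} (hq : q ∈ (extChartAt 𝓘(ℝ, E) p).source)
    (Y : ∀ p : M, TangentSpace 𝓘(ℝ, E) p) :
    constField p (coordRep p Y (extChartAt 𝓘(ℝ, E) p q)) q = Y q := by
  let k : M → E := fun q ↦ tangentCoord 𝓘(ℝ, E) _
    (mfderiv 𝓘(ℝ, E) 𝓘(ℝ, E) (extChartAt 𝓘(ℝ, E) p) q (Y q))
  have h1 : coordRep p Y (extChartAt 𝓘(ℝ, E) p q) = k q :=
    congrArg k ((extChartAt 𝓘(ℝ, E) p).left_inv hq)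
  rw [h1]
  exact constField_mfderiv hq _

theorem fderiv_chart_comp {E₁ : Type*} [NormedAddCommGroup E₁] [NormedSpace ℝ E₁]
    {N : Type*} [TopologicalSpace N] [ChartedSpace E₁ N] [IsManifold 𝓘(ℝ, E₁) ∞ N]
    {j : N → M} {a : N} {y : E₁} {p : M} (hy : y ∈ (extChartAt 𝓘(ℝ, E₁) a).target)
    (hj : MDifferentiableAt 𝓘(ℝ, E₁) 𝓘(ℝ, E) j ((extChartAt 𝓘(ℝ, E₁) a).symm y))
    (hq : j ((extChartAt 𝓘(ℝ, E₁) a).symm y) ∈ (extChartAt 𝓘(ℝ, E) p).source) (v : E₁) :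
    fderiv ℝ (fun s ↦ extChartAt 𝓘(ℝ, E) p (j ((extChartAt 𝓘(ℝ, E₁) a).symm s))) y v =
      tangentCoord 𝓘(ℝ, E) _ (mfderiv 𝓘(ℝ, E) 𝓘(ℝ, E) (extChartAt 𝓘(ℝ, E) p)
        (j ((extChartAt 𝓘(ℝ, E₁) a).symm y))
        (mfderiv 𝓘(ℝ, E₁) 𝓘(ℝ, E) j ((extChartAt 𝓘(ℝ, E₁) a).symm y) (coordVec a y v))) := by
  have h1 : MDifferentiableAt 𝓘(ℝ, E₁) 𝓘(ℝ, E₁) (extChartAt 𝓘(ℝ, E₁) a).symm y := by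
    have := mdifferentiableWithinAt_extChartAt_symm (I := 𝓘(ℝ, E₁)) hy
    simpa only [modelWithCornersSelf_coe, range_id, mdifferentiableWithinAt_univ] using this
  have h2 : MDifferentiableAt 𝓘(ℝ, E) 𝓘(ℝ, E) (extChartAt 𝓘(ℝ, E) p)
      (j ((extChartAt 𝓘(ℝ, E₁) a).symm y)) :=
    mdifferentiableAt_extChartAt (by rwa [extChartAt_source] at hq)
  have h3 := mfderiv_comp y (h2.comp _ hj) h1
  rw [mfderiv_comp _ h2 hj, mfderiv_eq_fderiv] at h3
  exact DFunLike.congr_fun h3 v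

variable [RiemannianBundle (fun p : M ↦ TangentSpace 𝓘(ℝ, E) p)] [FiniteDimensional ℝ E]

theorem chartMetric_extChartAt {p q : M} (hq : q ∈ (extChartAt 𝓘(ℝ, E) p).source) (v w : E) :
    chartMetric p (extChartAt 𝓘(ℝ, E) p q) v w =
      inner ℝ (constField p v q) (constField p w q) := by
  have hy := (extChartAt 𝓘(ℝ, E) p).map_source hq
  rw [chartMetric_apply, coordVec_eq_constField hy, coordVec_eq_constField hy]
  exact congrArg (fun q ↦ inner ℝ (constField p v q) (constField p w q))
    ((extChartAt 𝓘(ℝ, E) p).left_inv hq)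

theorem constField_chartMap (S : AlmostContactMetricStructure E M) {p q : M}
    (hq : q ∈ (extChartAt 𝓘(ℝ, E) p).source) (w : E) :
    constField p (chartMap S p (extChartAt 𝓘(ℝ, E) p q) w) q = S.φ q (constField p w q) := by
  rw [chartMap_eq_coordRep S ((extChartAt 𝓘(ℝ, E) p).map_source hq),
    constField_coordRep hq]

end Transfer

/-! ### Geometry of the two families of leaves. -/

section Leaves

open Filter Topology Set

variable {E : Type*} [NormedAddCommGroup E] [NormedSpace ℝ E] [FiniteDimensional ℝ E]
  {M : Type*} [TopologicalSpace M] [ChartedSpace E M] [IsManifold 𝓘(ℝ, E) ∞ M]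
  [RiemannianBundle (fun p : M ↦ TangentSpace 𝓘(ℝ, E) p)]
  {E₁ : Type*} [NormedAddCommGroup E₁] [NormedSpace ℝ E₁]
  {N₁ : Type*} [TopologicalSpace N₁] [ChartedSpace E₁ N₁]
  [RiemannianBundle (fun p : N₁ ↦ TangentSpace 𝓘(ℝ, E₁) p)]
  {E₂ : Type*} [NormedAddCommGroup E₂] [NormedSpace ℝ E₂]
  {N₂ : Type*} [TopologicalSpace N₂] [ChartedSpace E₂ N₂]
  [RiemannianBundle (fun p : N₂ ↦ TangentSpace 𝓘(ℝ, E₂) p)]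
  {S : AlmostContactMetricStructure E M} {f : N₁ → ℝ} {ι : N₁ × N₂ → M} {θ : ℝ}

variable (E) in
/-- The differential of `a ↦ ι (a, b)`. -/
def leafDeriv₁ (ι : N₁ × N₂ → M) (a : N₁) (b : N₂) :
    TangentSpace 𝓘(ℝ, E₁) a →L[ℝ] TangentSpace 𝓘(ℝ, E) (ι (a, b)) :=
  mfderiv 𝓘(ℝ, E₁) 𝓘(ℝ, E) (fun a' ↦ ι (a', b)) a

variable (E) in
/-- The differential of `b ↦ ι (a, b)`. -/
def leafDeriv₂ (ι : N₁ × N₂ → M) (a : N₁) (b : N₂) :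
    TangentSpace 𝓘(ℝ, E₂) b →L[ℝ] TangentSpace 𝓘(ℝ, E) (ι (a, b)) :=
  mfderiv 𝓘(ℝ, E₂) 𝓘(ℝ, E) (fun b' ↦ ι (a, b')) b

variable (E E₁ E₂) in
/-- The differential of `ι` on the model space. -/
def prodDeriv (ι : N₁ × N₂ → M) (x : N₁ × N₂) :
    E₁ × E₂ →ₗ[ℝ] TangentSpace 𝓘(ℝ, E) (ι x) :=
  (mfderiv (𝓘(ℝ, E₁).prod 𝓘(ℝ, E₂)) 𝓘(ℝ, E) ι x).toLinearMap ∘ₗ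
    (tangentCoord (𝓘(ℝ, E₁).prod 𝓘(ℝ, E₂)) x).symm.toLinearEquiv.toLinearMap

theorem mdifferentiableAt_immersion (hM : IsWarpedProductSemiSlant E E₁ E₂ S f ι θ) (x : N₁ × N₂) :
    MDifferentiableAt (𝓘(ℝ, E₁).prod 𝓘(ℝ, E₂)) 𝓘(ℝ, E) ι x :=
  (hM.smooth_ι x).mdifferentiableAt (by simp)

theorem leafDeriv₁_eq (hM : IsWarpedProductSemiSlant E E₁ E₂ S f ι θ)
    (a : N₁) (b : N₂) (v : TangentSpace 𝓘(ℝ, E₁) a) :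
    leafDeriv₁ E ι a b v = prodDeriv E E₁ E₂ ι (a, b) (tangentCoord 𝓘(ℝ, E₁) a v, 0) := by
  have h1 : MDifferentiableAt 𝓘(ℝ, E₁) (𝓘(ℝ, E₁).prod 𝓘(ℝ, E₂)) (fun a' : N₁ ↦ (a', b)) a :=
    mdifferentiableAt_id.prodMk mdifferentiableAt_const
  have h2 := mfderiv_comp a (mdifferentiableAt_immersion hM (a, b)) h1
  rw [mfderiv_prod_left] at h2
  exact DFunLike.congr_fun h2 v

theorem leafDeriv₂_eq (hM : IsWarpedProductSemiSlant E E₁ E₂ S f ι θ)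
    (a : N₁) (b : N₂) (v : TangentSpace 𝓘(ℝ, E₂) b) :
    leafDeriv₂ E ι a b v = prodDeriv E E₁ E₂ ι (a, b) (0, tangentCoord 𝓘(ℝ, E₂) b v) := by
  have h1 : MDifferentiableAt 𝓘(ℝ, E₂) (𝓘(ℝ, E₁).prod 𝓘(ℝ, E₂)) (fun b' : N₂ ↦ (a, b')) b :=
    mdifferentiableAt_const.prodMk mdifferentiableAt_id
  have h2 := mfderiv_comp b (mdifferentiableAt_immersion hM (a, b)) h1
  rw [mfderiv_prod_right] at h2
  exact DFunLike.congr_fun h2 v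

theorem inner_prodDeriv (hM : IsWarpedProductSemiSlant E E₁ E₂ S f ι θ)
    (a : N₁) (b : N₂) (v w : E₁ × E₂) :
    inner ℝ (prodDeriv E E₁ E₂ ι (a, b) v) (prodDeriv E E₁ E₂ ι (a, b) w) =
      inner ℝ ((tangentCoord 𝓘(ℝ, E₁) a).symm v.1) ((tangentCoord 𝓘(ℝ, E₁) a).symm w.1) +
      f a ^ 2 * inner ℝ ((tangentCoord 𝓘(ℝ, E₂) b).symm v.2)
        ((tangentCoord 𝓘(ℝ, E₂) b).symm w.2) := by
  have h := hM.isometric a b ((tangentCoord 𝓘(ℝ, E₁) a).symm v.1)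
    ((tangentCoord 𝓘(ℝ, E₁) a).symm w.1) ((tangentCoord 𝓘(ℝ, E₂) b).symm v.2)
    ((tangentCoord 𝓘(ℝ, E₂) b).symm w.2)
  simp only [ContinuousLinearEquiv.apply_symm_apply] at h
  exact h

theorem prodDeriv_injective (hM : IsWarpedProductSemiSlant E E₁ E₂ S f ι θ) (a : N₁) (b : N₂) :
    Function.Injective (prodDeriv E E₁ E₂ ι (a, b)) := by
  rw [injective_iff_map_eq_zero]
  intro v hv
  have h := inner_prodDeriv hM a b v v
  rw [hv, inner_zero_left, real_inner_self_eq_norm_sq, real_inner_self_eq_norm_sq] at h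
  have hf : 0 < f a ^ 2 := pow_pos (hM.f_pos a) 2
  have h1 := sq_nonneg ‖(tangentCoord 𝓘(ℝ, E₁) a).symm v.1‖
  have h2 := sq_nonneg ‖(tangentCoord 𝓘(ℝ, E₂) b).symm v.2‖
  have h3 : ‖(tangentCoord 𝓘(ℝ, E₂) b).symm v.2‖ ^ 2 = 0 := by
    by_contra hne
    have := mul_pos hf (lt_of_le_of_ne h2 (Ne.symm hne))
    linarith
  have h4 : ‖(tangentCoord 𝓘(ℝ, E₁) a).symm v.1‖ ^ 2 = 0 := by rw [h3] at h; linarith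
  rw [sq_eq_zero_iff, norm_eq_zero] at h3 h4
  exact Prod.ext ((ContinuousLinearEquiv.map_eq_zero_iff _).mp h4)
    ((ContinuousLinearEquiv.map_eq_zero_iff _).mp h3)

theorem inner_leafDeriv₁ (hM : IsWarpedProductSemiSlant E E₁ E₂ S f ι θ)
    (a : N₁) (b : N₂) (v w : TangentSpace 𝓘(ℝ, E₁) a) :
    inner ℝ (leafDeriv₁ E ι a b v) (leafDeriv₁ E ι a b w) = inner ℝ v w := by
  rw [leafDeriv₁_eq hM, leafDeriv₁_eq hM, inner_prodDeriv hM]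
  simp

theorem inner_leafDeriv₁_leafDeriv₂ (hM : IsWarpedProductSemiSlant E E₁ E₂ S f ι θ)
    (a : N₁) (b : N₂) (v : TangentSpace 𝓘(ℝ, E₁) a)
    (w : TangentSpace 𝓘(ℝ, E₂) b) :
    inner ℝ (leafDeriv₁ E ι a b v) (leafDeriv₂ E ι a b w) = 0 := by
  rw [leafDeriv₁_eq hM, leafDeriv₂_eq hM, inner_prodDeriv hM]
  simp

theorem inner_leafDeriv₂ (hM : IsWarpedProductSemiSlant E E₁ E₂ S f ι θ)
    (a : N₁) (b : N₂) (v w : TangentSpace 𝓘(ℝ, E₂) b) :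
    inner ℝ (leafDeriv₂ E ι a b v) (leafDeriv₂ E ι a b w) = f a ^ 2 * inner ℝ v w := by
  rw [leafDeriv₂_eq hM, leafDeriv₂_eq hM, inner_prodDeriv hM]
  simp

theorem exists_map_leafDeriv₁ (hM : IsWarpedProductSemiSlant E E₁ E₂ S f ι θ)
    (a : N₁) (b : N₂) (v : TangentSpace 𝓘(ℝ, E₁) a) :
    ∃ w : TangentSpace 𝓘(ℝ, E₁) a,
      S.φ (ι (a, b)) (leafDeriv₁ E ι a b v) = leafDeriv₁ E ι a b w := by
  have h := hM.invariant b a (leafDeriv₁ E ι a b v) ⟨v, rfl⟩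
  rw [normalPart, sub_eq_zero] at h
  obtain ⟨w, hw⟩ := Submodule.starProjection_apply_mem
    (tangentImage E 𝓘(ℝ, E₁) (fun a' ↦ ι (a', b)) a) (S.φ (ι (a, b)) (leafDeriv₁ E ι a b v))
  exact ⟨w, h.trans hw.symm⟩

theorem exists_reeb_eq (hM : IsWarpedProductSemiSlant E E₁ E₂ S f ι θ) (a : N₁) (b : N₂) :
    ∃ v : TangentSpace 𝓘(ℝ, E₁) a, S.ξ (ι (a, b)) = leafDeriv₁ E ι a b v := by
  obtain ⟨v, hv⟩ := hM.ξ_tangent a b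
  exact ⟨v, hv.symm⟩

theorem inner_leafDeriv₂_reeb (hM : IsWarpedProductSemiSlant E E₁ E₂ S f ι θ)
    (a : N₁) (b : N₂) (z : TangentSpace 𝓘(ℝ, E₂) b) :
    inner ℝ (leafDeriv₂ E ι a b z) (S.ξ (ι (a, b))) = 0 := by
  obtain ⟨v, hv⟩ := exists_reeb_eq hM a b
  rw [hv, real_inner_comm, inner_leafDeriv₁_leafDeriv₂ hM]

theorem norm_map_leafDeriv₂ (hM : IsWarpedProductSemiSlant E E₁ E₂ S f ι θ)
    (a : N₁) (b : N₂) (z : TangentSpace 𝓘(ℝ, E₂) b) :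
    ‖S.φ (ι (a, b)) (leafDeriv₂ E ι a b z)‖ = ‖leafDeriv₂ E ι a b z‖ := by
  have h := S.inner_φ_φ (ι (a, b)) (leafDeriv₂ E ι a b z) (leafDeriv₂ E ι a b z)
  rw [S.η_eq_inner, inner_leafDeriv₂_reeb hM, real_inner_self_eq_norm_sq,
    real_inner_self_eq_norm_sq, mul_zero, sub_zero] at h
  exact (pow_left_inj₀ (norm_nonneg _) (norm_nonneg _) two_ne_zero).mp h

theorem exists_slant (hM : IsWarpedProductSemiSlant E E₁ E₂ S f ι θ)
    (a : N₁) (b : N₂) (z : TangentSpace 𝓘(ℝ, E₂) b) :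
    ∃ t : TangentSpace 𝓘(ℝ, E₂) b,
      tangentPart E 𝓘(ℝ, E₂) (fun b' ↦ ι (a, b')) b (S.φ (ι (a, b)) (leafDeriv₂ E ι a b z)) =
        leafDeriv₂ E ι a b t ∧
      (∀ w : TangentSpace 𝓘(ℝ, E₂) b,
        inner ℝ (S.φ (ι (a, b)) (leafDeriv₂ E ι a b z)) (leafDeriv₂ E ι a b w) =
        inner ℝ (leafDeriv₂ E ι a b t) (leafDeriv₂ E ι a b w)) ∧
      inner ℝ (leafDeriv₂ E ι a b t) (leafDeriv₂ E ι a b t) =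
        Real.cos θ ^ 2 * inner ℝ (leafDeriv₂ E ι a b z) (leafDeriv₂ E ι a b z) := by
  obtain ⟨t, ht⟩ := Submodule.starProjection_apply_mem
    (tangentImage E 𝓘(ℝ, E₂) (fun b' ↦ ι (a, b')) b) (S.φ (ι (a, b)) (leafDeriv₂ E ι a b z))
  have ht' : tangentPart E 𝓘(ℝ, E₂) (fun b' ↦ ι (a, b')) b
      (S.φ (ι (a, b)) (leafDeriv₂ E ι a b z)) = leafDeriv₂ E ι a b t := ht.symm
  have horth : ∀ w : TangentSpace 𝓘(ℝ, E₂) b,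
      inner ℝ (S.φ (ι (a, b)) (leafDeriv₂ E ι a b z)) (leafDeriv₂ E ι a b w) =
      inner ℝ (leafDeriv₂ E ι a b t) (leafDeriv₂ E ι a b w) := by
    intro w
    have h := Submodule.starProjection_inner_eq_zero
      (K := tangentImage E 𝓘(ℝ, E₂) (fun b' ↦ ι (a, b')) b)
      (S.φ (ι (a, b)) (leafDeriv₂ E ι a b z)) (leafDeriv₂ E ι a b w) ⟨w, rfl⟩
    rw [← ht, inner_sub_left, sub_eq_zero] at h
    exact h
  refine ⟨t, ht', horth, ?_⟩
  rw [real_inner_self_eq_norm_sq, real_inner_self_eq_norm_sq]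
  by_cases hz : leafDeriv₂ E ι a b z = 0
  · rw [hz, map_zero] at ht'
    have : leafDeriv₂ E ι a b t = 0 := by
      rw [← ht', tangentPart, map_zero]
    rw [hz, this]; simp
  -- A vertical vector is orthogonal to `ξ`, so it is proportional to `ξ` only if it is zero; the
  -- slant condition thus applies to every nonzero one.
  have hspan : leafDeriv₂ E ι a b z ∉ Submodule.span ℝ {S.ξ (ι (a, b))} := by
    intro hmem
    obtain ⟨c, hc⟩ := Submodule.mem_span_singleton.mp hmem
    apply hz
    rw [← inner_self_eq_zero (𝕜 := ℝ)]
    nth_rewrite 2 [← hc]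
    rw [real_inner_smul_right, inner_leafDeriv₂_reeb hM, mul_zero]
  have hang := (hM.properSlant a).1 b (leafDeriv₂ E ι a b z) ⟨z, rfl⟩ hspan
  have hcos := InnerProductGeometry.cos_angle (S.φ (ι (a, b)) (leafDeriv₂ E ι a b z))
    (leafDeriv₂ E ι a b t)
  have hang' : InnerProductGeometry.angle (S.φ (ι (a, b)) (leafDeriv₂ E ι a b z))
    (leafDeriv₂ E ι a b t) = θ := by rw [← ht']; exact hang
  rw [hang', horth, real_inner_self_eq_norm_sq, norm_map_leafDeriv₂ hM] at hcos
  have hz' : ‖leafDeriv₂ E ι a b z‖ ≠ 0 := norm_ne_zero_iff.mpr hz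
  -- If the tangential part is zero, its angle with any vector is a right angle by convention; this
  -- agrees with the quotient in `hcos`, where division by zero gives 0.
  by_cases ht0 : ‖leafDeriv₂ E ι a b t‖ = 0
  · rw [hcos, ht0]; simp
  · rw [hcos]; field_simp

/-- If sin θ = 0, then the tangential part of `φ z` has the full length of `φ z`, so the normal part
vanishes and the leaf is invariant, contrary to properness. -/
theorem sin_ne_zero_of_semiSlant (hM : IsWarpedProductSemiSlant E E₁ E₂ S f ι θ)
    (a : N₁) : Real.sin θ ≠ 0 := by
  intro hs
  refine (hM.properSlant a).2.1 ?_
  rintro b _ ⟨z, rfl⟩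
  obtain ⟨t, ht, horth, hn⟩ := exists_slant hM a b z
  change normalPart E 𝓘(ℝ, E₂) (fun b' ↦ ι (a, b')) b (S.φ (ι (a, b)) (leafDeriv₂ E ι a b z)) = 0
  have hc : Real.cos θ ^ 2 = 1 := by rw [Real.cos_sq', hs]; simp
  have h1 := horth t
  have h2 := norm_map_leafDeriv₂ hM a b z
  rw [normalPart, ht]
  rw [hc, one_mul, real_inner_self_eq_norm_sq, real_inner_self_eq_norm_sq] at hn
  have h3 := norm_sub_sq_real (S.φ (ι (a, b)) (leafDeriv₂ E ι a b z)) (leafDeriv₂ E ι a b t)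
  rw [h1, real_inner_self_eq_norm_sq, h2] at h3
  rw [← norm_eq_zero, ← sq_eq_zero_iff]
  linarith

end Leaves

/-! ### The immersion and the warping function in charts. -/

section Immersion

open Filter Topology Set

variable {E : Type*} [NormedAddCommGroup E] [NormedSpace ℝ E]
  {M : Type*} [TopologicalSpace M] [ChartedSpace E M]
  {E₁ : Type*} [NormedAddCommGroup E₁] [NormedSpace ℝ E₁]
  {N₁ : Type*} [TopologicalSpace N₁] [ChartedSpace E₁ N₁]
  {E₂ : Type*} [NormedAddCommGroup E₂] [NormedSpace ℝ E₂]
  {N₂ : Type*} [TopologicalSpace N₂] [ChartedSpace E₂ N₂]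

variable (E E₁ E₂) in
/-- The map `ι` read in the preferred charts at `(a, b)` and at its image. -/
def chartImmersion (ι : N₁ × N₂ → M) (a : N₁) (b : N₂) (y : E₁ × E₂) : E :=
  extChartAt 𝓘(ℝ, E) (ι (a, b))
    (ι ((extChartAt 𝓘(ℝ, E₁) a).symm y.1, (extChartAt 𝓘(ℝ, E₂) b).symm y.2))

theorem writtenInExtChartAt_eq_chartImmersion (ι : N₁ × N₂ → M) (a : N₁) (b : N₂) :
    writtenInExtChartAt (𝓘(ℝ, E₁).prod 𝓘(ℝ, E₂)) 𝓘(ℝ, E) (a, b) ι =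
      chartImmersion E E₁ E₂ ι a b := by
  ext y
  simp only [writtenInExtChartAt, extChartAt_prod, chartImmersion]
  rfl

theorem extChartAt_prod_self (a : N₁) (b : N₂) :
    extChartAt (𝓘(ℝ, E₁).prod 𝓘(ℝ, E₂)) (a, b) (a, b) =
      (extChartAt 𝓘(ℝ, E₁) a a, extChartAt 𝓘(ℝ, E₂) b b) := by
  rw [extChartAt_prod]; rfl

theorem chartImmersion_self (ι : N₁ × N₂ → M) (a : N₁) (b : N₂) :
    chartImmersion E E₁ E₂ ι a b (extChartAt 𝓘(ℝ, E₁) a a, extChartAt 𝓘(ℝ, E₂) b b) =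
      extChartAt 𝓘(ℝ, E) (ι (a, b)) (ι (a, b)) := by
  simp only [chartImmersion, extChartAt_to_inv]

/-- The warping function, read in the chart at `a` and divided by its value at `a`. -/
def chartWarping (E₁ : Type*) [NormedAddCommGroup E₁] [NormedSpace ℝ E₁]
    {N₁ : Type*} [TopologicalSpace N₁] [ChartedSpace E₁ N₁] (f : N₁ → ℝ) (a : N₁) (s : E₁) : ℝ :=
  f ((extChartAt 𝓘(ℝ, E₁) a).symm s) / f a

theorem hasFDerivAt_chartWarping {f : N₁ → ℝ} (hf : ContMDiff 𝓘(ℝ, E₁) 𝓘(ℝ, ℝ) ∞ f) (a : N₁) :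
    HasFDerivAt (chartWarping E₁ f a)
      ((f a)⁻¹ • fderiv ℝ (fun s ↦ f ((extChartAt 𝓘(ℝ, E₁) a).symm s)) (extChartAt 𝓘(ℝ, E₁) a a))
      (extChartAt 𝓘(ℝ, E₁) a a) := by
  have h := (contMDiffAt_iff.mp (hf a)).2
  rw [ModelWithCorners.range_eq_univ, contDiffWithinAt_univ] at h
  have hd : DifferentiableAt ℝ (fun s ↦ f ((extChartAt 𝓘(ℝ, E₁) a).symm s))
    (extChartAt 𝓘(ℝ, E₁) a a) := h.differentiableAt (by simp)
  exact hd.hasFDerivAt.mul_const (f a)⁻¹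

variable [FiniteDimensional ℝ E] [IsManifold 𝓘(ℝ, E) ∞ M]
  [RiemannianBundle (fun p : M ↦ TangentSpace 𝓘(ℝ, E) p)]
  [RiemannianBundle (fun p : N₁ ↦ TangentSpace 𝓘(ℝ, E₁) p)]
  [RiemannianBundle (fun p : N₂ ↦ TangentSpace 𝓘(ℝ, E₂) p)]
  {S : AlmostContactMetricStructure E M} {f : N₁ → ℝ} {ι : N₁ × N₂ → M} {θ : ℝ}

theorem contDiffAt_chartImmersion (hM : IsWarpedProductSemiSlant E E₁ E₂ S f ι θ)
    (a : N₁) (b : N₂) : ContDiffAt ℝ 2 (chartImmersion E E₁ E₂ ι a b)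
      (extChartAt 𝓘(ℝ, E₁) a a, extChartAt 𝓘(ℝ, E₂) b b) := by
  have h := (contMDiffAt_iff.mp (hM.smooth_ι (a, b))).2
  rw [ModelWithCorners.range_eq_univ, contDiffWithinAt_univ, extChartAt_prod_self] at h
  have h2 := writtenInExtChartAt_eq_chartImmersion (E := E) (E₁ := E₁) (E₂ := E₂) ι a b
  rw [writtenInExtChartAt] at h2
  rw [h2] at h
  exact h.of_le (by norm_cast)

theorem prodDeriv_eq_fderiv (hM : IsWarpedProductSemiSlant E E₁ E₂ S f ι θ)
    (a : N₁) (b : N₂) (v : E₁ × E₂) :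
    prodDeriv E E₁ E₂ ι (a, b) v = (tangentCoord 𝓘(ℝ, E) (ι (a, b))).symm
      (fderiv ℝ (chartImmersion E E₁ E₂ ι a b)
        (extChartAt 𝓘(ℝ, E₁) a a, extChartAt 𝓘(ℝ, E₂) b b) v) := by
  have h1 : mfderiv (𝓘(ℝ, E₁).prod 𝓘(ℝ, E₂)) 𝓘(ℝ, E) ι (a, b) =
      fderiv ℝ (chartImmersion E E₁ E₂ ι a b)
        (extChartAt 𝓘(ℝ, E₁) a a, extChartAt 𝓘(ℝ, E₂) b b) := by
    have h := (mdifferentiableAt_immersion hM (a, b)).mfderiv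
    rw [ModelWithCorners.range_eq_univ, extChartAt_prod_self,
      writtenInExtChartAt_eq_chartImmersion, fderivWithin_univ] at h
    exact h
  exact DFunLike.congr_fun h1 v

/-- The set of coordinates where the immersion can be read in the charts at `(a, b)`. -/
def chartDomain (ι : N₁ × N₂ → M) (a : N₁) (b : N₂) : Set (E₁ × E₂) :=
  {y | y.1 ∈ (extChartAt 𝓘(ℝ, E₁) a).target ∧ y.2 ∈ (extChartAt 𝓘(ℝ, E₂) b).target ∧
    ι ((extChartAt 𝓘(ℝ, E₁) a).symm y.1, (extChartAt 𝓘(ℝ, E₂) b).symm y.2) ∈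
      (extChartAt 𝓘(ℝ, E) (ι (a, b))).source}

theorem chartDomain_mem_nhds (hM : IsWarpedProductSemiSlant E E₁ E₂ S f ι θ) (a : N₁) (b : N₂) :
    ∀ᶠ y in 𝓝 (extChartAt 𝓘(ℝ, E₁) a a, extChartAt 𝓘(ℝ, E₂) b b),
      y ∈ chartDomain (E := E) ι a b ∧ DifferentiableAt ℝ (chartImmersion E E₁ E₂ ι a b) y := by
  have h1 : ∀ᶠ y in 𝓝 (extChartAt 𝓘(ℝ, E₁) a a, extChartAt 𝓘(ℝ, E₂) b b),
      y.1 ∈ (extChartAt 𝓘(ℝ, E₁) a).target :=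
    (continuous_fst.tendsto _).eventually (extChartAt_target_mem_nhds (I := 𝓘(ℝ, E₁)) a)
  have h2 : ∀ᶠ y in 𝓝 (extChartAt 𝓘(ℝ, E₁) a a, extChartAt 𝓘(ℝ, E₂) b b),
      y.2 ∈ (extChartAt 𝓘(ℝ, E₂) b).target :=
    (continuous_snd.tendsto _).eventually (extChartAt_target_mem_nhds (I := 𝓘(ℝ, E₂)) b)
  have h3 : ContinuousAt (fun y : E₁ × E₂ ↦ ι ((extChartAt 𝓘(ℝ, E₁) a).symm y.1,
      (extChartAt 𝓘(ℝ, E₂) b).symm y.2)) (extChartAt 𝓘(ℝ, E₁) a a, extChartAt 𝓘(ℝ, E₂) b b) := by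
    refine hM.smooth_ι.continuous.continuousAt.comp ?_
    exact (ContinuousAt.comp (f := Prod.fst)
      (continuousAt_extChartAt_symm (I := 𝓘(ℝ, E₁)) a) continuousAt_fst).prodMk
      (ContinuousAt.comp (f := Prod.snd)
      (continuousAt_extChartAt_symm (I := 𝓘(ℝ, E₂)) b) continuousAt_snd)
  have h4 : ∀ᶠ y in 𝓝 (extChartAt 𝓘(ℝ, E₁) a a, extChartAt 𝓘(ℝ, E₂) b b),
      ι ((extChartAt 𝓘(ℝ, E₁) a).symm y.1, (extChartAt 𝓘(ℝ, E₂) b).symm y.2) ∈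
      (extChartAt 𝓘(ℝ, E) (ι (a, b))).source := by
    refine h3 ?_
    simp only [extChartAt_to_inv]
    exact extChartAt_source_mem_nhds _
  filter_upwards [h1, h2, h4, (contDiffAt_chartImmersion hM a b).eventually (by simp)]
    with y hy1 hy2 hy3 hy4
  exact ⟨⟨hy1, hy2, hy3⟩, hy4.differentiableAt two_ne_zero⟩

/-- This and `constField_fderiv_inr` translate coordinate partial derivatives, at all points near
the base point, into leaf differentials. The identities of `warpedChart` must hold on neighbourhoods
because they are differentiated. -/
theorem constField_fderiv_inl [IsManifold 𝓘(ℝ, E₁) ∞ N₁]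
    (hM : IsWarpedProductSemiSlant E E₁ E₂ S f ι θ) {a : N₁} {b : N₂}
    {y : E₁ × E₂} (hy : y ∈ chartDomain (E := E) ι a b)
    (hd : DifferentiableAt ℝ (chartImmersion E E₁ E₂ ι a b) y) (x : E₁) :
    constField (ι (a, b)) (fderiv ℝ (chartImmersion E E₁ E₂ ι a b) y (x, 0))
        (ι ((extChartAt 𝓘(ℝ, E₁) a).symm y.1, (extChartAt 𝓘(ℝ, E₂) b).symm y.2)) =
      leafDeriv₁ E ι ((extChartAt 𝓘(ℝ, E₁) a).symm y.1) ((extChartAt 𝓘(ℝ, E₂) b).symm y.2)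
        (coordVec a y.1 x) := by
  have hj : MDifferentiableAt 𝓘(ℝ, E₁) 𝓘(ℝ, E)
      (fun a' ↦ ι (a', (extChartAt 𝓘(ℝ, E₂) b).symm y.2)) ((extChartAt 𝓘(ℝ, E₁) a).symm y.1) :=
    (mdifferentiableAt_immersion hM _).comp _ (mdifferentiableAt_id.prodMk mdifferentiableAt_const)
  have h1 := fderiv_chart_comp hy.1 hj hy.2.2 x
  have h2 : HasFDerivAt (fun s ↦ chartImmersion E E₁ E₂ ι a b (s, y.2))
      ((fderiv ℝ (chartImmersion E E₁ E₂ ι a b) y).comp (ContinuousLinearMap.inl ℝ E₁ E₂)) y.1 :=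
    HasFDerivAt.comp (g := chartImmersion E E₁ E₂ ι a b) (f := fun s ↦ (s, y.2)) y.1
      hd.hasFDerivAt (hasFDerivAt_prodMk_left y.1 y.2)
  have h3 : fderiv ℝ (chartImmersion E E₁ E₂ ι a b) y (x, 0) = _ :=
    (DFunLike.congr_fun h2.fderiv x).symm.trans h1
  rw [h3]
  exact constField_mfderiv hy.2.2 _

theorem constField_fderiv_inr [IsManifold 𝓘(ℝ, E₂) ∞ N₂]
    (hM : IsWarpedProductSemiSlant E E₁ E₂ S f ι θ) {a : N₁} {b : N₂}
    {y : E₁ × E₂} (hy : y ∈ chartDomain (E := E) ι a b)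
    (hd : DifferentiableAt ℝ (chartImmersion E E₁ E₂ ι a b) y) (x : E₂) :
    constField (ι (a, b)) (fderiv ℝ (chartImmersion E E₁ E₂ ι a b) y (0, x))
        (ι ((extChartAt 𝓘(ℝ, E₁) a).symm y.1, (extChartAt 𝓘(ℝ, E₂) b).symm y.2)) =
      leafDeriv₂ E ι ((extChartAt 𝓘(ℝ, E₁) a).symm y.1) ((extChartAt 𝓘(ℝ, E₂) b).symm y.2)
        (coordVec b y.2 x) := by
  have hj : MDifferentiableAt 𝓘(ℝ, E₂) 𝓘(ℝ, E)
      (fun b' ↦ ι ((extChartAt 𝓘(ℝ, E₁) a).symm y.1, b')) ((extChartAt 𝓘(ℝ, E₂) b).symm y.2) :=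
    (mdifferentiableAt_immersion hM _).comp _ (mdifferentiableAt_const.prodMk mdifferentiableAt_id)
  have h1 := fderiv_chart_comp hy.2.1 hj hy.2.2 x
  have h2 : HasFDerivAt (fun s ↦ chartImmersion E E₁ E₂ ι a b (y.1, s))
      ((fderiv ℝ (chartImmersion E E₁ E₂ ι a b) y).comp (ContinuousLinearMap.inr ℝ E₁ E₂)) y.2 :=
    HasFDerivAt.comp (g := chartImmersion E E₁ E₂ ι a b) (f := fun s ↦ (y.1, s)) y.2
      hd.hasFDerivAt (hasFDerivAt_prodMk_right y.1 y.2)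
  have h3 : fderiv ℝ (chartImmersion E E₁ E₂ ι a b) y (0, x) = _ :=
    (DFunLike.congr_fun h2.fderiv x).symm.trans h1
  rw [h3]
  exact constField_mfderiv hy.2.2 _

theorem warpedChart [IsManifold 𝓘(ℝ, E₁) ∞ N₁] [IsManifold 𝓘(ℝ, E₂) ∞ N₂]
    (hM : IsWarpedProductSemiSlant E E₁ E₂ S f ι θ) (a : N₁) (b : N₂) :
    WarpedChart (chartMetric (ι (a, b))) (chartMap S (ι (a, b))) (coordRep (ι (a, b)) S.ξ)
      (chartImmersion E E₁ E₂ ι a b) (extChartAt 𝓘(ℝ, E₁) a a) (extChartAt 𝓘(ℝ, E₂) b b)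
      (chartWarping E₁ f a) θ := by
  have hdom := chartDomain_mem_nhds hM a b
  have hG : ∀ y ∈ chartDomain (E := E) ι a b, ∀ v w,
      chartMetric (ι (a, b)) (chartImmersion E E₁ E₂ ι a b y) v w =
        inner ℝ (constField (ι (a, b)) v (ι ((extChartAt 𝓘(ℝ, E₁) a).symm y.1,
          (extChartAt 𝓘(ℝ, E₂) b).symm y.2))) (constField (ι (a, b)) w
          (ι ((extChartAt 𝓘(ℝ, E₁) a).symm y.1, (extChartAt 𝓘(ℝ, E₂) b).symm y.2))) :=
    fun y hy v w ↦ chartMetric_extChartAt hy.2.2 v w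
  have hΦ : ∀ y ∈ chartDomain (E := E) ι a b, ∀ v,
      constField (ι (a, b)) (chartMap S (ι (a, b)) (chartImmersion E E₁ E₂ ι a b y) v)
        (ι ((extChartAt 𝓘(ℝ, E₁) a).symm y.1, (extChartAt 𝓘(ℝ, E₂) b).symm y.2)) =
      S.φ _ (constField (ι (a, b)) v
        (ι ((extChartAt 𝓘(ℝ, E₁) a).symm y.1, (extChartAt 𝓘(ℝ, E₂) b).symm y.2))) :=
    fun y hy v ↦ constField_chartMap S hy.2.2 v
  have hΞ : ∀ y ∈ chartDomain (E := E) ι a b,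
      constField (ι (a, b)) (coordRep (ι (a, b)) S.ξ (chartImmersion E E₁ E₂ ι a b y))
        (ι ((extChartAt 𝓘(ℝ, E₁) a).symm y.1, (extChartAt 𝓘(ℝ, E₂) b).symm y.2)) = S.ξ _ :=
    fun y hy ↦ constField_coordRep hy.2.2 _
  have hl : Tendsto (fun s : E₁ ↦ (s, extChartAt 𝓘(ℝ, E₂) b b)) (𝓝 (extChartAt 𝓘(ℝ, E₁) a a))
      (𝓝 (extChartAt 𝓘(ℝ, E₁) a a, extChartAt 𝓘(ℝ, E₂) b b)) :=
    (Continuous.prodMk_left _).tendsto _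
  have hr : Tendsto (fun s : E₂ ↦ (extChartAt 𝓘(ℝ, E₁) a a, s)) (𝓝 (extChartAt 𝓘(ℝ, E₂) b b))
      (𝓝 (extChartAt 𝓘(ℝ, E₁) a a, extChartAt 𝓘(ℝ, E₂) b b)) :=
    (Continuous.prodMk_right _).tendsto _
  obtain ⟨hy0, hd0⟩ := hdom.self_of_nhds
  have hfa : f a ≠ 0 := (hM.f_pos a).ne'
  refine
    { contDiffAt := contDiffAt_chartImmersion hM a b
      differentiableAt := (hasFDerivAt_chartWarping hM.smooth_f a).differentiableAt
      normalized := by rw [chartWarping, extChartAt_to_inv, div_self hfa]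
      mixed := ?_
      horizontal := ?_
      vertical := ?_
      invariant := ?_
      reeb := ?_
      slant := ?_ }
  · filter_upwards [hdom] with y hy x z
    rw [hG y hy.1, constField_fderiv_inl hM hy.1 hy.2, constField_fderiv_inr hM hy.1 hy.2,
      inner_leafDeriv₁_leafDeriv₂ hM]
  · filter_upwards [hr.eventually hdom] with t ht x y
    rw [hG _ ht.1, constField_fderiv_inl hM ht.1 ht.2, constField_fderiv_inl hM ht.1 ht.2,
      inner_leafDeriv₁ hM, hG _ hy0, constField_fderiv_inl hM hy0 hd0,
      constField_fderiv_inl hM hy0 hd0, inner_leafDeriv₁ hM]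
  · filter_upwards [hl.eventually hdom] with s hs z w
    rw [hG _ hs.1, constField_fderiv_inr hM hs.1 hs.2, constField_fderiv_inr hM hs.1 hs.2,
      inner_leafDeriv₂ hM, hG _ hy0, constField_fderiv_inr hM hy0 hd0,
      constField_fderiv_inr hM hy0 hd0, inner_leafDeriv₂ hM, chartWarping]
    simp only [extChartAt_to_inv]
    field_simp
  · filter_upwards [hdom] with y hy x z
    obtain ⟨w, hw⟩ := exists_map_leafDeriv₁ hM ((extChartAt 𝓘(ℝ, E₁) a).symm y.1)
      ((extChartAt 𝓘(ℝ, E₂) b).symm y.2) (coordVec a y.1 x)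
    rw [hG y hy.1, hΦ y hy.1, constField_fderiv_inl hM hy.1 hy.2,
      constField_fderiv_inr hM hy.1 hy.2, hw, inner_leafDeriv₁_leafDeriv₂ hM]
  · filter_upwards [hdom] with y hy z
    rw [hG y hy.1, hΞ y hy.1, constField_fderiv_inr hM hy.1 hy.2, real_inner_comm,
      inner_leafDeriv₂_reeb hM]
  · filter_upwards [hdom] with y hy z
    obtain ⟨t, -, ht1, ht2⟩ := exists_slant hM ((extChartAt 𝓘(ℝ, E₁) a).symm y.1)
      ((extChartAt 𝓘(ℝ, E₂) b).symm y.2) (coordVec b y.2 z)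
    have ht := coordVec_symm hy.1.2.1 t
    refine ⟨tangentCoord 𝓘(ℝ, E₂) _ (mfderiv 𝓘(ℝ, E₂) 𝓘(ℝ, E₂) (extChartAt 𝓘(ℝ, E₂) b)
      ((extChartAt 𝓘(ℝ, E₂) b).symm y.2) t), fun w ↦ ?_, ?_⟩
    · rw [hG y hy.1, hΦ y hy.1, hG y hy.1, constField_fderiv_inr hM hy.1 hy.2,
        constField_fderiv_inr hM hy.1 hy.2, constField_fderiv_inr hM hy.1 hy.2, ht, ht1]
    · rw [hG y hy.1, hG y hy.1, constField_fderiv_inr hM hy.1 hy.2,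
        constField_fderiv_inr hM hy.1 hy.2, ht, ht2]

end Immersion

/-! ### Tangency of the ambient derivative in the equality case. -/

section EqualityCase

variable {V : Type*} [NormedAddCommGroup V] [InnerProductSpace ℝ V]

theorem IsFrame.exists_gradient {F : Type*} [AddCommGroup F] [Module ℝ F] {κ : Type*} [Fintype κ]
    {D : F →ₗ[ℝ] V} {e : κ → F} (he : IsFrame D e) (L : F →ₗ[ℝ] ℝ) :
    ∃ g, ∀ v, inner ℝ (D g) (D v) = L v := by
  refine ⟨∑ j, L (e j) • e j, fun v ↦ ?_⟩
  conv_rhs => rw [← he.expand v]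
  simp [sum_inner, inner_smul_left, mul_comm]

variable {E₁ : Type*} [AddCommGroup E₁] [Module ℝ E₁] {E₂ : Type*} [AddCommGroup E₂] [Module ℝ E₂]
  {D : E₁ × E₂ →ₗ[ℝ] V} {B : E₁ × E₂ →ₗ[ℝ] E₁ × E₂ →ₗ[ℝ] V}
  {φ : V →ₗ[ℝ] V} {ξ : V} {lam : E₁ →ₗ[ℝ] ℝ} {θ : ℝ} {ψ : V → V → V → ℝ} {dΩ : E₁ → E₂ → E₂ → ℝ}

/-- Vanishing of h only makes `∇_x y` tangent to `M`; orthogonality to the slant factor then places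
it in the horizontal leaf. -/
theorem SemiSlantPoint.exists_horizontal_eq (H : SemiSlantPoint D B φ ξ lam θ ψ dΩ) {x y : E₁}
    (h : ∃ v, B (x, 0) (y, 0) = D v) : ∃ s, B (x, 0) (y, 0) = D (s, 0) := by
  obtain ⟨⟨s, t⟩, hv⟩ := h
  have h1 := H.inner_horizontal_vertical x y t
  rw [hv, map_eq_add s, inner_add_left, H.orthogonal, zero_add, inner_self_eq_zero] at h1
  exact ⟨s, by rw [hv, map_eq_add s, h1, add_zero]⟩

theorem SemiSlantPoint.exists_vertical_eq (H : SemiSlantPoint D B φ ξ lam θ ψ dΩ) {g : E₁}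
    (hg : ∀ x, lam x = inner ℝ (D (g, 0)) (D (x, 0))) {z w : E₂}
    (h : ∃ v, B (0, z) (0, w) = D v) :
    ∃ t, B (0, z) (0, w) - -inner ℝ (D (0, z)) (D (0, w)) • D (g, 0) = D (0, t) := by
  obtain ⟨⟨s, t⟩, hv⟩ := h
  refine ⟨t, ?_⟩
  set c := inner ℝ (D (0, z)) (D (0, w)) with hc
  have h1 : D (s, 0) - -c • D (g, 0) = D (s - -c • g, 0) := by
    rw [← map_smul, ← map_sub]; simp
  have h2 := H.inner_vertical_horizontal (s - -c • g) z w
  rw [hv, map_eq_add s, inner_add_left, real_inner_comm (D (_, 0)) (D (0, t)), H.orthogonal,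
    add_zero, hg, ← hc, ← h1] at h2
  -- The formula for the horizontal part of `∇_z w` is tested against the discrepancy itself, which
  -- is therefore orthogonal to itself.
  have h3 : inner ℝ (D (s, 0) - -c • D (g, 0)) (D (s, 0) - -c • D (g, 0)) = 0 := by
    conv_lhs => rw [inner_sub_left, real_inner_smul_left, h2]
    ring
  rw [hv, map_eq_add s, add_sub_right_comm, inner_self_eq_zero.mp h3, zero_add]

end EqualityCase

/-! ### Normal projection, orthonormal frames and umbilicity of a submanifold. -/

section Submanifold

variable {E : Type*} [NormedAddCommGroup E] [NormedSpace ℝ E] [FiniteDimensional ℝ E]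
  {M : Type*} [TopologicalSpace M] [ChartedSpace E M]
  [RiemannianBundle (fun p : M ↦ TangentSpace 𝓘(ℝ, E) p)]
  {F : Type*} [NormedAddCommGroup F] [NormedSpace ℝ F]
  {H : Type*} [TopologicalSpace H] {I : ModelWithCorners ℝ F H}
  {N : Type*} [TopologicalSpace N] [ChartedSpace H N]

variable (E I) in
/-- The projection to the normal space, as a linear map. -/
def normalProj (ι : N → M) (x : N) :
    TangentSpace 𝓘(ℝ, E) (ι x) →ₗ[ℝ] TangentSpace 𝓘(ℝ, E) (ι x) :=
  LinearMap.id - (tangentImage E I ι x).starProjection.toLinearMap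

theorem inner_normalPart (ι : N → M) (x : N) (v : TangentSpace 𝓘(ℝ, E) (ι x))
    (w : TangentSpace I x) :
    inner ℝ (normalPart E I ι x v) (mfderiv I 𝓘(ℝ, E) ι x w) = 0 :=
  Submodule.starProjection_inner_eq_zero (K := tangentImage E I ι x) v _ ⟨w, rfl⟩

theorem exists_sub_normalPart_eq (ι : N → M) (x : N) (v : TangentSpace 𝓘(ℝ, E) (ι x)) :
    ∃ w : TangentSpace I x, v - normalPart E I ι x v = mfderiv I 𝓘(ℝ, E) ι x w := by
  obtain ⟨w, hw⟩ := Submodule.starProjection_apply_mem (tangentImage E I ι x) v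
  exact ⟨w, (sub_sub_cancel _ _).trans hw.symm⟩

theorem normalPart_eq_of_sub_mem {ι : N → M} {x : N} {v n : TangentSpace 𝓘(ℝ, E) (ι x)}
    (hn : ∀ w : TangentSpace I x, inner ℝ n (mfderiv I 𝓘(ℝ, E) ι x w) = 0)
    (hv : v - n ∈ tangentImage E I ι x) : normalPart E I ι x v = n := by
  have h1 : (tangentImage E I ι x).starProjection v = v - n := by
    refine Submodule.eq_starProjection_of_mem_of_inner_eq_zero hv ?_
    rintro _ ⟨w, rfl⟩
    rw [sub_sub_cancel]
    exact hn w
  rw [normalPart, tangentPart, h1, sub_sub_cancel]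

theorem mfderiv_orthonormalFrame (ι : N → M) (x : N)
    (i : Fin (Module.finrank ℝ (tangentImage E I ι x))) :
    mfderiv I 𝓘(ℝ, E) ι x (orthonormalFrame E I ι x i) =
      stdOrthonormalBasis ℝ (tangentImage E I ι x) i :=
  Classical.choose_spec (stdOrthonormalBasis ℝ (tangentImage E I ι x) i).2

theorem isFrame_orthonormalFrame {ι : N → M} {x : N}
    (h : Function.Injective (mfderiv I 𝓘(ℝ, E) ι x)) :
    IsFrame (mfderiv I 𝓘(ℝ, E) ι x).toLinearMap (orthonormalFrame E I ι x) :=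
  .of_orthonormalBasis h (stdOrthonormalBasis ℝ (tangentImage E I ι x))
    (mfderiv_orthonormalFrame ι x)

/-- Taking the trace identifies any such `K` with the mean curvature vector. In dimension zero the
mean curvature need not be `K`, but the induced inner product vanishes. -/
theorem isTotallyUmbilical_of_forall_exists {ι : N → M}
    (h : ∀ x, ∃ K, ∀ v w, secondFundamentalForm E I ι x v w = inducedInner E I ι x v w • K) :
    IsTotallyUmbilical E I ι := by
  intro x v w
  obtain ⟨K, hK⟩ := h x
  rw [hK]
  by_cases hn : Module.finrank ℝ (tangentImage E I ι x) = 0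
  · have h0 := Submodule.finrank_eq_zero.mp hn
    have hv : mfderiv I 𝓘(ℝ, E) ι x v ∈ tangentImage E I ι x := ⟨v, rfl⟩
    rw [h0, Submodule.mem_bot] at hv
    rw [inducedInner, hv, inner_zero_left, zero_smul, zero_smul]
  · have h1 : ∀ i, inducedInner E I ι x (orthonormalFrame E I ι x i)
        (orthonormalFrame E I ι x i) = 1 := by
      intro i
      rw [inducedInner, mfderiv_orthonormalFrame, real_inner_self_eq_norm_sq]
      have := (stdOrthonormalBasis ℝ (tangentImage E I ι x)).orthonormal.1 i
      rw [Submodule.coe_norm] at this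
      rw [this, one_pow]
    have h2 : meanCurvature E I ι x = K := by
      simp only [meanCurvature, hK, h1, one_smul, Finset.sum_const, Finset.card_univ,
        Fintype.card_fin]
      rw [← Nat.cast_smul_eq_nsmul ℝ, smul_smul, one_div_mul_cancel (Nat.cast_ne_zero.mpr hn),
        one_smul]
    rw [h2]

end Submanifold

/-! ### Second fundamental forms of the product and the leaves, and the gradient of ln f. -/

section Immersion

open Filter Topology Set

variable {E : Type*} [NormedAddCommGroup E] [NormedSpace ℝ E] [FiniteDimensional ℝ E]
  {M : Type*} [TopologicalSpace M] [ChartedSpace E M] [IsManifold 𝓘(ℝ, E) ∞ M]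
  [RiemannianBundle (fun p : M ↦ TangentSpace 𝓘(ℝ, E) p)]
  {E₁ : Type*} [NormedAddCommGroup E₁] [NormedSpace ℝ E₁]
  {N₁ : Type*} [TopologicalSpace N₁] [ChartedSpace E₁ N₁]
  [RiemannianBundle (fun p : N₁ ↦ TangentSpace 𝓘(ℝ, E₁) p)]
  {E₂ : Type*} [NormedAddCommGroup E₂] [NormedSpace ℝ E₂]
  {N₂ : Type*} [TopologicalSpace N₂] [ChartedSpace E₂ N₂]
  [RiemannianBundle (fun p : N₂ ↦ TangentSpace 𝓘(ℝ, E₂) p)]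
  {S : AlmostContactMetricStructure E M} {f : N₁ → ℝ} {ι : N₁ × N₂ → M} {θ : ℝ}

variable (E E₁ E₂) in
/-- The ambient covariant derivative of the coordinate fields along `ι`, on the model space. -/
def prodAmbientDeriv (ι : N₁ × N₂ → M) (a : N₁) (b : N₂) (v w : E₁ × E₂) :
    TangentSpace 𝓘(ℝ, E) (ι (a, b)) :=
  (tangentCoord 𝓘(ℝ, E) (ι (a, b))).symm
    (alongDeriv (chartImmersion E E₁ E₂ ι a b) (chartChristoffel (ι (a, b)))
      (extChartAt 𝓘(ℝ, E₁) a a, extChartAt 𝓘(ℝ, E₂) b b) v w)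

theorem prodAmbientDeriv_eq (hM : IsWarpedProductSemiSlant E E₁ E₂ S f ι θ) (a : N₁) (b : N₂)
    (v w : E₁ × E₂) : prodAmbientDeriv E E₁ E₂ ι a b v w =
      (tangentCoord 𝓘(ℝ, E) (ι (a, b))).symm
        (fderiv ℝ (fderiv ℝ (chartImmersion E E₁ E₂ ι a b))
          (extChartAt 𝓘(ℝ, E₁) a a, extChartAt 𝓘(ℝ, E₂) b b) v w) +
      christoffel (ι (a, b)) (prodDeriv E E₁ E₂ ι (a, b) v) (prodDeriv E E₁ E₂ ι (a, b) w) := by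
  rw [prodAmbientDeriv, alongDeriv, map_add, prodDeriv_eq_fderiv hM, prodDeriv_eq_fderiv hM,
    chartChristoffel, ContinuousLinearEquiv.symm_apply_apply]

theorem ambientDeriv_prod (hM : IsWarpedProductSemiSlant E E₁ E₂ S f ι θ) (a : N₁) (b : N₂)
    (v w : TangentSpace (𝓘(ℝ, E₁).prod 𝓘(ℝ, E₂)) (a, b)) :
    ambientDeriv E (𝓘(ℝ, E₁).prod 𝓘(ℝ, E₂)) ι (a, b) v w =
      prodAmbientDeriv E E₁ E₂ ι a b (tangentCoord _ _ v) (tangentCoord _ _ w) := by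
  rw [prodAmbientDeriv_eq hM, ambientDeriv, writtenInExtChartAt_eq_chartImmersion,
    extChartAt_prod_self]
  rfl

theorem ambientDeriv_leaf₁ (hM : IsWarpedProductSemiSlant E E₁ E₂ S f ι θ) (a : N₁) (b : N₂)
    (v w : TangentSpace 𝓘(ℝ, E₁) a) :
    ambientDeriv E 𝓘(ℝ, E₁) (fun a' ↦ ι (a', b)) a v w =
      prodAmbientDeriv E E₁ E₂ ι a b (tangentCoord _ _ v, 0) (tangentCoord _ _ w, 0) := by
  have h1 : writtenInExtChartAt 𝓘(ℝ, E₁) 𝓘(ℝ, E) a (fun a' ↦ ι (a', b)) =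
      fun s ↦ chartImmersion E E₁ E₂ ι a b (s, extChartAt 𝓘(ℝ, E₂) b b) := by
    ext s
    simp only [chartImmersion, extChartAt_to_inv]
    rfl
  have h2 := (fderiv_fderiv_comp (j := fun s ↦ (s, extChartAt 𝓘(ℝ, E₂) b b))
    (contDiffAt_chartImmersion hM a b) (fun t ↦ hasFDerivAt_prodMk_left t (extChartAt 𝓘(ℝ, E₂) b b))
    (tangentCoord 𝓘(ℝ, E₁) a v) (tangentCoord 𝓘(ℝ, E₁) a w)).2
  rw [prodAmbientDeriv_eq hM, ambientDeriv, h1, h2, ← leafDeriv₁_eq hM, ← leafDeriv₁_eq hM]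
  rfl

theorem ambientDeriv_leaf₂ (hM : IsWarpedProductSemiSlant E E₁ E₂ S f ι θ) (a : N₁) (b : N₂)
    (v w : TangentSpace 𝓘(ℝ, E₂) b) :
    ambientDeriv E 𝓘(ℝ, E₂) (fun b' ↦ ι (a, b')) b v w =
      prodAmbientDeriv E E₁ E₂ ι a b (0, tangentCoord _ _ v) (0, tangentCoord _ _ w) := by
  have h1 : writtenInExtChartAt 𝓘(ℝ, E₂) 𝓘(ℝ, E) b (fun b' ↦ ι (a, b')) =
      fun s ↦ chartImmersion E E₁ E₂ ι a b (extChartAt 𝓘(ℝ, E₁) a a, s) := by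
    ext s
    simp only [chartImmersion, extChartAt_to_inv]
    rfl
  have h2 := (fderiv_fderiv_comp (contDiffAt_chartImmersion hM a b)
    (fun t ↦ hasFDerivAt_prodMk_right (extChartAt 𝓘(ℝ, E₁) a a) t)
    (tangentCoord 𝓘(ℝ, E₂) b v) (tangentCoord 𝓘(ℝ, E₂) b w)).2
  rw [prodAmbientDeriv_eq hM, ambientDeriv, h1, h2, ← leafDeriv₂_eq hM, ← leafDeriv₂_eq hM]
  rfl

/-- The differential of `log f`. -/
theorem mfderiv_log_warping (hM : IsWarpedProductSemiSlant E E₁ E₂ S f ι θ) (a : N₁) (b : N₂)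
    (v : TangentSpace (𝓘(ℝ, E₁).prod 𝓘(ℝ, E₂)) (a, b)) :
    tangentCoord 𝓘(ℝ, ℝ) (Real.log (f a)) (mfderiv (𝓘(ℝ, E₁).prod 𝓘(ℝ, E₂)) 𝓘(ℝ, ℝ)
      (fun p : N₁ × N₂ ↦ Real.log (f p.1)) (a, b) v) =
    fderiv ℝ (chartWarping E₁ f a) (extChartAt 𝓘(ℝ, E₁) a a)
      (tangentCoord (𝓘(ℝ, E₁).prod 𝓘(ℝ, E₂)) (a, b) v).1 := by
  have hfa : f a ≠ 0 := (hM.f_pos a).ne'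
  have h1 := (hasFDerivAt_chartWarping hM.smooth_f a).differentiableAt.hasFDerivAt
  have h2 : HasFDerivAt (fun y : E₁ × E₂ ↦ chartWarping E₁ f a y.1) _
      (extChartAt 𝓘(ℝ, E₁) a a, extChartAt 𝓘(ℝ, E₂) b b) :=
    HasFDerivAt.comp (g := chartWarping E₁ f a) _ h1 hasFDerivAt_fst
  have h0 : chartWarping E₁ f a (extChartAt 𝓘(ℝ, E₁) a a) = 1 := by
    rw [chartWarping, extChartAt_to_inv, div_self hfa]
  -- In coordinates ln f is the logarithm of the normalized warping function plus a constant; the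
  -- derivative of log at 1 is the identity.
  have h3 := (h2.log (by rw [h0]; exact one_ne_zero)).add_const (Real.log (f a))
  rw [h0, inv_one, one_smul] at h3
  have h4 : (fun y : E₁ × E₂ ↦ Real.log (chartWarping E₁ f a y.1) + Real.log (f a)) =
      writtenInExtChartAt (𝓘(ℝ, E₁).prod 𝓘(ℝ, E₂)) 𝓘(ℝ, ℝ) (a, b)
        (fun p : N₁ × N₂ ↦ Real.log (f p.1)) := by
    ext y
    rw [chartWarping, ← Real.log_mul (div_ne_zero (hM.f_pos _).ne' hfa) hfa, div_mul_cancel₀ _ hfa]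
    simp only [writtenInExtChartAt, extChartAt_prod]
    rfl
  have h5 : HasMFDerivAt (𝓘(ℝ, E₁).prod 𝓘(ℝ, E₂)) 𝓘(ℝ, ℝ)
      (fun p : N₁ × N₂ ↦ Real.log (f p.1)) (a, b)
      ((fderiv ℝ (chartWarping E₁ f a) (extChartAt 𝓘(ℝ, E₁) a a)).comp
        (ContinuousLinearMap.fst ℝ E₁ E₂)) := by
    refine ⟨?_, ?_⟩
    · exact ((hM.smooth_f.continuous.comp continuous_fst).continuousAt).log hfa
    · rw [ModelWithCorners.range_eq_univ, extChartAt_prod_self, ← h4]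
      exact h3.hasFDerivWithinAt
  rw [h5.mfderiv]
  rfl

variable [FiniteDimensional ℝ E₁] [FiniteDimensional ℝ E₂]

theorem exists_gradient_log_warping (hM : IsWarpedProductSemiSlant E E₁ E₂ S f ι θ) (a : N₁)
    (b : N₂) : ∃ g : E₁, (∀ x, fderiv ℝ (chartWarping E₁ f a) (extChartAt 𝓘(ℝ, E₁) a a) x =
        inner ℝ (prodDeriv E E₁ E₂ ι (a, b) (g, 0)) (prodDeriv E E₁ E₂ ι (a, b) (x, 0))) ∧
      gradNormSq E (𝓘(ℝ, E₁).prod 𝓘(ℝ, E₂)) ι (fun p ↦ Real.log (f p.1)) (a, b) =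
        ‖prodDeriv E E₁ E₂ ι (a, b) (g, 0)‖ ^ 2 := by
  obtain ⟨e, he⟩ := exists_isFrame (prodDeriv_injective hM a b)
  obtain ⟨G, hG⟩ := he.exists_gradient
    ((fderiv ℝ (chartWarping E₁ f a) (extChartAt 𝓘(ℝ, E₁) a a) : E₁ →ₗ[ℝ] ℝ) ∘ₗ
      LinearMap.fst ℝ E₁ E₂)
  have hex : ∃ w : TangentSpace (𝓘(ℝ, E₁).prod 𝓘(ℝ, E₂)) (a, b), ∀ v,
      inducedInner E (𝓘(ℝ, E₁).prod 𝓘(ℝ, E₂)) ι (a, b) w v =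
      tangentCoord 𝓘(ℝ, ℝ) (Real.log (f a)) (mfderiv (𝓘(ℝ, E₁).prod 𝓘(ℝ, E₂)) 𝓘(ℝ, ℝ)
        (fun p : N₁ × N₂ ↦ Real.log (f p.1)) (a, b) v) := by
    refine ⟨(tangentCoord _ _).symm G, fun v ↦ ?_⟩
    rw [mfderiv_log_warping hM]
    exact hG (tangentCoord (𝓘(ℝ, E₁).prod 𝓘(ℝ, E₂)) (a, b) v)
  have hspec := Classical.epsilon_spec hex
  obtain ⟨⟨g, t⟩, hgt⟩ : ∃ v, v = tangentCoord (𝓘(ℝ, E₁).prod 𝓘(ℝ, E₂)) (a, b)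
    (inducedGradient E (𝓘(ℝ, E₁).prod 𝓘(ℝ, E₂)) ι (fun p ↦ Real.log (f p.1)) (a, b)) := ⟨_, rfl⟩
  have h1 : ∀ v : E₁ × E₂, inner ℝ (prodDeriv E E₁ E₂ ι (a, b) (g, t))
      (prodDeriv E E₁ E₂ ι (a, b) v) =
      fderiv ℝ (chartWarping E₁ f a) (extChartAt 𝓘(ℝ, E₁) a a) v.1 := by
    intro v
    rw [hgt]
    exact (hspec ((tangentCoord _ _).symm v)).trans (mfderiv_log_warping hM a b _)
  -- Since ln f depends only on the first factor, its gradient pairs to zero with its own vertical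
  -- component.
  have ht : prodDeriv E E₁ E₂ ι (a, b) (0, t) = 0 := by
    have h2 := h1 (0, t)
    rw [map_zero, inner_prodDeriv hM] at h2
    rw [← inner_self_eq_zero (𝕜 := ℝ), inner_prodDeriv hM]
    simpa using h2
  have hD : prodDeriv E E₁ E₂ ι (a, b) (g, t) = prodDeriv E E₁ E₂ ι (a, b) (g, 0) := by
    rw [SemiSlantPoint.map_eq_add g, ht, add_zero]
  refine ⟨g, fun x ↦ ?_, ?_⟩
  · rw [← hD, h1]
  · rw [← hD, ← real_inner_self_eq_norm_sq, hgt]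
    rfl

end Immersion

/-! ### The estimate and its equality case on the manifold. -/

section Estimate

variable {E : Type*} [NormedAddCommGroup E] [NormedSpace ℝ E] [FiniteDimensional ℝ E]
  {M : Type*} [TopologicalSpace M] [ChartedSpace E M] [IsManifold 𝓘(ℝ, E) ∞ M]
  [RiemannianBundle (fun p : M ↦ TangentSpace 𝓘(ℝ, E) p)]
  {E₁ : Type*} [NormedAddCommGroup E₁] [NormedSpace ℝ E₁]
  {N₁ : Type*} [TopologicalSpace N₁] [ChartedSpace E₁ N₁]
  [RiemannianBundle (fun p : N₁ ↦ TangentSpace 𝓘(ℝ, E₁) p)]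
  {E₂ : Type*} [NormedAddCommGroup E₂] [NormedSpace ℝ E₂]
  {N₂ : Type*} [TopologicalSpace N₂] [ChartedSpace E₂ N₂]
  [RiemannianBundle (fun p : N₂ ↦ TangentSpace 𝓘(ℝ, E₂) p)]
  {S : AlmostContactMetricStructure E M} {f : N₁ → ℝ} {ι : N₁ × N₂ → M} {θ : ℝ}

theorem exists_semiSlantPoint
    [IsContMDiffRiemannianBundle 𝓘(ℝ, E) ∞ E (fun p : M ↦ TangentSpace 𝓘(ℝ, E) p)]
    [IsManifold 𝓘(ℝ, E₁) ∞ N₁] [IsManifold 𝓘(ℝ, E₂) ∞ N₂]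
    (hS : S.IsNearlyCosymplectic) (hM : IsWarpedProductSemiSlant E E₁ E₂ S f ι θ)
    (a : N₁) (b : N₂) :
    ∃ (B : E₁ × E₂ →ₗ[ℝ] E₁ × E₂ →ₗ[ℝ] TangentSpace 𝓘(ℝ, E) (ι (a, b)))
      (ψ : TangentSpace 𝓘(ℝ, E) (ι (a, b)) → TangentSpace 𝓘(ℝ, E) (ι (a, b)) →
        TangentSpace 𝓘(ℝ, E) (ι (a, b)) → ℝ) (dΩ : E₁ → E₂ → E₂ → ℝ),
      (∀ v w, B v w = prodAmbientDeriv E E₁ E₂ ι a b v w) ∧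
      SemiSlantPoint (prodDeriv E E₁ E₂ ι (a, b)) B (S.φ (ι (a, b))).toLinearMap (S.ξ (ι (a, b)))
        (fderiv ℝ (chartWarping E₁ f a) (extChartAt 𝓘(ℝ, E₁) a a) : E₁ →ₗ[ℝ] ℝ) θ ψ dΩ := by
  have C := nearlyCosymplecticChart S hS (ι (a, b))
  have hu := contDiffAt_chartImmersion hM a b
  have hadd : ∀ v w w', prodAmbientDeriv E E₁ E₂ ι a b v (w + w') =
      prodAmbientDeriv E E₁ E₂ ι a b v w + prodAmbientDeriv E E₁ E₂ ι a b v w' := by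
    intro v w w'
    simp only [prodAmbientDeriv]
    rw [C.alongDeriv_add, map_add]
  have hsmul : ∀ (c : ℝ) v w, prodAmbientDeriv E E₁ E₂ ι a b v (c • w) =
      c • prodAmbientDeriv E E₁ E₂ ι a b v w := by
    intro c v w
    simp only [prodAmbientDeriv]
    rw [C.alongDeriv_smul, map_smul]
  have hsymm : ∀ v w, prodAmbientDeriv E E₁ E₂ ι a b v w = prodAmbientDeriv E E₁ E₂ ι a b w v := by
    intro v w
    simp only [prodAmbientDeriv]
    rw [C.alongDeriv_symm hu]
  refine ⟨LinearMap.mk₂ ℝ (prodAmbientDeriv E E₁ E₂ ι a b)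
    (fun v v' w ↦ by rw [hsymm, hadd, hsymm w, hsymm w])
    (fun c v w ↦ by rw [hsymm, hsmul, hsymm w]) hadd hsmul, _, _, fun v w ↦ rfl,
    semiSlantPoint_of_chart C (warpedChart hM a b) (chartImmersion_self ι a b)
      (tangentCoord 𝓘(ℝ, E) (ι (a, b))).symm.toLinearEquiv (fun v w ↦ chartMetric_self _ v w)
      (fun v ↦ prodDeriv_eq_fderiv hM a b v) (fun v w ↦ rfl) (fun v ↦ ?_) ?_
      (prodDeriv_injective hM a b) (fun x ↦ ?_) ?_ (sin_ne_zero_of_semiSlant hM a)⟩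
  · rw [chartMap_self]
    exact ((tangentCoord 𝓘(ℝ, E) (ι (a, b))).symm_apply_apply _).symm
  · rw [coordRep_self]
    exact ((tangentCoord 𝓘(ℝ, E) (ι (a, b))).symm_apply_apply _).symm
  · obtain ⟨w, hw⟩ := exists_map_leafDeriv₁ hM a b ((tangentCoord 𝓘(ℝ, E₁) a).symm x)
    rw [leafDeriv₁_eq hM, leafDeriv₁_eq hM, ContinuousLinearEquiv.apply_symm_apply] at hw
    exact ⟨_, hw⟩
  · obtain ⟨v, hv⟩ := exists_reeb_eq hM a b
    rw [leafDeriv₁_eq hM] at hv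
    exact ⟨_, hv⟩

variable [FiniteDimensional ℝ E₁] [FiniteDimensional ℝ E₂]

/-- The estimate at one point, and the consequences of equality there. -/
theorem secondFundamentalForm_estimate
    [IsContMDiffRiemannianBundle 𝓘(ℝ, E) ∞ E (fun p : M ↦ TangentSpace 𝓘(ℝ, E) p)]
    [IsManifold 𝓘(ℝ, E₁) ∞ N₁] [IsManifold 𝓘(ℝ, E₂) ∞ N₂]
    (hS : S.IsNearlyCosymplectic) (hM : IsWarpedProductSemiSlant E E₁ E₂ S f ι θ)
    (a : N₁) (b : N₂) :
    2 * Module.finrank ℝ E₂ * (1 / Real.sin θ) ^ 2 * (1 + 1 / 9 * Real.cos θ ^ 2) *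
        gradNormSq E (𝓘(ℝ, E₁).prod 𝓘(ℝ, E₂)) ι (fun p ↦ Real.log (f p.1)) (a, b) ≤
      secondFundamentalFormNormSq E (𝓘(ℝ, E₁).prod 𝓘(ℝ, E₂)) ι (a, b) ∧
    (secondFundamentalFormNormSq E (𝓘(ℝ, E₁).prod 𝓘(ℝ, E₂)) ι (a, b) =
      2 * Module.finrank ℝ E₂ * (1 / Real.sin θ) ^ 2 * (1 + 1 / 9 * Real.cos θ ^ 2) *
        gradNormSq E (𝓘(ℝ, E₁).prod 𝓘(ℝ, E₂)) ι (fun p ↦ Real.log (f p.1)) (a, b) →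
      (∀ v w, secondFundamentalForm E 𝓘(ℝ, E₁) (fun a' ↦ ι (a', b)) a v w = 0) ∧
      (∃ K, ∀ v w, secondFundamentalForm E 𝓘(ℝ, E₂) (fun b' ↦ ι (a, b')) b v w =
        inducedInner E 𝓘(ℝ, E₂) (fun b' ↦ ι (a, b')) b v w • K) ∧
      meanCurvature E (𝓘(ℝ, E₁).prod 𝓘(ℝ, E₂)) ι (a, b) = 0) := by
  obtain ⟨B, ψ, dΩ, hB, H⟩ := exists_semiSlantPoint hS hM a b
  obtain ⟨g, hg, hgrad⟩ := exists_gradient_log_warping hM a b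
  have he₀ : IsFrame (prodDeriv E E₁ E₂ ι (a, b)) (fun i ↦ tangentCoord _ _
      (orthonormalFrame E (𝓘(ℝ, E₁).prod 𝓘(ℝ, E₂)) ι (a, b) i)) :=
    isFrame_orthonormalFrame (prodDeriv_injective hM a b)
  have hN : ∀ v w, inner ℝ (normalProj E (𝓘(ℝ, E₁).prod 𝓘(ℝ, E₂)) ι (a, b) v)
      (prodDeriv E E₁ E₂ ι (a, b) w) = 0 := fun v w ↦ inner_normalPart ι (a, b) v _
  have hN' : ∀ v, ∃ w, v - normalProj E (𝓘(ℝ, E₁).prod 𝓘(ℝ, E₂)) ι (a, b) v =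
      prodDeriv E E₁ E₂ ι (a, b) w :=
    fun v ↦ exists_sub_normalPart_eq (I := 𝓘(ℝ, E₁).prod 𝓘(ℝ, E₂)) ι (a, b) v
  have hh : ∀ v w, secondFundamentalForm E (𝓘(ℝ, E₁).prod 𝓘(ℝ, E₂)) ι (a, b) v w =
      normalProj E (𝓘(ℝ, E₁).prod 𝓘(ℝ, E₂)) ι (a, b)
        (B (tangentCoord _ _ v) (tangentCoord _ _ w)) := by
    intro v w
    rw [secondFundamentalForm, ambientDeriv_prod hM, hB]
    rfl
  obtain ⟨hle, heq⟩ := H.sum_norm_sq_ge hN hN' he₀ hg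
  have hnorm : secondFundamentalFormNormSq E (𝓘(ℝ, E₁).prod 𝓘(ℝ, E₂)) ι (a, b) = _ :=
    Finset.sum_congr rfl fun i _ ↦ Finset.sum_congr rfl fun j _ ↦ by
      rw [real_inner_self_eq_norm_sq, hh]
  rw [hnorm, hgrad]
  refine ⟨hle, fun h ↦ ?_⟩
  obtain ⟨h₁, h₂⟩ := heq h
  -- The umbilicity vector is `-∇ ln f`. It is tangent to `M` but normal to the slant leaf, so
  -- umbilic leaves are compatible with h vanishing on vertical pairs.
  refine ⟨fun v w ↦ ?_, ⟨-prodDeriv E E₁ E₂ ι (a, b) (g, 0), fun v w ↦ ?_⟩, ?_⟩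
  · obtain ⟨t, ht⟩ := hN' (B (tangentCoord _ _ v, 0) (tangentCoord _ _ w, 0))
    rw [h₁, sub_zero] at ht
    obtain ⟨s, hs⟩ := H.exists_horizontal_eq ⟨t, ht⟩
    rw [secondFundamentalForm, ambientDeriv_leaf₁ hM, ← hB]
    refine normalPart_eq_of_sub_mem (fun w ↦ inner_zero_left _)
      ⟨(tangentCoord 𝓘(ℝ, E₁) a).symm s, ?_⟩
    have := leafDeriv₁_eq hM a b ((tangentCoord 𝓘(ℝ, E₁) a).symm s)
    rw [ContinuousLinearEquiv.apply_symm_apply, ← hs] at this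
    exact this.trans (sub_zero _).symm
  · obtain ⟨t, ht⟩ := hN' (B (0, tangentCoord _ _ v) (0, tangentCoord _ _ w))
    rw [h₂, sub_zero] at ht
    obtain ⟨s, hs⟩ := H.exists_vertical_eq hg ⟨t, ht⟩
    have hvw : inducedInner E 𝓘(ℝ, E₂) (fun b' ↦ ι (a, b')) b v w =
        inner ℝ (leafDeriv₂ E ι a b v) (leafDeriv₂ E ι a b w) := rfl
    rw [secondFundamentalForm, ambientDeriv_leaf₂ hM, ← hB, hvw, leafDeriv₂_eq hM,
      leafDeriv₂_eq hM, smul_neg, ← neg_smul]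
    refine normalPart_eq_of_sub_mem (fun w ↦ ?_) ⟨(tangentCoord 𝓘(ℝ, E₂) b).symm s, ?_⟩
    · have h3 : inner ℝ (prodDeriv E E₁ E₂ ι (a, b) (g, 0)) (leafDeriv₂ E ι a b w) = 0 := by
        rw [leafDeriv₂_eq hM, H.orthogonal]
      refine (real_inner_smul_left _ _ _).trans ?_
      rw [mul_eq_zero]
      exact .inr h3
    · have := leafDeriv₂_eq hM a b ((tangentCoord 𝓘(ℝ, E₂) b).symm s)
      rw [ContinuousLinearEquiv.apply_symm_apply, ← hs] at this
      exact this
  · have h3 := H.sum_normal_diag_eq_zero he₀ h₁ h₂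
    rw [meanCurvature]
    simp only [hh]
    rw [h3, smul_zero]

end Estimate

end WarpedSemiSlant

end

theorem theorem3p5
    {E : Type*} [NormedAddCommGroup E] [NormedSpace ℝ E] [FiniteDimensional ℝ E]
    {M : Type*} [TopologicalSpace M] [ChartedSpace E M] [IsManifold 𝓘(ℝ, E) ∞ M]
    [RiemannianBundle (fun p : M ↦ TangentSpace 𝓘(ℝ, E) p)]
    [IsContMDiffRiemannianBundle 𝓘(ℝ, E) ∞ E (fun p : M ↦ TangentSpace 𝓘(ℝ, E) p)]
    {E₁ : Type*} [NormedAddCommGroup E₁] [NormedSpace ℝ E₁] [FiniteDimensional ℝ E₁]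
    {NT : Type*} [TopologicalSpace NT] [ChartedSpace E₁ NT] [IsManifold 𝓘(ℝ, E₁) ∞ NT]
    [RiemannianBundle (fun p : NT ↦ TangentSpace 𝓘(ℝ, E₁) p)]
    [IsContMDiffRiemannianBundle 𝓘(ℝ, E₁) ∞ E₁ (fun p : NT ↦ TangentSpace 𝓘(ℝ, E₁) p)]
    {E₂ : Type*} [NormedAddCommGroup E₂] [NormedSpace ℝ E₂] [FiniteDimensional ℝ E₂]
    {Nθ : Type*} [TopologicalSpace Nθ] [ChartedSpace E₂ Nθ] [IsManifold 𝓘(ℝ, E₂) ∞ Nθ]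
    [RiemannianBundle (fun p : Nθ ↦ TangentSpace 𝓘(ℝ, E₂) p)]
    [IsContMDiffRiemannianBundle 𝓘(ℝ, E₂) ∞ E₂ (fun p : Nθ ↦ TangentSpace 𝓘(ℝ, E₂) p)]
    (S : WarpedSemiSlant.AlmostContactMetricStructure E M) (hS : S.IsNearlyCosymplectic)
    (f : NT → ℝ) (ι : NT × Nθ → M) (θ : ℝ)
    (hM : WarpedSemiSlant.IsWarpedProductSemiSlant E E₁ E₂ S f ι θ)
    (q : ℕ) (hq : Module.finrank ℝ E₂ = 2 * q) :
    (∀ x : NT × Nθ,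
      WarpedSemiSlant.secondFundamentalFormNormSq E (𝓘(ℝ, E₁).prod 𝓘(ℝ, E₂)) ι x ≥
        4 * q * (1 / Real.sin θ) ^ 2 * (1 + 1 / 9 * Real.cos θ ^ 2) *
          WarpedSemiSlant.gradNormSq E (𝓘(ℝ, E₁).prod 𝓘(ℝ, E₂)) ι
            (fun p ↦ Real.log (f p.1)) x) ∧
    ((∀ x : NT × Nθ,
      WarpedSemiSlant.secondFundamentalFormNormSq E (𝓘(ℝ, E₁).prod 𝓘(ℝ, E₂)) ι x =
        4 * q * (1 / Real.sin θ) ^ 2 * (1 + 1 / 9 * Real.cos θ ^ 2) *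
          WarpedSemiSlant.gradNormSq E (𝓘(ℝ, E₁).prod 𝓘(ℝ, E₂)) ι
            (fun p ↦ Real.log (f p.1)) x) →
      (∀ b, WarpedSemiSlant.IsTotallyGeodesic E 𝓘(ℝ, E₁) (fun a ↦ ι (a, b))) ∧
      (∀ a, WarpedSemiSlant.IsTotallyUmbilical E 𝓘(ℝ, E₂) (fun b ↦ ι (a, b))) ∧
      WarpedSemiSlant.IsMinimal E (𝓘(ℝ, E₁).prod 𝓘(ℝ, E₂)) ι) := by
  have hc : (2 : ℝ) * Module.finrank ℝ E₂ = 4 * q := by rw [hq]; push_cast; ring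
  have key := WarpedSemiSlant.secondFundamentalForm_estimate hS hM
  rw [hc] at key
  refine ⟨fun x ↦ (key x.1 x.2).1, fun h ↦ ⟨fun b a ↦ ((key a b).2 (h (a, b))).1,
    fun a ↦ WarpedSemiSlant.isTotallyUmbilical_of_forall_exists
      fun b ↦ ((key a b).2 (h (a, b))).2.1, fun x ↦ ((key x.1 x.2).2 (h x)).2.2⟩⟩
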